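/- Let $M$ be a (finite-dimensional, Hausdorff, $\sigma$-compact, boundaryless) smooth manifold and $Z\to M$ a smooth one-dimensional affine bundle modelled on the trivial vector bundle $M\times\mathbb R$, so that $C^\infty(M)$ acts on the set $\mathrm{Sec}(Z)$ of smooth sections by translations. An affine derivation is a map $D:\mathrm{Sec}(Z)\to C^\infty(M)$ with $D(a+f)=D(a)+\widehat D(f)$ for all $a\in\mathrm{Sec}(Z)$, $f\in C^\infty(M)$, where $\widehat D$ is a derivation of the algebra $C^\infty(M)$. Let $\bigwedge^n\mathrm{AffDer}(Z,\mathbb R)$ be the space of skew-symmetric maps $\mathrm{Sec}(Z)^n\to C^\infty(M)$ that are affine derivations in each argument (so it is $C^\infty(M)$ for $n=0$, and it is set to be $0$ for $n<0$), and let $\bigwedge\mathrm{AffDer}(Z,\mathbb R)=\bigoplus_{n}\bigwedge^n\mathrm{AffDer}(Z,\mathbb R)$, with the wedge product $$(D\wedge D')(s_1,\dots,s_{n+k})=\frac1{n!\,k!}\sum_{\tau\in S_{n+k}}\mathrm{sgn}(\tau)\,D(s_{\tau(1)},\dots,s_{\tau(n)})\,D'(s_{\tau(n+1)},\dots,s_{\tau(n+k)}).$$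 (1) There is exactly one bilinear bracket on $\bigwedge\mathrm{AffDer}(Z,\mathbb R)$ which, together with the wedge product, makes it a Gerstenhaber algebra (an associative, unital, graded-commutative algebra with a bracket of degree $-1$ that is a graded Lie bracket for the shifted grading and satisfies $[a,b\wedge c]=[a,b]\wedge c+(-1)^{(|a|-1)|b|}b\wedge[a,c]$), and which satisfies $[D_1,D_2]=\widehat D_1\circ D_2-\widehat D_2\circ D_1$ and $[D,f]=\widehat D(f)$ for affine derivations $D,D_1,D_2$ and $f\in C^\infty(M)$. Likewise the classical Schouten–Nijenhuis bracket $[\cdot,\cdot]^{SN}$ of multivector fields is the unique bracket on $\mathrm{Sec}(\bigwedge\mathrm TM)$ which makes it a Gerstenhaber algebra with the wedge product and extends the Lie bracket of vector fields and $[X,f]=X(f)$. (2) Let $\sigma$ be a smooth section of $Z$. The formula $$D_{(X_n,X_{n-1})}(\sigma+f_1,\dots,\sigma+f_n)=\langle X_n,df_1\wedge\dots\wedge df_n\rangle+\sum_{i=1}^n(-1)^i\langle X_{n-1},df_1\wedge\dots\wedge\widehat{df_i}\wedge\dots\wedge df_n\rangle$$ (the hat denotes omission, and $\langle v_1\wedge\dots\wedge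 v_n,\alpha_1\wedge\dots\wedge\alpha_n\rangle=\det(\alpha_j(v_i))$) defines a linear isomorphism $(X_n,X_{n-1})\mapsto D_{(X_n,X_{n-1})}$ from $\mathrm{Sec}(\bigwedge^n\mathrm TM)\times\mathrm{Sec}(\bigwedge^{n-1}\mathrm TM)$ onto $\bigwedge^n\mathrm{AffDer}(Z,\mathbb R)$ for every $n$. With this identification the wedge product is $$(X_n,X_{n-1})\wedge(Y_k,Y_{k-1})=(X_n\wedge Y_k,\;X_{n-1}\wedge Y_k+(-1)^nX_n\wedge Y_{k-1})$$ and the bracket of (1) is $$[(X_n,X_{n-1}),(Y_k,Y_{k-1})]=([X_n,Y_k]^{SN},\;[X_{n-1},Y_k]^{SN}+(-1)^{n-1}[X_n,Y_{k-1}]^{SN}).$$ -/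

import Mathlib

open Bundle Manifold Function
open scoped Manifold Bundle ContDiff DirectSum

noncomputable section

namespace AffGerst

/-! ### Gerstenhaber algebras -/

/-- `IsGerstenhaber 𝒜 mul br`: the real vector space `T`, graded by the subspaces `𝒜 i` (`i : ℤ`),
with product `mul` and bracket `br`, is a Gerstenhaber algebra: an associative, unital,
graded-commutative algebra with a bracket of degree `-1` that is a graded Lie bracket for the
shifted grading and such that `br a` is a derivation of degree `i - 1` for `a ∈ 𝒜 i`. -/
structure IsGerstenhaber {T : Type*} [AddCommGroup T] [Module ℝ T] (𝒜 : ℤ → Submodule ℝ T)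
    (mul br : T →ₗ[ℝ] T →ₗ[ℝ] T) : Prop where
  isInternal : DirectSum.IsInternal 𝒜
  mul_mem : ∀ i j : ℤ, ∀ a ∈ 𝒜 i, ∀ b ∈ 𝒜 j, mul a b ∈ 𝒜 (i + j)
  mul_assoc : ∀ a b c : T, mul (mul a b) c = mul a (mul b c)
  unit : ∃ e ∈ 𝒜 0, ∀ a : T, mul e a = a ∧ mul a e = a
  mul_comm : ∀ i j : ℤ, ∀ a ∈ 𝒜 i, ∀ b ∈ 𝒜 j, mul a b = (i * j).negOnePow • mul b a
  br_mem : ∀ i j : ℤ, ∀ a ∈ 𝒜 i, ∀ b ∈ 𝒜 j, br a b ∈ 𝒜 (i + j - 1)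
  br_skew : ∀ i j : ℤ, ∀ a ∈ 𝒜 i, ∀ b ∈ 𝒜 j,
    br a b = -(((i - 1) * (j - 1)).negOnePow • br b a)
  jacobi : ∀ i j k : ℤ, ∀ a ∈ 𝒜 i, ∀ b ∈ 𝒜 j, ∀ c ∈ 𝒜 k,
    br a (br b c) = br (br a b) c + ((i - 1) * (j - 1)).negOnePow • br b (br a c)
  leibniz : ∀ i j k : ℤ, ∀ a ∈ 𝒜 i, ∀ b ∈ 𝒜 j, ∀ c ∈ 𝒜 k,
    br a (mul b c) = mul (br a b) c + ((i - 1) * j).negOnePow • mul b (br a c)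

/-- The `ℤ`-grading of a direct sum `⨁ n : ℕ, A n`, with zero components in negative degrees. -/
def intGrading (A : ℕ → Type*) [∀ n, AddCommGroup (A n)] [∀ n, Module ℝ (A n)] :
    ℤ → Submodule ℝ (⨁ n, A n)
  | Int.ofNat n => LinearMap.range (DirectSum.lof ℝ ℕ A n)
  | Int.negSucc _ => ⊥

section Manifold

variable (E : Type*) [NormedAddCommGroup E] [NormedSpace ℝ E]
  (M : Type*) [TopologicalSpace M] [ChartedSpace E M]

/-- The algebra `C^∞(M)` of smooth real functions. -/
abbrev Smooth : Type _ := C^∞⟮𝓘(ℝ, E), M; ℝ⟯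

variable {M}

/-- The tangent space `T_pM`. -/
abbrev Tan (p : M) : Type _ := TangentSpace 𝓘(ℝ, E) p

/-- The exterior algebra `⋀ T_pM`. -/
abbrev ExtTan (p : M) : Type _ := ExteriorAlgebra ℝ (Tan E p)

variable {E}

/-- The differential of a smooth function at `p`, a covector. -/
def dAt (f : Smooth E M) (p : M) : Tan E p →ₗ[ℝ] ℝ :=
  (mfderiv 𝓘(ℝ, E) 𝓘(ℝ, ℝ) f p).toLinearMap

/-- The pairing `⟨x, α₁ ∧ ⋯ ∧ αₙ⟩` of `x ∈ ⋀ V` with covectors, normalised by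
`⟨v₁ ∧ ⋯ ∧ vₙ, α₁ ∧ ⋯ ∧ αₙ⟩ = det (αⱼ (vᵢ))`; it only sees the component of degree `n` of `x`. -/
def extPairing {V : Type*} [AddCommGroup V] [Module ℝ V] {n : ℕ} (α : Fin n → V →ₗ[ℝ] ℝ) :
    ExteriorAlgebra ℝ V →ₗ[ℝ] ℝ :=
  ExteriorAlgebra.liftAlternating
    (Pi.single n ((Matrix.detRowAlternating (n := Fin n) (R := ℝ)).compLinearMap
      (LinearMap.pi α)))

variable [IsManifold 𝓘(ℝ, E) ∞ M]

variable (E) in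
/-- The map `⋀ T_pM → ⋀ E` induced by the local trivialization of `TM` around `p₀`. -/
def extTriv (p₀ p : M) : ExtTan E p →ₐ[ℝ] ExteriorAlgebra ℝ E :=
  ExteriorAlgebra.map ((trivializationAt E (TangentSpace 𝓘(ℝ, E)) p₀).linearMapAt ℝ p)

/-- Smoothness of a section of `⋀ TM`: read in the local trivializations, it is a smooth map into
the finite-dimensional vector space `⋀ E`, that is, all its components are smooth. -/
def IsSmoothMultivector (X : ∀ p : M, ExtTan E p) : Prop :=
  ∀ (p₀ : M) (l : ExteriorAlgebra ℝ E →ₗ[ℝ] ℝ),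
    ContMDiffAt 𝓘(ℝ, E) 𝓘(ℝ, ℝ) ∞ (fun p => l (extTriv E p₀ p (X p))) p₀

variable [FiniteDimensional ℝ E]

variable (E M) in
/-- The algebra `Sec(⋀ TM)` of multivector fields: smooth sections of `⋀ TM`, with the pointwise
wedge product. -/
def Multivector : Subalgebra ℝ (∀ p : M, ExtTan E p) where
  carrier := {X | IsSmoothMultivector X}
  mul_mem' {X Y} hX hY p₀ l := by
    let b := (Module.finBasis ℝ E).ExteriorAlgebra
    have h : ∀ x y : ExteriorAlgebra ℝ E,
        l (x * y) = ∑ i, ∑ j, b.coord i x * b.coord j y * l (b i * b j) := by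
      intro x y
      conv_lhs => rw [← b.sum_repr x, ← b.sum_repr y]
      rw [Finset.sum_mul_sum, map_sum]
      refine Finset.sum_congr rfl fun i _ => ?_
      rw [map_sum]
      refine Finset.sum_congr rfl fun j _ => ?_
      rw [smul_mul_smul_comm, map_smul, smul_eq_mul]
      rfl
    have e : (fun p => l (extTriv E p₀ p ((X * Y) p))) = fun p =>
        ∑ i, ∑ j, b.coord i (extTriv E p₀ p (X p)) * b.coord j (extTriv E p₀ p (Y p)) *
          l (b i * b j) := by
      funext p
      rw [Pi.mul_apply, map_mul, h]
    rw [e]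
    refine contMDiffAt_finsetSum fun i _ => contMDiffAt_finsetSum fun j _ => ?_
    exact ((hX p₀ (b.coord i)).mul (hY p₀ (b.coord j))).mul contMDiffAt_const
  add_mem' {X Y} hX hY p₀ l := by
    simp only [Pi.add_apply, map_add]
    exact (hX p₀ l).add (hY p₀ l)
  algebraMap_mem' r p₀ l := by
    simpa using contMDiffAt_const

variable (E M) in
/-- `Sec(⋀ⁿ TM)` as a subspace of `Sec(⋀ TM)`; it is zero for `n < 0`. -/
def multivectorGrading : ℤ → Submodule ℝ (Multivector E M)
  | Int.ofNat n =>
    { carrier := {X | ∀ p, X.1 p ∈ ⋀[ℝ]^n (Tan E p)}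
      add_mem' := fun hX hY p => add_mem (hX p) (hY p)
      zero_mem' := fun _ => zero_mem _
      smul_mem' := fun r _ hX p => Submodule.smul_mem _ r (hX p) }
  | Int.negSucc _ => ⊥

/-- The wedge product of multivector fields. -/
def multivectorWedge : Multivector E M →ₗ[ℝ] Multivector E M →ₗ[ℝ] Multivector E M :=
  LinearMap.mul ℝ (Multivector E M)

/-- `br` is the classical Schouten–Nijenhuis bracket of multivector fields: the Gerstenhaber
bracket on `Sec(⋀ TM)` that extends the Lie bracket of vector fields and the action of vector
fields on functions. -/
structure IsSchoutenNijenhuis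
    (br : Multivector E M →ₗ[ℝ] Multivector E M →ₗ[ℝ] Multivector E M) : Prop where
  gerstenhaber : IsGerstenhaber (multivectorGrading E M) multivectorWedge br
  br_vectorField : ∀ (X Y : Multivector E M) (V W : ∀ p : M, Tan E p),
    (∀ p, X.1 p = ExteriorAlgebra.ι ℝ (V p)) → (∀ p, Y.1 p = ExteriorAlgebra.ι ℝ (W p)) →
    ∀ p, (br X Y).1 p = ExteriorAlgebra.ι ℝ (VectorField.mlieBracket 𝓘(ℝ, E) V W p)
  br_function : ∀ (X F : Multivector E M) (V : ∀ p : M, Tan E p) (f : Smooth E M),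
    (∀ p, X.1 p = ExteriorAlgebra.ι ℝ (V p)) → (∀ p, F.1 p = algebraMap ℝ _ (f p)) →
    ∀ p, (br X F).1 p = algebraMap ℝ _ (dAt f p (V p))

end Manifold

section AffineBundle

variable {E : Type*} [NormedAddCommGroup E] [NormedSpace ℝ E]
  {M : Type*} [TopologicalSpace M] [ChartedSpace E M]

/-- A smooth one-dimensional vectorially trivial affine bundle `Z → M`. Its fibres are affine lines
`Z p` over `ℝ`, so that the model vector bundle is `M × ℝ`. The local trivializations
`Z|_U ≅ U × ℝ` are affine on fibres, with linear part the identity, and differ by smooth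
translations. -/
class AffineLineBundle (E : Type*) [NormedAddCommGroup E] [NormedSpace ℝ E]
    {M : Type*} [TopologicalSpace M] [ChartedSpace E M]
    (Z : M → Type*) [∀ p, AddTorsor ℝ (Z p)] [TopologicalSpace (TotalSpace ℝ Z)]
    [∀ p, TopologicalSpace (Z p)] [FiberBundle ℝ Z] : Prop where
  coord_vadd : ∀ (e : Trivialization ℝ (π ℝ Z)) [MemTrivializationAtlas e],
    ∀ p ∈ e.baseSet, ∀ (t : ℝ) (z : Z p),
      (e (TotalSpace.mk' ℝ p (t +ᵥ z))).2 = t + (e (TotalSpace.mk' ℝ p z)).2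
  smooth_coordChange : ∀ (e e' : Trivialization ℝ (π ℝ Z)) [MemTrivializationAtlas e]
    [MemTrivializationAtlas e'],
    ContMDiffOn 𝓘(ℝ, E) 𝓘(ℝ, ℝ) ∞ (fun p : M => (e' (e.toOpenPartialHomeomorph.symm (p, 0))).2)
      (e.baseSet ∩ e'.baseSet)

variable (E) (Z : M → Type*) [∀ p, AddTorsor ℝ (Z p)] [TopologicalSpace (TotalSpace ℝ Z)]
  [∀ p, TopologicalSpace (Z p)] [FiberBundle ℝ Z] [AffineLineBundle E Z]

/-- `Sec(Z)`: the smooth sections of `Z`. -/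
def Sec : Type _ :=
  {s : ∀ p, Z p // ContMDiff 𝓘(ℝ, E) (𝓘(ℝ, E).prod 𝓘(ℝ, ℝ)) ∞
    (fun p => TotalSpace.mk' ℝ p (s p))}

/-- The action of `C^∞(M)`, the space of sections of the model bundle, on `Sec(Z)` by translations:
`(f + s)(p) = f(p) + s(p)`. -/
instance : AddAction (Smooth E M) (Sec E Z) where
  vadd f s := ⟨fun p => f p +ᵥ s.1 p, fun p₀ => by
    have hs := (Bundle.contMDiffAt_section (IB := 𝓘(ℝ, E)) (F := ℝ) (s := s.1) p₀).1 (s.2 p₀)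
    rw [Bundle.contMDiffAt_section]
    refine ((f.contMDiff p₀).add hs).congr_of_eventuallyEq ?_
    filter_upwards [(trivializationAt ℝ Z p₀).open_baseSet.mem_nhds
      (FiberBundle.mem_baseSet_trivializationAt' p₀)] with p hp
    exact AffineLineBundle.coord_vadd E (trivializationAt ℝ Z p₀) p hp _ _⟩
  zero_vadd s := Subtype.ext (funext fun p => zero_vadd ℝ (s.1 p))
  add_vadd f g s := Subtype.ext (funext fun p => add_vadd (f p) (g p) (s.1 p))

variable {E Z}

/-- `D : Sec(Z) → C^∞(M)` is an affine derivation: an affine map whose linear part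
`δ : C^∞(M) → C^∞(M)` is a derivation. -/
def IsAffineDerivation (D : Sec E Z → Smooth E M) : Prop :=
  ∃ δ : Derivation ℝ (Smooth E M) (Smooth E M), ∀ (a : Sec E Z) (f : Smooth E M),
    D (f +ᵥ a) = D a + δ f

/-- The linear part `f ↦ D(a + f) - D(a)` of an affine map `D`; it does not depend on `a`. -/
def linearPart (D : Sec E Z → Smooth E M) (a : Sec E Z) (f : Smooth E M) : Smooth E M :=
  D (f +ᵥ a) - D a

lemma IsAffineDerivation.zero : IsAffineDerivation (fun _ : Sec E Z => 0) :=
  ⟨0, fun a f => by simp⟩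

lemma IsAffineDerivation.add {D D' : Sec E Z → Smooth E M} (h : IsAffineDerivation D)
    (h' : IsAffineDerivation D') : IsAffineDerivation (fun s => D s + D' s) := by
  obtain ⟨δ, hδ⟩ := h
  obtain ⟨δ', hδ'⟩ := h'
  exact ⟨δ + δ', fun a f => by simp only [hδ, hδ', Derivation.add_apply]; abel⟩

lemma IsAffineDerivation.mul {D : Sec E Z → Smooth E M} (h : IsAffineDerivation D)
    (g : Smooth E M) : IsAffineDerivation (fun s => g * D s) := by
  obtain ⟨δ, hδ⟩ := h
  exact ⟨g • δ, fun a f => by simp only [hδ, Derivation.smul_apply, smul_eq_mul, mul_add]⟩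

lemma IsAffineDerivation.smul {D : Sec E Z → Smooth E M} (h : IsAffineDerivation D)
    (r : ℝ) : IsAffineDerivation (fun s => r • D s) := by
  obtain ⟨δ, hδ⟩ := h
  exact ⟨r • δ, fun a f => by simp only [hδ, Derivation.smul_apply, smul_add]⟩

lemma IsAffineDerivation.units_smul {D : Sec E Z → Smooth E M} (h : IsAffineDerivation D)
    (u : ℤˣ) : IsAffineDerivation (fun s => u • D s) := by
  rcases Int.units_eq_one_or u with rfl | rfl
  · simpa using h
  · simpa using h.smul (-1)

lemma IsAffineDerivation.sum {ι : Type*} (t : Finset ι) {D : ι → Sec E Z → Smooth E M}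
    (h : ∀ i, IsAffineDerivation (D i)) : IsAffineDerivation (fun s => ∑ i ∈ t, D i s) := by
  classical
  induction t using Finset.induction_on with
  | empty => exact IsAffineDerivation.zero
  | insert i t hi ih => 
    convert (h i).add ih using 2
    exact Finset.sum_insert hi

variable (E Z) in
/-- `⋀ⁿ AffDer(Z, ℝ)`: the skew-symmetric maps `Sec(Z)ⁿ → C^∞(M)` that are affine derivations (in
particular affine) in each argument. For `n = 0` this is `C^∞(M)`. -/
def MultiAffDer (n : ℕ) : Submodule ℝ ((Fin n → Sec E Z) → Smooth E M) where
  carrier := {D |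
    (∀ (τ : Equiv.Perm (Fin n)) (s : Fin n → Sec E Z), D (s ∘ τ) = Equiv.Perm.sign τ • D s) ∧
    ∀ (i : Fin n) (s : Fin n → Sec E Z), IsAffineDerivation (fun a => D (update s i a))}
  add_mem' hD hD' := ⟨fun τ s => by simp only [Pi.add_apply, hD.1 τ s, hD'.1 τ s, smul_add],
    fun i s => (hD.2 i s).add (hD'.2 i s)⟩
  zero_mem' := ⟨fun τ s => by simp, fun i s => IsAffineDerivation.zero⟩
  smul_mem' r D hD := ⟨fun τ s => by
      simp only [Pi.smul_apply, hD.1 τ s]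
      exact smul_comm _ _ _,
    fun i s => (hD.2 i s).smul r⟩

/-- The term of the wedge product that belongs to a permutation `τ` of the arguments. -/
def wedgeTerm {n k : ℕ} (D : (Fin n → Sec E Z) → Smooth E M) (D' : (Fin k → Sec E Z) → Smooth E M)
    (τ : Equiv.Perm (Fin (n + k))) (s : Fin (n + k) → Sec E Z) : Smooth E M :=
  D (fun i => s (τ (Fin.castAdd k i))) * D' (fun j => s (τ (Fin.natAdd n j)))

lemma wedgeTerm_affine {n k : ℕ} (D : MultiAffDer E Z n) (D' : MultiAffDer E Z k)
    (τ : Equiv.Perm (Fin (n + k))) (i : Fin (n + k)) (s : Fin (n + k) → Sec E Z) :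
    IsAffineDerivation (fun a => wedgeTerm D.1 D'.1 τ (update s i a)) := by
  obtain ⟨j, rfl⟩ := τ.surjective i
  simp only [wedgeTerm, update_apply, EmbeddingLike.apply_eq_iff_eq]
  induction j using Fin.addCases with
  | left j =>
    have h := (D.2.2 j (fun i => s (τ (Fin.castAdd k i)))).mul
      (D'.1 (fun j => s (τ (Fin.natAdd n j))))
    convert h using 2 with a
    rw [mul_comm]
    congr 1
    · refine congrArg _ (funext fun l => if_neg fun h => ?_)
      have := congrArg Fin.val h
      simp at this
      omega
    · refine congrArg _ (funext fun l => ?_)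
      simp [update_apply]
  | right j =>
    have h := (D'.2.2 j (fun i => s (τ (Fin.natAdd n i)))).mul
      (D.1 (fun j => s (τ (Fin.castAdd k j))))
    convert h using 2 with a
    congr 1
    · refine congrArg _ (funext fun l => if_neg fun h => ?_)
      have := congrArg Fin.val h
      simp at this
      omega
    · refine congrArg _ (funext fun l => ?_)
      simp [update_apply]

/-- The wedge product of homogeneous elements,
`(D ∧ D')(s₁, …, sₙ₊ₖ) = 1/(n! k!) ∑_τ sgn(τ) D(s_τ(1), …, s_τ(n)) D'(s_τ(n+1), …, s_τ(n+k))`,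
which is the sum over `(n, k)`-shuffles. -/
def wedgeHom {n k : ℕ} (D : MultiAffDer E Z n) (D' : MultiAffDer E Z k) :
    MultiAffDer E Z (n + k) :=
  ⟨fun s => ((n.factorial : ℝ) * k.factorial)⁻¹ •
      ∑ τ : Equiv.Perm (Fin (n + k)), Equiv.Perm.sign τ • wedgeTerm D.1 D'.1 τ s, by
    refine ⟨fun ρ s => ?_, fun i s => ?_⟩
    · refine Eq.trans (congrArg _ ?_) (smul_comm _ (Equiv.Perm.sign ρ) _)
      rw [Finset.smul_sum]
      conv_rhs => rw [← Equiv.sum_comp (Equiv.mulLeft ρ)]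
      refine Finset.sum_congr rfl fun τ _ => ?_
      rw [Equiv.coe_mulLeft, Equiv.Perm.sign_mul, smul_smul, ← mul_assoc, Int.units_mul_self,
        one_mul]
      rfl
    · exact (IsAffineDerivation.sum _ fun τ => (wedgeTerm_affine D D' τ i s).units_smul _).smul _⟩

variable (E Z) in
/-- The graded space `⋀ AffDer(Z, ℝ) = ⨁ₙ ⋀ⁿ AffDer(Z, ℝ)`. -/
abbrev AffDerAlg : Type _ := ⨁ n : ℕ, MultiAffDer E Z n

/-- The homogeneous element of `⋀ AffDer(Z, ℝ)` given by an element of `⋀ⁿ AffDer(Z, ℝ)`. -/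
def homog (n : ℕ) : MultiAffDer E Z n →ₗ[ℝ] AffDerAlg E Z :=
  DirectSum.lof ℝ ℕ (fun n => MultiAffDer E Z n) n

/-- `wedgeHom` as a bilinear map. -/
def wedgeBilin (n k : ℕ) :
    MultiAffDer E Z n →ₗ[ℝ] MultiAffDer E Z k →ₗ[ℝ] MultiAffDer E Z (n + k) :=
  LinearMap.mk₂ ℝ wedgeHom
    (fun D₁ D₂ D' => Subtype.ext <| funext fun s => by
      simp [wedgeHom, wedgeTerm, add_mul, smul_add, Finset.sum_add_distrib])
    (fun r D D' => Subtype.ext <| funext fun s => by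
      simp [wedgeHom, wedgeTerm, smul_comm _ r, ← Finset.smul_sum])
    (fun D D₁ D₂ => Subtype.ext <| funext fun s => by
      simp [wedgeHom, wedgeTerm, mul_add, smul_add, Finset.sum_add_distrib])
    (fun r D D' => Subtype.ext <| funext fun s => by
      simp [wedgeHom, wedgeTerm, smul_comm _ r, ← Finset.smul_sum])

/-- The wedge product on `⋀ AffDer(Z, ℝ)`. -/
def affWedge : AffDerAlg E Z →ₗ[ℝ] AffDerAlg E Z →ₗ[ℝ] AffDerAlg E Z :=
  DirectSum.toModule ℝ ℕ _ fun n => LinearMap.flip <|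
    DirectSum.toModule ℝ ℕ _ fun k => LinearMap.flip <|
      (wedgeBilin n k).compr₂ (homog (n + k))

/-- `br` is the Schouten–Nijenhuis bracket of `⋀ AffDer(Z, ℝ)`: the Gerstenhaber bracket that
extends the bracket `[D₁, D₂] = D̂₁ ∘ D₂ - D̂₂ ∘ D₁` of affine derivations and the action
`[D, f] = D̂(f)` of affine derivations on functions through their linear parts `D̂`. -/
structure IsAffSchoutenNijenhuis
    (br : AffDerAlg E Z →ₗ[ℝ] AffDerAlg E Z →ₗ[ℝ] AffDerAlg E Z) : Prop where
  gerstenhaber : IsGerstenhaber (intGrading fun n => MultiAffDer E Z n) affWedge br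
  br_one_one : ∀ (D₁ D₂ : MultiAffDer E Z 1) (a : Sec E Z),
    ((br (homog 1 D₁) (homog 1 D₂)) 1).1 ![a] =
      linearPart (fun s => D₁.1 ![s]) a (D₂.1 ![a]) - linearPart (fun s => D₂.1 ![s]) a (D₁.1 ![a])
  br_one_zero : ∀ (D : MultiAffDer E Z 1) (F : MultiAffDer E Z 0) (a : Sec E Z),
    ((br (homog 1 D) (homog 0 F)) 0).1 ![] = linearPart (fun s => D.1 ![s]) a (F.1 ![])

variable [IsManifold 𝓘(ℝ, E) ∞ M] [FiniteDimensional ℝ E]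

/-- The value at `p` of the right-hand side of the formula
`⟨X, df₁ ∧ ⋯ ∧ dfₙ⟩ + ∑ᵢ (-1)ⁱ ⟨X', df₁ ∧ ⋯ (omit i) ⋯ ∧ dfₙ⟩` (`i = 1, …, n`). -/
def pairValue (X X' : Multivector E M) : (n : ℕ) → (Fin n → Smooth E M) → M → ℝ
  | 0, f, p => extPairing (fun j => dAt (f j) p) (X.1 p)
  | m + 1, f, p => extPairing (fun j => dAt (f j) p) (X.1 p) +
      ∑ i : Fin (m + 1), (-1 : ℝ) ^ ((i : ℕ) + 1) *
        extPairing (fun j : Fin m => dAt (f (i.succAbove j)) p) (X'.1 p)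

/-- `Φ` is the identification, by means of the section `σ`, of pairs `(X, X')` of multivector fields
with elements of `⋀ AffDer(Z, ℝ)`. -/
def IsIdentification (σ : Sec E Z)
    (Φ : (Multivector E M × Multivector E M) ≃ₗ[ℝ] AffDerAlg E Z) : Prop :=
  ∀ (X X' : Multivector E M) (n : ℕ) (f : Fin n → Smooth E M) (p : M),
    ((Φ (X, X')) n).1 (fun i => f i +ᵥ σ) p = pairValue X X' n f p

end AffineBundle

end AffGerst

end

/-! Fix a section `σ`; one exists by a partition of unity (`exists_sec`). It identifies `Sec(Z)`
with `C^∞(M)`, so that `⋀ⁿ AffDer(Z, ℝ)` becomes the space of skew maps of `n` functions that are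
affine derivations in each argument. Such maps of all degrees are handled together as functions on
lists of functions. The antisymmetrized product then becomes a shuffle product defined by the graded
Leibniz rule for insertion of a first argument (`antisymm_eq_shuffle`, `affVal_affWedge`), and its
algebra is done by induction on lists.

Skewness reduces the affine case to the linear one. If `L` is a skew affine multiderivation, then
`D' = -L(0, …)` vanishes when a further argument is `0`, hence is a multiderivation. Let `θ` be the
map of one argument that is constantly `1`. Then `D = L + θ ∧ D'` also vanishes when an argument is
`0`, so `L = D - θ ∧ D'` with `D` and `D'` multiderivations (`IsMultiAff.exists_decomposition`), and
the pair is unique (`Contraction.pairVal_injective`). Since `θ ∧ θ = 0` and `θ` is odd, the product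
of pairs is read off at once (`shuffle_sub_wedgeOne`).

Multiderivations of `C^∞(M)` are the same as multivector fields (`multivectorContraction_isFull`).
By Hadamard's lemma a derivation sees only the differential of a function at a point, so a
multiderivation is determined near a point by its values on coordinate functions, and a multivector
field with these values is written down in the coordinate frame. Degrees above the dimension do not
occur, because coordinates would repeat.

The Schouten–Nijenhuis bracket is built from its values: with `i_f` the contraction with `df` and
`ω` the grade involution, the rule `i_f [X, Y] = [i_f X, Y] - [ω X, i_f Y]` is a recursion for them,
starting from the component of degree `0`. The terms that obstruct linearity over functions cancel,
so the result is a multiderivation (`Contraction.isMultiDer_bracketVal`) and hence a multivector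
field. Each Gerstenhaber identity is inherited by the contractions of its two sides, so induction
reduces it to a direct check of components of degree `0`.

The bracket on pairs is defined by the formula to be proved. Its axioms are those of the
Schouten–Nijenhuis bracket with one entry lowered by one degree, up to parity checks
(`IsGerstenhaber.pair`); its values in degrees `0` and `1` are computed directly
(`affBracket_one_one`, `affBracket_one_zero`).

Uniqueness holds because both algebras are locally generated in degrees `0` and `1`. The difference
of two brackets with one entry fixed obeys a Leibniz rule and kills the generators; cutoff functions
make the argument local (`IsGerstenhaber.br_unique`). In particular the bracket does not depend on
`σ`, so the formula holds for every section. -/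

noncomputable section

namespace AffGerst

/-! ### Skew functions on lists -/

section SkewLists

variable {S A : Type*} [CommRing A]

/-- A function on lists that changes sign when two neighbouring entries are exchanged. -/
def IsSkew (L : List S → A) : Prop :=
  ∀ l a b l', L (l ++ a :: b :: l') = -L (l ++ b :: a :: l')

/-- Insertion of a first argument. -/
def ins (a : S) (L : List S → A) : List S → A := fun l => L (a :: l)

/-- The grade involution of functions on lists. -/
def gradeInv (L : List S → A) : List S → A := fun l => (-1) ^ l.length * L l

/-- `L` is supported on lists of length `n`. -/
def HasDeg (n : ℤ) (L : List S → A) : Prop := ∀ l, (l.length : ℤ) ≠ n → L l = 0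

lemma IsSkew.ins {L : List S → A} (h : IsSkew L) (a : S) : IsSkew (ins a L) :=
  fun l b c l' => h (a :: l) b c l'

/-- Bringing the inserted entry to the front takes `p` exchanges of neighbours. -/
lemma IsSkew.insertIdx {L : List S → A} (h : IsSkew L) (a : S) :
    ∀ (p : ℕ) (l : List S), p ≤ l.length → L (l.insertIdx p a) = (-1) ^ p * L (a :: l)
  | 0, l, _ => by simp
  | p + 1, [], hp => by simp at hp
  | p + 1, b :: l, hp => by
    have h1 := IsSkew.insertIdx (h.ins b) a p l (by simpa using hp)
    have h2 := h [] a b l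
    simp only [AffGerst.ins, List.nil_append] at h1 h2
    rw [List.insertIdx_succ_cons, h1, h2]
    ring

lemma HasDeg.ins {n : ℤ} {L : List S → A} (h : HasDeg n L) (a : S) :
    HasDeg (n - 1) (AffGerst.ins a L) := fun l hl => h _ (by simp; omega)

/-- The graded shuffle product of functions on lists. -/
def shuffle : (List S → A) → (List S → A) → List S → A
  | D, D', [] => D [] * D' []
  | D, D', a :: l => shuffle (ins a D) D' l + shuffle (gradeInv D) (ins a D') l

/-- As for the shuffle identities below, the induction is on the list with the functions quantified
inside, because the recursion replaces `D` by `ins a D` and by `gradeInv D`. -/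
lemma shuffle_add_left (l : List S) : ∀ D₁ D₂ D' : List S → A,
    shuffle (D₁ + D₂) D' l = shuffle D₁ D' l + shuffle D₂ D' l := by
  induction l with
  | nil => intros; simp [shuffle, add_mul]
  | cons a l ih =>
    intro D₁ D₂ D'
    have h1 : ins a (D₁ + D₂) = ins a D₁ + ins a D₂ := rfl
    have h2 : gradeInv (D₁ + D₂) = gradeInv D₁ + gradeInv D₂ := by
      funext l; simp [gradeInv, mul_add]
    simp only [shuffle, h1, h2, ih]
    ring

lemma shuffle_add_right (l : List S) : ∀ D D₁ D₂ : List S → A,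
    shuffle D (D₁ + D₂) l = shuffle D D₁ l + shuffle D D₂ l := by
  induction l with
  | nil => intros; simp [shuffle, mul_add]
  | cons a l ih =>
    intro D D₁ D₂
    have h1 : ins a (D₁ + D₂) = ins a D₁ + ins a D₂ := rfl
    simp only [shuffle, h1, ih]
    ring

lemma shuffle_smul_left (c : A) (l : List S) : ∀ D D' : List S → A,
    shuffle (c • D) D' l = c * shuffle D D' l := by
  induction l with
  | nil => intros; simp [shuffle, mul_assoc]
  | cons a l ih =>
    intro D D'
    have h1 : ins a (c • D) = c • ins a D := rfl
    have h2 : gradeInv (c • D) = c • gradeInv D := by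
      funext l; simp only [gradeInv, Pi.smul_apply, smul_eq_mul]; ring
    simp only [shuffle, h1, h2, ih]
    ring

lemma shuffle_smul_right (c : A) (l : List S) : ∀ D D' : List S → A,
    shuffle D (c • D') l = c * shuffle D D' l := by
  induction l with
  | nil => intros; simp only [shuffle, Pi.smul_apply, smul_eq_mul]; ring
  | cons a l ih =>
    intro D D'
    have h1 : ins a (c • D') = c • ins a D' := rfl
    simp only [shuffle, h1, ih]
    ring

lemma ins_gradeInv (a : S) (D : List S → A) :
    ins a (gradeInv D) = (-1 : A) • gradeInv (ins a D) := by
  funext l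
  simp only [gradeInv, ins, List.length_cons, Pi.smul_apply, smul_eq_mul]
  ring

lemma gradeInv_shuffle (l : List S) : ∀ D D' : List S → A,
    gradeInv (shuffle D D') l = shuffle (gradeInv D) (gradeInv D') l := by
  induction l with
  | nil => intros; simp [shuffle, gradeInv]
  | cons a l ih =>
    intro D D'
    simp only [shuffle, ins_gradeInv, shuffle_smul_left, shuffle_smul_right, ← ih]
    simp only [gradeInv, shuffle, List.length_cons]
    ring

/-- Insertion of `a` is an odd derivation of the product and `gradeInv` is multiplicative, so both
sides obey the same recursion. Neither skewness nor homogeneity is needed. -/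
lemma shuffle_assoc (l : List S) : ∀ D₁ D₂ D₃ : List S → A,
    shuffle (shuffle D₁ D₂) D₃ l = shuffle D₁ (shuffle D₂ D₃) l := by
  induction l with
  | nil => intros; simp [shuffle, mul_assoc]
  | cons a l ih =>
    intro D₁ D₂ D₃
    have h (D D' : List S → A) :
        ins a (shuffle D D') = shuffle (ins a D) D' + shuffle (gradeInv D) (ins a D') := rfl
    have h' : gradeInv (shuffle D₁ D₂) = shuffle (gradeInv D₁) (gradeInv D₂) :=
      funext fun l => gradeInv_shuffle l _ _
    simp only [shuffle, h, h', shuffle_add_left, shuffle_add_right, ih]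
    ring

lemma shuffle_hasDeg (l : List S) : ∀ (n k : ℤ) (D D' : List S → A), HasDeg n D → HasDeg k D' →
    (l.length : ℤ) ≠ n + k → shuffle D D' l = 0 := by
  induction l with
  | nil =>
    intro n k D D' hD hD' h
    rcases eq_or_ne n 0 with rfl | hn
    · rw [shuffle, hD' [] (by simp at h ⊢; omega), mul_zero]
    · rw [shuffle, hD [] (by simpa using hn.symm), zero_mul]
  | cons a l ih =>
    intro n k D D' hD hD' h
    have hi : HasDeg n (gradeInv D) := fun l hl => by simp [gradeInv, hD l hl]
    simp only [List.length_cons, Nat.cast_add, Nat.cast_one] at h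
    rw [shuffle, ih (n - 1) k _ _ (hD.ins a) hD' (by omega),
      ih n (k - 1) _ _ hi (hD'.ins a) (by omega),
      add_zero]

lemma HasDeg.gradeInv_eq {n : ℕ} {D : List S → A} (h : HasDeg n D) :
    gradeInv D = (-1 : A) ^ n • D := by
  funext l
  by_cases hl : (l.length : ℤ) = n
  · simp [gradeInv, Nat.cast_injective hl]
  · simp [gradeInv, h l hl]

lemma shuffle_zero_left (l : List S) (D' : List S → A) : shuffle (0 : List S → A) D' l = 0 := by
  have := shuffle_smul_left (0 : A) l 0 D'
  simpa using this

lemma shuffle_zero_right (l : List S) (D : List S → A) : shuffle D (0 : List S → A) l = 0 := by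
  have := shuffle_smul_right (0 : A) l D 0
  simpa using this

lemma HasDeg.ins_zero {D : List S → A} (h : HasDeg 0 D) (a : S) : AffGerst.ins a D = 0 :=
  funext fun l => h _ (by simp; omega)

/-- The antisymmetrization of `D ⊗ D'`, where `D` takes the first `n` arguments. -/
def antisymm (n N : ℕ) (D D' : List S → A) (s : Fin N → S) : A :=
  ∑ τ : Equiv.Perm (Fin N), ((Equiv.Perm.sign τ : ℤ) : A) *
    (D ((List.ofFn (s ∘ τ)).take n) * D' ((List.ofFn (s ∘ τ)).drop n))

end SkewLists

/-! ### Antisymmetrized products as shuffle products -/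

section Antisymm

variable {S A : Type*} [CommRing A]

lemma ofFn_insertNth {N : ℕ} (p : Fin (N + 1)) (a : S) (t : Fin N → S) :
    List.ofFn (p.insertNth a t : Fin (N + 1) → S) = (List.ofFn t).insertIdx p a := by
  induction N with
  | zero =>
    obtain rfl : p = 0 := Subsingleton.elim (α := Fin 1) _ _
    simp
  | succ N ih =>
    induction p using Fin.cases with
    | zero => simp
    | succ p =>
      rw [List.ofFn_succ, List.ofFn_succ (f := t), Fin.val_succ, List.insertIdx_succ_cons, ← ih]
      have h0 : (p.succ.insertNth a t : Fin (N + 2) → S) 0 = t 0 := by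
        rw [Fin.insertNth_apply_below (Fin.succ_pos p)]
        rfl
      rw [h0]
      congr 2
      funext i
      rcases Fin.eq_self_or_eq_succAbove p i with rfl | ⟨j, rfl⟩
      · simp
      · have h := Fin.insertNth_apply_succAbove (α := fun _ => S) p.succ a t j.succ
        rw [Fin.succ_succAbove_succ] at h
        simpa using h

lemma take_insertIdx_of_le (a : S) : ∀ (p n : ℕ) (l : List S), p ≤ n → p ≤ l.length →
    (l.insertIdx p a).take (n + 1) = (l.take n).insertIdx p a
  | 0, n, l, _, _ => by simp
  | p + 1, n + 1, b :: l, hn, hl => by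
    simp [take_insertIdx_of_le a p n l (by omega) (by simpa using hl)]

lemma drop_insertIdx_of_le (a : S) : ∀ (p n : ℕ) (l : List S), p ≤ n → p ≤ l.length →
    (l.insertIdx p a).drop (n + 1) = l.drop n
  | 0, n, l, _, _ => by simp
  | p + 1, n + 1, b :: l, hn, hl => by
    simp [drop_insertIdx_of_le a p n l (by omega) (by simpa using hl)]

lemma drop_insertIdx_of_ge (a : S) : ∀ (p n : ℕ) (l : List S), n ≤ p → p ≤ l.length →
    (l.insertIdx p a).drop n = (l.drop n).insertIdx (p - n) a
  | p, 0, l, _, _ => by simp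
  | p + 1, n + 1, b :: l, hn, hl => by
    simp [drop_insertIdx_of_ge a p n l (by omega) (by simpa using hl)]

/-- The permutations of `Fin (N + 1)`, sorted by the preimage of `0`. -/
lemma sum_perm_succ {N : ℕ} (F : Equiv.Perm (Fin (N + 1)) → A) :
    ∑ τ, F τ = ∑ p : Fin (N + 1), ∑ e : Equiv.Perm (Fin N),
      F (Equiv.Perm.decomposeFin.symm (0, e) * p.cycleRange) := by
  rw [← Fintype.sum_prod_type']
  symm
  refine Function.Bijective.sum_comp (g := F) (e := fun q : Fin (N + 1) × Equiv.Perm (Fin N) =>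
    Equiv.Perm.decomposeFin.symm (0, q.2) * q.1.cycleRange) ?_
  rw [Fintype.bijective_iff_injective_and_card]
  constructor
  · rintro ⟨p, e⟩ ⟨p', e'⟩ h
    -- The cycle moves `q` to `0` and the extension of `e` fixes `0`, so `q` is recovered as the
    -- preimage of `0`; injectivity together with a count gives bijectivity.
    have key (q : Fin (N + 1)) (e : Equiv.Perm (Fin N)) :
        (Equiv.Perm.decomposeFin.symm (0, e) * q.cycleRange) q = 0 := by
      simp [Fin.cycleRange_self]
    have hp : p = p' := by
      apply (Equiv.Perm.decomposeFin.symm (0, e) * p.cycleRange).injective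
      rw [key]
      simp only at h
      rw [h, key]
    subst hp
    have := mul_right_cancel h
    simpa using this
  · simp [Fintype.card_perm, Nat.factorial_succ]

lemma comp_decomposeFin {N : ℕ} (s : Fin (N + 1) → S) (p : Fin (N + 1)) (e : Equiv.Perm (Fin N)) :
    s ∘ (Equiv.Perm.decomposeFin.symm (0, e) * p.cycleRange : Equiv.Perm (Fin (N + 1))) =
      p.insertNth (s 0) ((fun i => s i.succ) ∘ e) := by
  rw [← Fin.cons_comp_cycleRange]
  funext i
  simp only [comp_apply, Equiv.Perm.coe_mul]
  generalize p.cycleRange i = j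
  induction j using Fin.cases with
  | zero => simp
  | succ j => simp

/-- Sort the permutations by the position `p` at which `s 0` lands. If `p < n`, moving it to the
front of the arguments of `D` costs `(-1)^p`, which cancels the sign of the cycle; there are `n`
such positions. Otherwise the move inside the arguments of `D'` costs `(-1)^(p-n)`, and `(-1)^n`
remains. For `n = 0` the truncated `n - 1` is harmless, since its coefficient vanishes. -/
lemma antisymm_succ {n N : ℕ} (hn : n ≤ N + 1) {D D' : List S → A} (hD : IsSkew D)
    (hD' : IsSkew D') (s : Fin (N + 1) → S) :
    antisymm n (N + 1) D D' s =
      n * antisymm (n - 1) N (ins (s 0) D) D' (fun i => s i.succ) +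
      (N + 1 - n) * (-1) ^ n * antisymm n N D (ins (s 0) D') (fun i => s i.succ) := by
  have hsum (x y : A) : ∑ p : Fin (N + 1), (if (p : ℕ) < n then x else y) =
      n * x + (N + 1 - n) * y := by
    rw [Fin.sum_univ_eq_sum_range (fun p => if p < n then x else y),
      ← Finset.sum_range_add_sum_Ico _ hn,
      Finset.sum_congr rfl (fun p hp => if_pos (Finset.mem_range.1 hp)),
      Finset.sum_congr rfl (fun p hp => if_neg (not_lt.2 (Finset.mem_Ico.1 hp).1))]
    simp [Nat.cast_sub hn]
  rw [mul_assoc, ← hsum, antisymm, sum_perm_succ]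
  refine Finset.sum_congr rfl fun p _ => ?_
  have hp := p.2
  split_ifs with h
  · rw [antisymm]
    refine Finset.sum_congr rfl fun e _ => ?_
    rw [comp_decomposeFin, ofFn_insertNth]
    obtain ⟨n, rfl⟩ : ∃ m, n = m + 1 := ⟨n - 1, by omega⟩
    rw [take_insertIdx_of_le _ _ _ _ (by omega) (by simp; omega),
      drop_insertIdx_of_le _ _ _ _ (by omega) (by simp; omega),
      hD.insertIdx _ _ _ (by simp; omega), Equiv.Perm.sign_mul, Fin.sign_cycleRange]
    have : ((-1 : A) ^ (p : ℕ)) * (-1) ^ (p : ℕ) = 1 := by rw [← mul_pow]; simp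
    simp only [Equiv.Perm.decomposeFin.symm_sign, if_true, one_mul, ins, Nat.add_sub_cancel]
    push_cast
    linear_combination ((Equiv.Perm.sign e : ℤ) : A) *
      D (s 0 :: (List.ofFn ((fun i => s i.succ) ∘ e)).take n) *
      D' ((List.ofFn ((fun i => s i.succ) ∘ e)).drop n) * this
  · rw [antisymm, Finset.mul_sum]
    refine Finset.sum_congr rfl fun e _ => ?_
    rw [comp_decomposeFin, ofFn_insertNth]
    rw [List.take_insertIdx_eq_take_of_le _ _ _ _ (by omega),
      drop_insertIdx_of_ge _ _ _ _ (by omega) (by simp; omega),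
      hD'.insertIdx _ _ _ (by simp; omega), Equiv.Perm.sign_mul, Fin.sign_cycleRange]
    have : ((-1 : A) ^ (p : ℕ)) * (-1) ^ ((p : ℕ) - n) = (-1) ^ n := by
      rw [← pow_add, show (p : ℕ) + (p - n) = n + 2 * (p - n) by omega, pow_add, pow_mul]
      simp
    simp only [Equiv.Perm.decomposeFin.symm_sign, if_true, one_mul, ins]
    push_cast
    linear_combination ((Equiv.Perm.sign e : ℤ) : A) *
      D ((List.ofFn ((fun i => s i.succ) ∘ e)).take n) *
      D' (s 0 :: (List.ofFn ((fun i => s i.succ) ∘ e)).drop n) * this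

/-- The antisymmetrization of a product is a multiple of the shuffle product. -/
lemma antisymm_eq_shuffle {N : ℕ} : ∀ (n k : ℕ) (_ : n + k = N) (D D' : List S → A) (_ : IsSkew D)
    (_ : IsSkew D') (_ : HasDeg n D) (_ : HasDeg k D') (s : Fin N → S),
    antisymm n N D D' s = (n.factorial * k.factorial : ℕ) * shuffle D D' (List.ofFn s) := by
  induction N with
  | zero =>
    intro n k h D D' _ _ _ _ s
    obtain ⟨rfl, rfl⟩ : n = 0 ∧ k = 0 := by omega
    simp [antisymm, shuffle]
  | succ N ih =>
    intro n k h D D' hD hD' hn hk s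
    rw [antisymm_succ (by omega) hD hD', List.ofFn_succ, shuffle, hn.gradeInv_eq,
      shuffle_smul_left]
    have hNn : (N + 1 - n : A) = k := by
      have : ((N + 1 : ℕ) : A) = ((n + k : ℕ) : A) := by rw [h]
      push_cast at this
      linear_combination this
    rw [hNn]
    have h1 : (n : A) * antisymm (n - 1) N (ins (s 0) D) D' (fun i => s i.succ) =
        (n.factorial * k.factorial : ℕ) *
          shuffle (ins (s 0) D) D' (List.ofFn fun i => s i.succ) := by
      rcases n with _ | n
      · rw [hn.ins_zero, shuffle_zero_left]; simp
      · rw [Nat.add_sub_cancel, ih n k (by omega) _ _ (hD.ins _) hD'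
          (by simpa using hn.ins (s 0)) hk, Nat.factorial_succ]
        push_cast; ring
    have h2 : (k : A) * antisymm n N D (ins (s 0) D') (fun i => s i.succ) =
        (n.factorial * k.factorial : ℕ) *
          shuffle D (ins (s 0) D') (List.ofFn fun i => s i.succ) := by
      rcases k with _ | k
      · rw [hk.ins_zero, shuffle_zero_right]; simp
      · rw [ih n k (by omega) _ _ hD (hD'.ins _) hn
          (by simpa using hk.ins (s 0)), Nat.factorial_succ]
        push_cast; ring
    linear_combination h1 + (-1) ^ n * h2

end Antisymm

/-! ### Multiderivations and affine multiderivations as functions on lists -/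

section WedgeOne

variable {A : Type*} [CommRing A]

/-- The wedge product with the function that is constantly `1` on lists of length one. -/
def wedgeOne : (List A → A) → List A → A
  | _, [] => 0
  | D, f :: l => D l - wedgeOne (ins f D) l

lemma wedgeOne_smul (a : A) (l : List A) : ∀ D : List A → A,
    wedgeOne (a • D) l = a * wedgeOne D l := by
  induction l with
  | nil => intro D; simp [wedgeOne]
  | cons f l ih =>
    intro D
    rw [wedgeOne, show ins f (a • D) = a • ins f D from rfl, ih, wedgeOne, Pi.smul_apply,
      smul_eq_mul, mul_sub]

lemma wedgeOne_add (l : List A) : ∀ D D' : List A → A,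
    wedgeOne (D + D') l = wedgeOne D l + wedgeOne D' l := by
  induction l with
  | nil => intro D; simp [wedgeOne]
  | cons f l ih =>
    intro D D'
    rw [wedgeOne, show ins f (D + D') = ins f D + ins f D' from rfl, ih, wedgeOne, wedgeOne,
      Pi.add_apply]
    ring

lemma wedgeOne_zero (l : List A) : wedgeOne (0 : List A → A) l = 0 := by
  have := wedgeOne_smul (0 : A) l 0
  simpa using this

lemma wedgeOne_hasDeg (l : List A) : ∀ {n : ℤ} {D : List A → A}, HasDeg n D →
    (l.length : ℤ) ≠ n + 1 → wedgeOne D l = 0 := by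
  induction l with
  | nil => intros; rfl
  | cons f l ih =>
    intro n D h hl
    simp only [List.length_cons, Nat.cast_add, Nat.cast_one] at hl
    rw [wedgeOne, h l (by omega), ih (h.ins f) (by omega), sub_zero]

/-- The constant form of degree one becomes the unit under insertion and changes sign under
`gradeInv`, so the shuffle recursion turns into that of `wedgeOne`. -/
lemma wedgeOne_eq_shuffle (l : List A) : ∀ D : List A → A,
    wedgeOne D l = shuffle (fun l => if l.length = 1 then 1 else 0) D l := by
  have h0 : ∀ (l : List A) (D : List A → A),
      shuffle (fun l => if l.length = 0 then 1 else 0) D l = D l := by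
    intro l
    induction l with
    | nil => intro D; simp [shuffle]
    | cons f l ih =>
      intro D
      have h1 : ins f (fun l : List A => if l.length = 0 then (1 : A) else 0) = 0 := by
        funext l; simp [ins]
      have h2 : gradeInv (fun l : List A => if l.length = 0 then (1 : A) else 0) =
          fun l : List A => if l.length = 0 then (1 : A) else 0 := by
        funext l; by_cases hl : l = [] <;> simp [gradeInv, hl]
      rw [shuffle, h1, h2, shuffle_zero_left, ih, zero_add]
      rfl
  induction l with
  | nil => intro D; simp [wedgeOne, shuffle]
  | cons f l ih =>
    intro D
    have h1 : ins f (fun l : List A => if l.length = 1 then (1 : A) else 0) =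
        fun l : List A => if l.length = 0 then (1 : A) else 0 := by
      funext l; simp [ins]
    have h2 : gradeInv (fun l : List A => if l.length = 1 then (1 : A) else 0) =
        (-1 : A) • fun l : List A => if l.length = 1 then (1 : A) else 0 := by
      funext l; by_cases hl : l.length = 1 <;> simp [gradeInv, hl]
    rw [wedgeOne, shuffle, h1, h2, h0, shuffle_smul_left, ih]
    ring

end WedgeOne

section MultiDer

variable {A : Type*} [CommRing A] [Algebra ℝ A]

/-- `φ` is the function underlying a derivation. -/
def IsDer (φ : A → A) : Prop := ∃ δ : Derivation ℝ A A, ∀ f, φ f = δ f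

lemma IsDer.add {φ ψ : A → A} : IsDer φ → IsDer ψ → IsDer fun f => φ f + ψ f
  | ⟨δ, h⟩, ⟨δ', h'⟩ => ⟨δ + δ', fun f => by simp [h, h']⟩

lemma IsDer.sub {φ ψ : A → A} : IsDer φ → IsDer ψ → IsDer fun f => φ f - ψ f
  | ⟨δ, h⟩, ⟨δ', h'⟩ => ⟨δ - δ', fun f => by simp [h, h']⟩

lemma IsDer.neg {φ : A → A} : IsDer φ → IsDer fun f => -φ f
  | ⟨δ, h⟩ => ⟨-δ, fun f => by simp [h]⟩

lemma IsDer.zero : IsDer fun _ : A => (0 : A) := ⟨0, fun _ => rfl⟩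

lemma IsDer.of_rules {φ : A → A} (add : ∀ f g, φ (f + g) = φ f + φ g)
    (smul : ∀ (r : ℝ) f, φ (r • f) = r • φ f) (mul : ∀ f g, φ (f * g) = f * φ g + g * φ f) :
    IsDer φ :=
  ⟨Derivation.mk' ⟨⟨φ, add⟩, smul⟩ mul, fun _ => rfl⟩

lemma IsDer.map_add {φ : A → A} : IsDer φ → ∀ f g, φ (f + g) = φ f + φ g
  | ⟨δ, h⟩, f, g => by simp [h]

lemma IsDer.map_smul {φ : A → A} : IsDer φ → ∀ (r : ℝ) f, φ (r • f) = r • φ f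
  | ⟨δ, h⟩, f, g => by simp [h]

lemma IsDer.map_mul {φ : A → A} : IsDer φ → ∀ f g, φ (f * g) = f * φ g + g * φ f
  | ⟨δ, h⟩, f, g => by simp [h]

lemma IsDer.map_zero {φ : A → A} : IsDer φ → φ 0 = 0
  | ⟨δ, h⟩ => by simp [h]

/-- A skew function on lists that is a derivation in each argument. -/
structure IsMultiDer (L : List A → A) : Prop where
  skew : IsSkew L
  der : ∀ l l', IsDer fun f => L (l ++ f :: l')

/-- A skew function on lists that is an affine derivation in each argument. -/
structure IsMultiAff (L : List A → A) : Prop where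
  skew : IsSkew L
  aff : ∀ l l', IsDer fun f => L (l ++ f :: l') - L (l ++ 0 :: l')

lemma IsMultiDer.ins {L : List A → A} (h : IsMultiDer L) (f : A) : IsMultiDer (ins f L) :=
  ⟨h.skew.ins f, fun l l' => h.der (f :: l) l'⟩

lemma IsMultiAff.ins {L : List A → A} (h : IsMultiAff L) (f : A) : IsMultiAff (ins f L) :=
  ⟨h.skew.ins f, fun l l' => h.aff (f :: l) l'⟩

lemma IsMultiDer.isMultiAff {L : List A → A} (h : IsMultiDer L) : IsMultiAff L where
  skew := h.skew
  aff l l' := by simpa [(h.der l l').map_zero] using h.der l l'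

lemma eq_zero_of_eq_neg {x : A} (h : x = -x) : x = 0 := by
  have h2 : (2 : ℝ) • x = 0 := by
    rw [two_smul]
    nth_rewrite 1 [h]
    simp
  simpa using h2

lemma IsSkew.eq_zero_of_duplicate {L : List A → A} (h : IsSkew L) (a : A) :
    ∀ l l' : List A, L (a :: l ++ a :: l') = 0
  | [], l' => eq_zero_of_eq_neg (h [] a a l')
  | b :: l, l' => by
    have h1 := h [] a b (l ++ a :: l')
    have h2 := IsSkew.eq_zero_of_duplicate (h.ins b) a l l'
    simp only [AffGerst.ins, List.nil_append, List.cons_append] at h1 h2 ⊢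
    rw [h1, h2, neg_zero]

/-- Skewness carries a `0` from any slot to the first one, so the constant term vanishes in every
argument. -/
lemma IsMultiAff.isMultiDer {L : List A → A} (h : IsMultiAff L) (h₀ : ∀ l, L (0 :: l) = 0) :
    IsMultiDer L where
  skew := h.skew
  der l l' := by
    have key : ∀ (l : List A) (L : List A → A), IsSkew L → (∀ l, L (0 :: l) = 0) →
        L (l ++ 0 :: l') = 0 := by
      intro l
      induction l with
      | nil => intro L _ h; exact h _
      | cons a l ih =>
        intro L hs h
        refine ih (AffGerst.ins a L) (hs.ins a) fun l => ?_
        rw [AffGerst.ins, ← List.nil_append (a :: 0 :: l), hs, List.nil_append, h, neg_zero]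
    simpa [key l L h.skew h₀] using h.aff l l'

lemma IsMultiDer.truncate {L : List A → A} (h : IsMultiDer L) (n : ℕ) :
    IsMultiDer fun l => if l.length = n then L l else 0 where
  skew l a b l' := by
    simp only [List.length_append, List.length_cons]
    split_ifs
    · exact h.skew l a b l'
    · simp
  der l l' := by
    by_cases hl : (l ++ 0 :: l').length = n
    · simp only [List.length_append, List.length_cons] at hl ⊢
      simpa [hl] using h.der l l'
    · simp only [List.length_append, List.length_cons] at hl ⊢
      simpa [hl] using IsDer.zero

lemma wedgeOne_zero_cons {D : List A → A} (h : IsMultiDer D) (l : List A) :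
    wedgeOne D (0 :: l) = D l := by
  have : ins 0 D = 0 := funext fun l => (h.der [] l).map_zero
  rw [wedgeOne, this, wedgeOne_zero, sub_zero]

lemma wedgeOne_ins_isDer {D : List A → A} (h : IsMultiDer D) (l : List A) :
    IsDer fun f => wedgeOne (ins f D) l := by
  refine .of_rules (fun f g => ?_) (fun r f => ?_) (fun f g => ?_)
  · rw [← wedgeOne_add]
    exact congrArg (wedgeOne · l) (funext fun l => (h.der [] l).map_add f g)
  · have := wedgeOne_smul (algebraMap ℝ A r) l (ins f D)
    rw [← Algebra.smul_def] at this
    rw [← this]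
    refine congrArg (wedgeOne · l) (funext fun l => ?_)
    have := (h.der [] l).map_smul r f
    simp only [List.nil_append] at this
    rw [ins, this, Algebra.smul_def]
    rfl
  · rw [← wedgeOne_smul, ← wedgeOne_smul, ← wedgeOne_add]
    exact congrArg (wedgeOne · l) (funext fun l => (h.der [] l).map_mul f g)

/-- In the first argument `f`, the value is the constant `D l` minus a derivation in `f`. Later
arguments are reached by the recursion, which inserts the earlier ones into `D`. -/
lemma IsMultiAff.wedgeOne {D : List A → A} (h : IsMultiDer D) : IsMultiAff (wedgeOne D) := by
  have key : ∀ (l : List A) (D : List A → A), IsMultiDer D →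
      (∀ f g l', AffGerst.wedgeOne D (l ++ f :: g :: l') =
        -AffGerst.wedgeOne D (l ++ g :: f :: l')) ∧
      ∀ l', IsDer fun f => AffGerst.wedgeOne D (l ++ f :: l') -
        AffGerst.wedgeOne D (l ++ 0 :: l') := by
    intro l
    induction l with
    | nil =>
      intro D h
      refine ⟨fun f g l' => ?_, fun l' => ?_⟩
      · simp only [List.nil_append, AffGerst.wedgeOne]
        have h1 : AffGerst.ins g (AffGerst.ins f D) =
            (-1 : A) • AffGerst.ins f (AffGerst.ins g D) := by
          funext l
          simpa [AffGerst.ins] using h.skew [] f g l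
        rw [h1, wedgeOne_smul]
        simp only [AffGerst.ins]
        ring
      · simp only [List.nil_append, wedgeOne_zero_cons h, AffGerst.wedgeOne]
        simpa using (wedgeOne_ins_isDer h l').neg
    | cons a l ih =>
      intro D h
      refine ⟨fun f g l' => ?_, fun l' => ?_⟩
      · simp only [List.cons_append, AffGerst.wedgeOne]
        rw [(ih _ (h.ins a)).1, h.skew]
        ring
      · simp only [List.cons_append, AffGerst.wedgeOne]
        convert! (h.der l l').sub ((ih _ (h.ins a)).2 l') using 2 with f
        rw [(h.der l l').map_zero]
        ring
  exact ⟨fun l f g l' => (key l D h).1 f g l', fun l l' => (key l D h).2 l'⟩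

lemma IsMultiAff.add {D D' : List A → A} (h : IsMultiAff D) (h' : IsMultiAff D') :
    IsMultiAff (D + D') where
  skew l a b l' := by simp only [Pi.add_apply, h.skew l a b l', h'.skew l a b l']; ring
  aff l l' := by
    convert (h.aff l l').add (h'.aff l l') using 2 with f
    simp only [Pi.add_apply]; ring

lemma IsMultiDer.neg {D : List A → A} (h : IsMultiDer D) : IsMultiDer (-D) where
  skew l a b l' := by simp only [Pi.neg_apply, h.skew l a b l']
  der l l' := (h.der l l').neg

lemma IsMultiAff.ins_zero {L : List A → A} (h : IsMultiAff L) : IsMultiDer (AffGerst.ins 0 L) :=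
  (h.ins 0).isMultiDer fun l => h.skew.eq_zero_of_duplicate 0 [] l

/-- Every affine multiderivation is of the form `D - 1 ∧ D'`, with `D' = -L (0, …)`. -/
lemma IsMultiAff.exists_decomposition {L : List A → A} (h : IsMultiAff L) :
    ∃ D D', IsMultiDer D ∧ IsMultiDer D' ∧ L = D - AffGerst.wedgeOne D' := by
  -- On a list starting with `0`, `wedgeOne D'` takes the value of `D'` on the rest; with `D' = -ins
  -- 0 L` this cancels the value of `L`.
  refine ⟨L + AffGerst.wedgeOne (-AffGerst.ins 0 L), -AffGerst.ins 0 L,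
    (h.add (.wedgeOne h.ins_zero.neg)).isMultiDer fun l => ?_, h.ins_zero.neg, by simp⟩
  rw [Pi.add_apply, wedgeOne_zero_cons h.ins_zero.neg]
  simp [AffGerst.ins]

end MultiDer

/-! ### Shuffle products with `theta` -/

section Theta

variable {A : Type*} [CommRing A]

/-- The linear form `1` of degree one. -/
def theta (A : Type*) [CommRing A] : List A → A := fun l => if l.length = 1 then 1 else 0

lemma wedgeOne_eq (D : List A → A) : wedgeOne D = shuffle (theta A) D :=
  funext fun l => wedgeOne_eq_shuffle l D

lemma shuffle_unit_left (l : List A) : ∀ D : List A → A,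
    shuffle (fun l => if l.length = 0 then 1 else 0) D l = D l := by
  induction l with
  | nil => intro D; simp [shuffle]
  | cons f l ih =>
    intro D
    have h1 : ins f (fun l : List A => if l.length = 0 then (1 : A) else 0) = 0 := by
      funext l; simp [ins]
    have h2 : gradeInv (fun l : List A => if l.length = 0 then (1 : A) else 0) =
        fun l => if l.length = 0 then 1 else 0 := by
      funext l; simp only [gradeInv]; split_ifs with h <;> simp [h]
    rw [shuffle, h1, h2, shuffle_zero_left, ih, zero_add]
    rfl

lemma shuffle_unit_right (l : List A) : ∀ D : List A → A,
    shuffle D (fun l => if l.length = 0 then 1 else 0) l = D l := by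
  induction l with
  | nil => intro D; simp [shuffle]
  | cons f l ih =>
    intro D
    have h1 : ins f (fun l : List A => if l.length = 0 then (1 : A) else 0) = 0 := by
      funext l; simp [ins]
    rw [shuffle, h1, shuffle_zero_right, ih, add_zero]
    rfl

/-- `theta` is odd, and the sign of moving it past a `D` of mixed degree is the grade involution. -/
lemma shuffle_theta (l : List A) : ∀ D : List A → A,
    shuffle D (theta A) l = shuffle (theta A) (gradeInv D) l := by
  induction l with
  | nil => intro D; simp [shuffle, theta]
  | cons f l ih =>
    intro D
    have h1 : ins f (theta A) = fun l => if l.length = 0 then 1 else 0 := by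
      funext l; simp [ins, theta]
    have h2 : gradeInv (theta A) = (-1 : A) • theta A := by
      funext l; simp only [gradeInv, theta, Pi.smul_apply]; split_ifs with h <;> simp [h]
    have h3 : ins f (gradeInv D) = (-1 : A) • gradeInv (ins f D) := by
      funext l; simp [ins, gradeInv, pow_succ]
    rw [shuffle, shuffle, h1, h2, h3, shuffle_unit_right, shuffle_unit_left, shuffle_smul_left,
      shuffle_smul_right, ih]
    ring

lemma shuffle_theta_theta [Algebra ℝ A] : shuffle (theta A) (theta A) = 0 := by
  funext l
  have h1 := shuffle_theta l (theta A)
  have h2 : gradeInv (theta A) = (-1 : A) • theta A := by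
      funext l; simp only [gradeInv, theta, Pi.smul_apply]; split_ifs with h <;> simp [h]
  rw [h2, shuffle_smul_right] at h1
  exact eq_zero_of_eq_neg (h1.trans (neg_one_mul _))

lemma shuffle_sub_left (D₁ D₂ D' : List A → A) :
    shuffle (D₁ - D₂) D' = shuffle D₁ D' - shuffle D₂ D' := by
  funext l
  have := shuffle_add_left l (D₁ - D₂) D₂ D'
  rw [sub_add_cancel] at this
  rw [Pi.sub_apply, this, add_sub_cancel_right]

lemma shuffle_sub_right (D D₁ D₂ : List A → A) :
    shuffle D (D₁ - D₂) = shuffle D D₁ - shuffle D D₂ := by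
  funext l
  have := shuffle_add_right l D (D₁ - D₂) D₂
  rw [sub_add_cancel] at this
  rw [Pi.sub_apply, this, add_sub_cancel_right]

/-- Expand, move every `theta` to the front with the sign rule, and drop the term that contains it
twice. This is the source of the product formula for pairs. -/
lemma shuffle_sub_wedgeOne [Algebra ℝ A] (D D' F F' : List A → A) :
    shuffle (D - wedgeOne D') (F - wedgeOne F') =
      shuffle D F - wedgeOne (shuffle D' F + shuffle (gradeInv D) F') := by
  have assoc (D₁ D₂ D₃ : List A → A) : shuffle (shuffle D₁ D₂) D₃ = shuffle D₁ (shuffle D₂ D₃) :=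
    funext fun l => shuffle_assoc l D₁ D₂ D₃
  have comm (D : List A → A) : shuffle D (theta A) = shuffle (theta A) (gradeInv D) :=
    funext fun l => shuffle_theta l D
  have zl (D : List A → A) : shuffle 0 D = 0 := funext fun l => shuffle_zero_left l D
  have al (D D₁ D₂ : List A → A) : shuffle D (D₁ + D₂) = shuffle D D₁ + shuffle D D₂ :=
    funext fun l => shuffle_add_right l D D₁ D₂
  simp only [wedgeOne_eq, shuffle_sub_left, shuffle_sub_right]
  have h1 : shuffle D (shuffle (theta A) F') = shuffle (theta A) (shuffle (gradeInv D) F') := by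
    rw [← assoc, comm, assoc]
  have h2 : shuffle (shuffle (theta A) D') (shuffle (theta A) F') = 0 := by
    rw [assoc, ← assoc D', comm, ← assoc, ← assoc, shuffle_theta_theta, zl, zl]
  rw [h1, h2, assoc, al]
  abel

end Theta

/-! ### Contraction algebras and their Gerstenhaber bracket -/

/-- An algebra `T` over a commutative algebra `A` with a grade involution, odd derivations `con f`
over `A` that depend on `f` as derivations do, and an augmentation. The example is the algebra of
multivector fields, with the contractions by differentials of functions. -/
structure Contraction (A T : Type*) [CommRing A] [Algebra ℝ A] [Ring T] [Algebra A T]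
    [Algebra ℝ T] [IsScalarTower ℝ A T] where
  inv : T →ₐ[A] T
  con : A → T →ₗ[A] T
  ev : T →ₐ[A] A
  con_add : ∀ f g x, con (f + g) x = con f x + con g x
  con_smul : ∀ (r : ℝ) f x, con (r • f) x = r • con f x
  con_mul_left : ∀ f g x, con (f * g) x = f • con g x + g • con f x
  con_con : ∀ f g x, con f (con g x) = -con g (con f x)
  con_mul : ∀ f x y, con f (x * y) = con f x * y + inv x * con f y
  con_inv : ∀ f x, con f (inv x) = -inv (con f x)
  inv_inv : ∀ x, inv (inv x) = x
  ev_inv : ∀ x, ev (inv x) = ev x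

/-- The degrees are independent because they live on lists of different lengths. They span because
an element is the sum of its truncations, a finite sum by `hb`. -/
lemma isInternal_of_hasDeg {S A T : Type*} [CommRing A] [Module ℝ A] [AddCommGroup T] [Module ℝ T]
    (v : T →ₗ[ℝ] List S → A) (hv : Injective v) {𝒜 : ℤ → Submodule ℝ T}
    (h𝒜 : ∀ n x, x ∈ 𝒜 n ↔ HasDeg n (v x))
    (ht : ∀ (x : T) (n : ℕ), ∃ y, v y = fun l => if l.length = n then v x l else 0)
    (hb : ∀ x, ∃ N : ℕ, ∀ l, N < l.length → v x l = 0) : DirectSum.IsInternal 𝒜 := by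
  refine DirectSum.isInternal_submodule_of_iSupIndep_of_iSup_eq_top ?_ ?_
  · intro n
    rw [Submodule.disjoint_def]
    intro x hx hx'
    refine hv (funext fun l => ?_)
    rw [map_zero, Pi.zero_apply]
    by_cases hl : (l.length : ℤ) = n
    · have : (⨆ j, ⨆ (_ : j ≠ n), 𝒜 j) ≤ LinearMap.ker (LinearMap.proj l ∘ₗ v) :=
        iSup₂_le fun j hj y hy => (h𝒜 j y).1 hy l (by rw [hl]; exact hj.symm)
      exact this hx'
    · exact (h𝒜 n x).1 hx l hl
  · rw [eq_top_iff]
    intro x _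
    choose y hy using ht x
    obtain ⟨N, hN⟩ := hb x
    have : x = ∑ n ∈ Finset.range (N + 1), y n := by
      refine hv (funext fun l => ?_)
      simp only [map_sum, Finset.sum_apply, hy]
      rw [Finset.sum_ite_eq]
      split_ifs with h
      · rfl
      · exact hN l (by simpa using h)
    rw [this]
    refine Submodule.sum_mem _ fun n _ =>
      Submodule.mem_iSup_of_mem (n : ℤ) ((h𝒜 _ _).2 fun l hl => ?_)
    rw [hy]
    exact if_neg (by exact_mod_cast hl)

/-- The sign `(-1)ⁿ`. -/
def sg (A : Type*) [CommRing A] (n : ℤ) : A := if Even n then 1 else -1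

lemma sg_smul {A T : Type*} [CommRing A] [Ring T] [Algebra A T] (n : ℤ) (x : T) :
    sg A n • x = n.negOnePow • x := by
  unfold sg
  split_ifs with h
  · rw [Int.negOnePow_even _ h, one_smul, one_smul]
  · rw [Int.negOnePow_odd _ (Int.not_even_iff_odd.1 h), neg_one_smul, Units.neg_smul, one_smul]

namespace Contraction

variable {A T : Type*} [CommRing A] [Algebra ℝ A] [Ring T] [Algebra A T]
    [Algebra ℝ T] [IsScalarTower ℝ A T] (K : Contraction A T)

/-- The value of an element of `T` on a list of functions. -/
def val : T → List A → A
  | x, [] => K.ev x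
  | x, f :: l => val (K.con f x) l

@[simp] lemma val_nil (x : T) : K.val x [] = K.ev x := rfl
@[simp] lemma val_cons (x : T) (f : A) (l : List A) : K.val x (f :: l) = K.val (K.con f x) l := rfl

lemma val_add (l : List A) : ∀ x y, K.val (x + y) l = K.val x l + K.val y l := by
  induction l with
  | nil => intros; simp
  | cons f l ih => intros; simp [ih]

lemma val_smul (a : A) (l : List A) : ∀ x, K.val (a • x) l = a * K.val x l := by
  induction l with
  | nil => intros; simp
  | cons f l ih => intros; simp [ih]

lemma val_real_smul (r : ℝ) (x : T) (l : List A) : K.val (r • x) l = r • K.val x l := by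
  rw [← algebraMap_smul A r x, val_smul, Algebra.smul_def]

lemma val_neg (x : T) (l : List A) : K.val (-x) l = -K.val x l := by
  have := K.val_smul (-1) l x
  simpa using this

lemma val_sub (x y : T) (l : List A) : K.val (x - y) l = K.val x l - K.val y l := by
  rw [sub_eq_add_neg, val_add, val_neg, sub_eq_add_neg]

lemma val_zero (l : List A) : K.val 0 l = 0 := by
  have := K.val_smul 0 l 0
  simpa using this

/-- `val` as a linear map. -/
def valₗ : T →ₗ[ℝ] List A → A where
  toFun := K.val
  map_add' x y := funext fun l => K.val_add l x y
  map_smul' r x := funext fun l => K.val_real_smul r x l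

lemma con_zero_left (x : T) : K.con 0 x = 0 := by
  have := K.con_smul 0 0 x
  simpa using this

lemma con_sub (f g : A) (x : T) : K.con (f - g) x = K.con f x - K.con g x := by
  have := K.con_add (f - g) g x
  rw [sub_add_cancel] at this
  rw [this, add_sub_cancel_right]

lemma val_isDer (l : List A) (x : T) : IsDer fun f => K.val (K.con f x) l := by
  refine .of_rules (fun f g => ?_) (fun r f => ?_) fun f g => ?_
  · rw [con_add, val_add]
  · rw [con_smul, val_real_smul]
  · rw [con_mul_left, val_add, val_smul, val_smul]

lemma isMultiDer_val (x : T) : IsMultiDer (K.val x) := by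
  refine ⟨fun l => ?_, fun l l' => ?_⟩
  · induction l generalizing x with
    | nil => intro a b l'; simp [K.con_con b a, val_neg]
    | cons f l ih => exact ih _
  · induction l generalizing x with
    | nil => exact K.val_isDer l' x
    | cons f l ih => exact ih _

lemma con_algebraMap (f a : A) : K.con f (algebraMap A T a) = 0 := by
  have h1 : K.con f 1 = 0 := by
    have := K.con_mul f 1 1
    simpa using this
  rw [Algebra.algebraMap_eq_smul_one, map_smul, h1, smul_zero]

lemma val_inv (l : List A) : ∀ x, K.val (K.inv x) l = (-1) ^ l.length * K.val x l := by
  induction l with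
  | nil => intro x; simp [ev_inv]
  | cons f l ih => intro x; simp [con_inv, val_neg, ih, pow_succ]

lemma shuffle_val (l : List A) : ∀ x y, shuffle (K.val x) (K.val y) l = K.val (x * y) l := by
  induction l with
  | nil => intro x y; simp [shuffle]
  | cons f l ih =>
    intro x y
    have h1 : gradeInv (K.val x) = K.val (K.inv x) := funext fun l => (K.val_inv l x).symm
    have h2 (x : T) : ins f (K.val x) = K.val (K.con f x) := rfl
    rw [shuffle, h1, h2, h2, ih, ih, val_cons, con_mul, val_add]

/-- The elements that are homogeneous of degree `n`. -/
def grading (n : ℤ) : Submodule ℝ T where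
  carrier := {x | HasDeg n (K.val x)}
  add_mem' hx hy l hl := by rw [val_add, hx l hl, hy l hl, add_zero]
  zero_mem' l hl := K.val_zero l
  smul_mem' r x hx l hl := by rw [val_real_smul, hx l hl, smul_zero]

variable {K}

lemma con_mem {n : ℤ} {x : T} (hx : x ∈ K.grading n) (f : A) : K.con f x ∈ K.grading (n - 1) :=
  HasDeg.ins hx f

lemma ev_eq_zero {n : ℤ} {x : T} (hx : x ∈ K.grading n) (hn : n ≠ 0) : K.ev x = 0 :=
  hx [] (by simpa using hn.symm)

lemma mul_mem {n k : ℤ} {x y : T} (hx : x ∈ K.grading n) (hy : y ∈ K.grading k) :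
    x * y ∈ K.grading (n + k) := fun l hl => by
  rw [← shuffle_val]
  exact shuffle_hasDeg l n k _ _ hx hy hl

variable (K)

/-- The bracket of two elements, as a function on lists. -/
def bracketVal : List A → T → T → A
  | [], X, Y => K.ev (K.con (K.ev Y) X) - K.ev (K.con (K.ev X) Y)
  | f :: l, X, Y => bracketVal l (K.con f X) Y - bracketVal l (K.inv X) (K.con f Y)

lemma bracketVal_add_left (l : List A) : ∀ X X' Y,
    K.bracketVal l (X + X') Y = K.bracketVal l X Y + K.bracketVal l X' Y := by
  induction l with
  | nil => intros; simp only [bracketVal, map_add, con_add]; ring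
  | cons f l ih => intros; simp only [bracketVal, map_add, ih]; ring

lemma bracketVal_add_right (l : List A) : ∀ X Y Y',
    K.bracketVal l X (Y + Y') = K.bracketVal l X Y + K.bracketVal l X Y' := by
  induction l with
  | nil => intros; simp only [bracketVal, map_add, con_add]; ring
  | cons f l ih => intros; simp only [bracketVal, map_add, ih]; ring

/-- The Leibniz rule for multiplication by a function: the correction term is the bracket of `X`
with `a`, multiplied by `Y`. It and its left counterpart measure the failure of linearity over `A`.
-/
lemma bracketVal_smul_right (a : A) (l : List A) : ∀ X Y,
    K.bracketVal l X (a • Y) = K.val (K.inv (K.con a X) * Y) l + a * K.bracketVal l X Y := by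
  induction l with
  | nil =>
    intro X Y
    simp only [bracketVal, map_smul, smul_eq_mul, con_mul_left, map_add, map_mul, val_nil, ev_inv]
    ring
  | cons f l ih =>
    intro X Y
    simp only [bracketVal, map_smul, ih, val_cons, con_mul, val_add, con_inv, inv_inv, map_neg,
      K.con_con a f, neg_mul, val_neg]
    ring

lemma bracketVal_smul_left (a : A) (l : List A) : ∀ X Y,
    K.bracketVal l (a • X) Y = a * K.bracketVal l X Y - K.val (X * K.con a Y) l := by
  induction l with
  | nil =>
    intro X Y
    simp only [bracketVal, map_smul, smul_eq_mul, con_mul_left, map_add, map_mul, val_nil]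
    ring
  | cons f l ih =>
    intro X Y
    simp only [bracketVal, map_smul, ih, val_cons, con_mul, val_add,
      K.con_con f a, mul_neg, val_neg]
    ring

lemma bracketVal_neg_left (l : List A) (X Y : T) :
    K.bracketVal l (-X) Y = -K.bracketVal l X Y := by
  have := K.bracketVal_add_left l X (-X) Y
  have h0 := K.bracketVal_add_left l 0 0 Y
  simp only [add_zero, add_neg_cancel, left_eq_add] at this h0
  rw [h0] at this
  linear_combination -this

lemma bracketVal_neg_right (l : List A) (X Y : T) :
    K.bracketVal l X (-Y) = -K.bracketVal l X Y := by
  have := K.bracketVal_add_right l X Y (-Y)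
  have h0 := K.bracketVal_add_right l X 0 0
  simp only [add_zero, add_neg_cancel, left_eq_add] at this h0
  rw [h0] at this
  linear_combination -this

lemma con_real (r : ℝ) (Y : T) : K.con (algebraMap ℝ A r) Y = 0 := by
  have h : K.con 1 Y = 0 := by
    have := K.con_mul_left 1 1 Y
    simpa using this
  rw [Algebra.algebraMap_eq_smul_one, con_smul, h, smul_zero]

lemma bracketVal_real_smul_left (r : ℝ) (l : List A) (X Y : T) :
    K.bracketVal l (r • X) Y = r • K.bracketVal l X Y := by
  rw [← algebraMap_smul A r X, bracketVal_smul_left, con_real, mul_zero, val_zero, sub_zero,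
    Algebra.smul_def]

lemma bracketVal_real_smul_right (r : ℝ) (l : List A) (X Y : T) :
    K.bracketVal l X (r • Y) = r • K.bracketVal l X Y := by
  rw [← algebraMap_smul A r Y, bracketVal_smul_right, con_real, map_zero, zero_mul, val_zero,
    zero_add, Algebra.smul_def]

/-- Skewness comes from the anticommutation of contractions. In the Leibniz rule for the argument,
contraction with `f * g` gives multiples by `f` and `g` in both entries of the bracket; the
resulting correction terms are products of a contraction of `X` with a contraction of `Y` and cancel
in pairs. -/
lemma isMultiDer_bracketVal (X Y : T) : IsMultiDer fun l => K.bracketVal l X Y := by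
  refine ⟨fun l => ?_, fun l l' => ?_⟩
  · induction l generalizing X Y with
    | nil =>
      intro f g l
      simp only [List.nil_append, bracketVal, con_inv, K.con_con f g, inv_inv, bracketVal_neg_left,
        bracketVal_neg_right]
      ring
    | cons f l ih =>
      intro a b l'
      simp only [List.cons_append, bracketVal]
      rw [ih (K.con f X), ih (K.inv X)]
      ring
  · induction l generalizing X Y with
    | nil =>
      refine .of_rules (fun f g => ?_) (fun r f => ?_) fun f g => ?_
      · simp only [List.nil_append, bracketVal, con_add, bracketVal_add_left, bracketVal_add_right]
        ring
      · simp only [List.nil_append, bracketVal, con_smul, bracketVal_real_smul_left,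
          bracketVal_real_smul_right, smul_sub]
      · simp only [List.nil_append, bracketVal, con_mul_left, bracketVal_add_left,
          bracketVal_add_right, bracketVal_smul_left, bracketVal_smul_right, con_inv, map_neg,
          inv_inv, neg_mul, val_neg]
        ring
    | cons f l ih => exact (ih _ _).sub (ih _ _)

/-- The elements of `T` are the multiderivations of `A`. -/
structure IsFull : Prop where
  injective : Injective K.val
  surjective : ∀ D, IsMultiDer D → ∃ x, K.val x = D
  bounded : ∃ N : ℕ, ∀ x l, N < l.length → K.val x l = 0

variable {K} (hK : K.IsFull)

/-- The element with values given by `bracketVal`. -/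
def bracketAux (X Y : T) : T :=
  Classical.choose (hK.surjective _ (K.isMultiDer_bracketVal X Y))

lemma val_bracketAux (X Y : T) (l : List A) :
    K.val (bracketAux hK X Y) l = K.bracketVal l X Y :=
  congrFun (Classical.choose_spec (hK.surjective _ (K.isMultiDer_bracketVal X Y))) l

/-- The Gerstenhaber bracket of a full contraction algebra. -/
def bracket : T →ₗ[ℝ] T →ₗ[ℝ] T :=
  LinearMap.mk₂ ℝ (bracketAux hK)
    (fun X X' Y => hK.injective <| funext fun l => by
      simp only [val_add, val_bracketAux, bracketVal_add_left])
    (fun r X Y => hK.injective <| funext fun l => by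
      simp only [val_real_smul, val_bracketAux, bracketVal_real_smul_left])
    (fun X Y Y' => hK.injective <| funext fun l => by
      simp only [val_add, val_bracketAux, bracketVal_add_right])
    (fun r X Y => hK.injective <| funext fun l => by
      simp only [val_real_smul, val_bracketAux, bracketVal_real_smul_right])

lemma val_bracket (X Y : T) (l : List A) : K.val (bracket hK X Y) l = K.bracketVal l X Y :=
  val_bracketAux hK X Y l

lemma ev_bracket (X Y : T) : K.ev (bracket hK X Y) =
    K.ev (K.con (K.ev Y) X) - K.ev (K.con (K.ev X) Y) :=
  val_bracket hK X Y []

/-- With `ev_bracket` this determines the bracket. The identities below are proved by contracting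
both sides until the list of arguments is empty. -/
lemma con_bracket (f : A) (X Y : T) : K.con f (bracket hK X Y) =
    bracket hK (K.con f X) Y - bracket hK (K.inv X) (K.con f Y) :=
  hK.injective <| funext fun l => by
    rw [val_sub, ← val_cons, val_bracket, val_bracket, val_bracket, bracketVal]

lemma inv_eq (hK : K.IsFull) {n : ℤ} {x : T} (hx : x ∈ K.grading n) : K.inv x = sg A n • x :=
  hK.injective <| funext fun l => by
    rw [val_inv, val_smul]
    by_cases hl : (l.length : ℤ) = n
    · rw [← hl, sg]
      split_ifs with h
      · rw [Even.neg_one_pow (by exact_mod_cast h)]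
      · rw [Odd.neg_one_pow (by rw [← Nat.not_even_iff_odd]; exact_mod_cast h)]
    · rw [hx l hl, mul_zero, mul_zero]

lemma bracket_sg_left (n : ℤ) (X Y : T) :
    bracket hK (sg A n • X) Y = sg A n • bracket hK X Y := by
  unfold sg; split_ifs <;> simp

lemma bracket_sg_right (n : ℤ) (X Y : T) :
    bracket hK X (sg A n • Y) = sg A n • bracket hK X Y := by
  unfold sg; split_ifs <;> simp

lemma con_bracket_of_mem {i : ℤ} (f : A) {X : T} (hX : X ∈ K.grading i) (Y : T) :
    K.con f (bracket hK X Y) =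
      bracket hK (K.con f X) Y - sg A i • bracket hK X (K.con f Y) := by
  rw [con_bracket, inv_eq hK hX, bracket_sg_left]

lemma con_mul_of_mem (hK : K.IsFull) {i : ℤ} (f : A) {X : T} (hX : X ∈ K.grading i) (Y : T) :
    K.con f (X * Y) = K.con f X * Y + sg A i • (X * K.con f Y) := by
  rw [con_mul, inv_eq hK hX, smul_mul_assoc]

lemma bracket_mem (l : List A) : ∀ {i j : ℤ} {X Y : T}, X ∈ K.grading i → Y ∈ K.grading j →
    (l.length : ℤ) ≠ i + j - 1 → K.val (bracket hK X Y) l = 0 := by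
  induction l with
  | nil =>
    intro i j X Y hX hY hl
    rw [val_nil, ev_bracket]
    have h1 : K.ev (K.con (K.ev Y) X) = 0 := by
      by_cases hj : j = 0
      · exact ev_eq_zero (con_mem hX _) (by simp at hl; omega)
      · rw [ev_eq_zero hY hj, con_zero_left, map_zero]
    have h2 : K.ev (K.con (K.ev X) Y) = 0 := by
      by_cases hi : i = 0
      · exact ev_eq_zero (con_mem hY _) (by simp at hl; omega)
      · rw [ev_eq_zero hX hi, con_zero_left, map_zero]
    rw [h1, h2, sub_zero]
  | cons f l ih =>
    intro i j X Y hX hY hl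
    simp only [List.length_cons, Nat.cast_add, Nat.cast_one] at hl
    rw [val_cons, con_bracket_of_mem hK f hX, val_sub, val_smul, ih (con_mem hX f) hY (by omega),
      ih hX (con_mem hY f) (by omega), mul_zero, sub_zero]

lemma bracket_mem_grading {i j : ℤ} {X Y : T} (hX : X ∈ K.grading i) (hY : Y ∈ K.grading j) :
    bracket hK X Y ∈ K.grading (i + j - 1) := fun l hl => bracket_mem hK l hX hY hl

lemma val_mul_comm (hK : K.IsFull) (l : List A) : ∀ {i j : ℤ} {X Y : T},
    X ∈ K.grading i → Y ∈ K.grading j →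
    K.val (X * Y) l = sg A (i * j) * K.val (Y * X) l := by
  induction l with
  | nil =>
    intro i j X Y hX hY
    simp only [val_nil, map_mul]
    by_cases hi : i = 0
    · subst hi; simp [sg, mul_comm]
    · simp [ev_eq_zero hX hi]
  | cons f l ih =>
    intro i j X Y hX hY
    have h1 := ih (con_mem hX f) hY
    have h2 := ih hX (con_mem hY f)
    simp only [val_cons, con_mul_of_mem hK f hX, con_mul_of_mem hK f hY, val_add, val_smul]
    -- A contraction lowers one degree by one, so the signs in the induction hypotheses are shifted;
    -- only the parities of `i` and `j` matter for matching them.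
    linear_combination (norm := skip) h1 + sg A i * h2
    by_cases hi : Even i <;> by_cases hj : Even j <;>
      simp only [sg, Int.even_mul, Int.even_sub, hi, hj, Int.not_even_one, if_true, if_false,
        or_false, or_true, or_self, iff_false, not_true] <;>
      ring

lemma val_bracket_skew (l : List A) : ∀ {i j : ℤ} {X Y : T}, X ∈ K.grading i → Y ∈ K.grading j →
    K.val (bracket hK X Y) l = -(sg A ((i - 1) * (j - 1)) * K.val (bracket hK Y X) l) := by
  induction l with
  | nil =>
    intro i j X Y hX hY
    simp only [val_nil, ev_bracket]
    by_cases hi : i = 0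
    · by_cases hj : j = 0
      · have h1 := ev_eq_zero (con_mem hX (K.ev Y)) (by omega)
        have h2 := ev_eq_zero (con_mem hY (K.ev X)) (by omega)
        simp [h1, h2]
      · by_cases hj' : j = 1
        · simp [hi, hj', sg]
        · have h1 := ev_eq_zero (con_mem hY (K.ev X)) (by omega)
          simp [h1, ev_eq_zero hY hj, con_zero_left]
    · by_cases hi' : i = 1
      · simp [hi', sg]
      · have h1 := ev_eq_zero (con_mem hX (K.ev Y)) (by omega)
        simp [h1, ev_eq_zero hX hi, con_zero_left]
  | cons f l ih =>
    intro i j X Y hX hY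
    have h1 := ih (con_mem hX f) hY
    have h2 := ih hX (con_mem hY f)
    simp only [val_cons, con_bracket_of_mem hK f hX, con_bracket_of_mem hK f hY, val_sub, val_smul]
    linear_combination (norm := skip) h1 - sg A i * h2
    by_cases hi : Even i <;> by_cases hj : Even j <;>
      simp only [sg, Int.even_mul, Int.even_sub, hi, hj, Int.not_even_one, if_true, if_false,
        or_false, or_true, or_self, iff_false, not_true] <;>
      ring

lemma val_bracket_mul (l : List A) : ∀ {i j : ℤ} {X Y Z : T}, X ∈ K.grading i →
    Y ∈ K.grading j → K.val (bracket hK X (Y * Z)) l =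
      K.val (bracket hK X Y * Z) l + sg A ((i - 1) * j) * K.val (Y * bracket hK X Z) l := by
  induction l with
  | nil =>
    intro i j X Y Z hX hY
    simp only [val_nil, ev_bracket, map_mul, con_mul_of_mem hK _ hY, map_add, con_mul_left,
      map_smul, smul_eq_mul]
    by_cases hj : j = 0
    · subst hj
      simp only [sg, mul_zero, Even.zero, if_true]
      ring
    · simp only [ev_eq_zero hY hj, con_zero_left, map_zero]
      ring
  | cons f l ih =>
    intro i j X Y Z hX hY
    have h1 := ih (Z := Z) (con_mem hX f) hY
    have h2 := ih (Z := Z) hX (con_mem hY f)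
    have h3 := ih (Z := K.con f Z) hX hY
    simp only [val_cons, con_bracket_of_mem hK f hX, con_mul_of_mem hK f hY,
      con_mul_of_mem hK f (bracket_mem_grading hK hX hY), val_add, val_sub, val_smul, map_add,
      bracket_sg_right, sub_mul, mul_sub, smul_mul_assoc, mul_smul_comm]
    linear_combination (norm := skip) h1 - sg A i * h2 - sg A i * sg A j * h3
    by_cases hi : Even i <;> by_cases hj : Even j <;>
      simp only [sg, Int.even_mul, Int.even_sub, Int.even_add, hi, hj, Int.not_even_one, if_true,
        if_false, or_false, or_true, or_self, iff_false, not_true, iff_true] <;>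
      ring

lemma val_bracket_jacobi (l : List A) : ∀ {i j k : ℤ} {X Y Z : T}, X ∈ K.grading i →
    Y ∈ K.grading j → Z ∈ K.grading k → K.val (bracket hK X (bracket hK Y Z)) l =
      K.val (bracket hK (bracket hK X Y) Z) l +
        sg A ((i - 1) * (j - 1)) * K.val (bracket hK Y (bracket hK X Z)) l := by
  induction l with
  | nil =>
    intro i j k X Y Z hX hY hZ
    have e (a b : A) : K.ev (K.con a (K.con b Z)) = -K.ev (K.con b (K.con a Z)) := by
      rw [con_con, map_neg]
    have e1 (a b : A) : K.ev (K.con a (K.con b X)) = -K.ev (K.con b (K.con a X)) := by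
      rw [con_con, map_neg]
    have e2 (a b : A) : K.ev (K.con a (K.con b Y)) = -K.ev (K.con b (K.con a Y)) := by
      rw [con_con, map_neg]
    have hX0 (h : i ≠ 0) : K.ev X = 0 := ev_eq_zero hX h
    have hX1 (a : A) (h : i ≠ 1) : K.ev (K.con a X) = 0 := ev_eq_zero (con_mem hX a) (by omega)
    have hX2 (a b : A) (h : i ≠ 2) : K.ev (K.con a (K.con b X)) = 0 :=
      ev_eq_zero (con_mem (con_mem hX b) a) (by omega)
    have hY0 (h : j ≠ 0) : K.ev Y = 0 := ev_eq_zero hY h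
    have hY1 (a : A) (h : j ≠ 1) : K.ev (K.con a Y) = 0 := ev_eq_zero (con_mem hY a) (by omega)
    have hY2 (a b : A) (h : j ≠ 2) : K.ev (K.con a (K.con b Y)) = 0 :=
      ev_eq_zero (con_mem (con_mem hY b) a) (by omega)
    simp only [val_nil, ev_bracket, con_bracket_of_mem hK _ hX, con_bracket_of_mem hK _ hY, map_sub,
      map_smul, smul_eq_mul, con_sub]
    -- `X` and `Y` occur under at most two contractions, so only their degrees `0`, `1`, `2`
    -- contribute. The surviving terms agree up to exchanging two contractions of `X`, `Y` or `Z`;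
    -- the degree of `Z` need not be split.
    have hi : i = 0 ∨ i = 1 ∨ i = 2 ∨ i ≠ 0 ∧ i ≠ 1 ∧ i ≠ 2 := by omega
    have hj : j = 0 ∨ j = 1 ∨ j = 2 ∨ j ≠ 0 ∧ j ≠ 1 ∧ j ≠ 2 := by omega
    rcases hi with hi | hi | hi | hi <;> rcases hj with hj | hj | hj | hj <;>
      simp [hX0, hX1, hX2, hY0, hY1, hY2, hi, hj, con_zero_left, sg] <;>
      first
      | ring1
      | linear_combination -e (K.ev X) (K.ev Y)
      | linear_combination -e1 (K.ev Y) (K.ev Z)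
      | linear_combination -e2 (K.ev X) (K.ev Z)
  | cons f l ih =>
    intro i j k X Y Z hX hY hZ
    have h1 := ih (con_mem hX f) hY hZ
    have h2 := ih hX (con_mem hY f) hZ
    have h3 := ih hX hY (con_mem hZ f)
    simp only [val_cons, con_bracket_of_mem hK f hX, con_bracket_of_mem hK f hY,
      con_bracket_of_mem hK f (bracket_mem_grading hK hX hY), val_sub, val_smul, map_sub,
      bracket_sg_right, bracket_sg_left, LinearMap.sub_apply]
    linear_combination (norm := skip) h1 - sg A i * h2 + sg A i * sg A j * h3
    by_cases hi : Even i <;> by_cases hj : Even j <;>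
      simp only [sg, Int.even_mul, Int.even_sub, Int.even_add, hi, hj, Int.not_even_one, if_true,
        if_false, or_false, or_true, or_self, iff_false, not_true, iff_true] <;>
      ring

lemma isGerstenhaber_bracket (hK : K.IsFull) :
    IsGerstenhaber K.grading (LinearMap.mul ℝ T) (bracket hK) where
  isInternal := isInternal_of_hasDeg K.valₗ hK.injective (fun _ _ => Iff.rfl)
    (fun x n => hK.surjective _ ((K.isMultiDer_val x).truncate n))
    (fun x => hK.bounded.imp fun _ h l hl => h x l hl)
  mul_mem i j a ha b hb := mul_mem ha hb
  mul_assoc a b c := _root_.mul_assoc a b c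
  unit := ⟨1, fun l hl => by
    have h : ∀ f l, K.val 1 (f :: l) = 0 := fun f l => by
      rw [val_cons, ← map_one (algebraMap A T), con_algebraMap, val_zero]
    match l, hl with
    | [], hl => simp at hl
    | f :: l, _ => exact h f l, fun a => ⟨one_mul a, mul_one a⟩⟩
  mul_comm i j a ha b hb := hK.injective <| funext fun l => by
    rw [LinearMap.mul_apply', LinearMap.mul_apply', ← sg_smul (A := A), val_smul,
      val_mul_comm hK l ha hb]
  br_mem i j a ha b hb := bracket_mem_grading hK ha hb
  br_skew i j a ha b hb := hK.injective <| funext fun l => by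
    rw [← sg_smul (A := A), val_neg, val_smul, val_bracket_skew hK l ha hb]
  jacobi i j k a ha b hb c hc := hK.injective <| funext fun l => by
    rw [← sg_smul (A := A), val_add, val_smul, val_bracket_jacobi hK l ha hb hc]
  leibniz i j k a ha b hb c hc := hK.injective <| funext fun l => by
    simp only [LinearMap.mul_apply']
    rw [← sg_smul (A := A), val_add, val_smul, val_bracket_mul hK l ha hb]

end Contraction

/-! ### Contractions in an exterior algebra -/

section Exterior

variable {V : Type*} [AddCommGroup V] [Module ℝ V]

/-- The contraction of an element of `⋀ V` with a covector, an odd derivation. -/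
def contr : Module.Dual ℝ V →ₗ[ℝ] ExteriorAlgebra ℝ V →ₗ[ℝ] ExteriorAlgebra ℝ V :=
  CliffordAlgebra.contractLeft

/-- The grade involution of `⋀ V`. -/
def extInv : ExteriorAlgebra ℝ V →ₐ[ℝ] ExteriorAlgebra ℝ V := CliffordAlgebra.involute

lemma extInv_ι (v : V) : extInv (ExteriorAlgebra.ι ℝ v) = -ExteriorAlgebra.ι ℝ v :=
  CliffordAlgebra.involute_ι v

lemma extInv_extInv (x : ExteriorAlgebra ℝ V) : extInv (extInv x) = x :=
  CliffordAlgebra.involute_involute x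

lemma contr_ι_mul (d : Module.Dual ℝ V) (v : V) (x : ExteriorAlgebra ℝ V) :
    contr d (ExteriorAlgebra.ι ℝ v * x) = d v • x - ExteriorAlgebra.ι ℝ v * contr d x :=
  CliffordAlgebra.contractLeft_ι_mul d v x

lemma contr_algebraMap (d : Module.Dual ℝ V) (r : ℝ) :
    contr d (algebraMap ℝ (ExteriorAlgebra ℝ V) r) = 0 :=
  CliffordAlgebra.contractLeft_algebraMap (Q := (0 : QuadraticForm ℝ V)) d r

lemma contr_one (d : Module.Dual ℝ V) : contr d (1 : ExteriorAlgebra ℝ V) = 0 :=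
  CliffordAlgebra.contractLeft_one (Q := (0 : QuadraticForm ℝ V)) d

lemma contr_comm (d d' : Module.Dual ℝ V) (x : ExteriorAlgebra ℝ V) :
    contr d (contr d' x) = -contr d' (contr d x) :=
  CliffordAlgebra.contractLeft_comm (Q := (0 : QuadraticForm ℝ V)) d d' x

lemma ext_left_induction {P : ExteriorAlgebra ℝ V → Prop}
    (algebraMap : ∀ r : ℝ, P (algebraMap ℝ _ r)) (add : ∀ x y, P x → P y → P (x + y))
    (ι_mul : ∀ x (v : V), P x → P (ExteriorAlgebra.ι ℝ v * x)) (x : ExteriorAlgebra ℝ V) : P x :=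
  CliffordAlgebra.left_induction (Q := (0 : QuadraticForm ℝ V)) (P := P) algebraMap add ι_mul x

lemma contr_mul (d : Module.Dual ℝ V) (x y : ExteriorAlgebra ℝ V) :
    contr d (x * y) = contr d x * y + extInv x * contr d y := by
  induction x using ext_left_induction with
  | algebraMap r =>
    simp only [contr_algebraMap, zero_mul, zero_add, AlgHom.commutes, ← Algebra.smul_def, map_smul]
  | add x x' h h' => simp only [add_mul, map_add, h, h']; abel
  | ι_mul x v h =>
    rw [mul_assoc, contr_ι_mul, h, contr_ι_mul, map_mul, extInv_ι]
    simp only [sub_mul, mul_add, smul_mul_assoc, neg_mul, mul_assoc]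
    abel

lemma contr_extInv (d : Module.Dual ℝ V) (x : ExteriorAlgebra ℝ V) :
    contr d (extInv x) = -extInv (contr d x) := by
  induction x using ext_left_induction with
  | algebraMap r => simp only [AlgHom.commutes, contr_algebraMap, map_zero, neg_zero]
  | add x x' h h' => simp only [map_add, h, h']; abel
  | ι_mul x v h =>
    rw [map_mul, extInv_ι, neg_mul, map_neg, contr_ι_mul, contr_ι_mul, h, map_sub, map_mul,
      map_smul, extInv_ι]
    simp only [mul_neg, neg_mul]

/-- The component of degree zero. -/
def extEv : ExteriorAlgebra ℝ V →ₐ[ℝ] ℝ := ExteriorAlgebra.algebraMapInv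

lemma extEv_algebraMap (r : ℝ) : extEv (algebraMap ℝ (ExteriorAlgebra ℝ V) r) = r :=
  ExteriorAlgebra.algebraMap_leftInverse V r

lemma extEv_ι (v : V) : extEv (ExteriorAlgebra.ι ℝ v) = 0 := by
  simp [extEv, ExteriorAlgebra.algebraMapInv]

lemma extEv_extInv (x : ExteriorAlgebra ℝ V) : extEv (extInv x) = extEv x := by
  induction x using ext_left_induction with
  | algebraMap r => rw [AlgHom.commutes]
  | add x x' h h' => simp only [map_add, h, h']
  | ι_mul x v h => simp only [map_mul, extInv_ι, map_neg, extEv_ι, neg_zero, zero_mul]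

/-- Naturality of the contraction, by which it can be computed in a trivialization of the tangent
bundle. -/
lemma map_contr {W : Type*} [AddCommGroup W] [Module ℝ W] (φ : V →ₗ[ℝ] W) (d : Module.Dual ℝ W)
    (x : ExteriorAlgebra ℝ V) :
    ExteriorAlgebra.map φ (contr (d ∘ₗ φ) x) = contr d (ExteriorAlgebra.map φ x) := by
  induction x using ext_left_induction with
  | algebraMap r => simp only [AlgHom.commutes, contr_algebraMap, map_zero]
  | add x x' h h' => simp only [map_add, h, h']
  | ι_mul x v h =>
    rw [contr_ι_mul, map_mul, ExteriorAlgebra.map_apply_ι, contr_ι_mul, map_sub, map_smul, map_mul,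
      ExteriorAlgebra.map_apply_ι, h]
    rfl

lemma contr_ιMulti (d : Module.Dual ℝ V) {n : ℕ} (v : Fin (n + 1) → V) :
    contr d (ExteriorAlgebra.ιMulti ℝ (n + 1) v) =
      ∑ i : Fin (n + 1), ((-1 : ℝ) ^ (i : ℕ) * d (v i)) •
        ExteriorAlgebra.ιMulti ℝ n (fun j => v (i.succAbove j)) := by
  induction n with
  | zero =>
    rw [ExteriorAlgebra.ιMulti_succ_apply, contr_ι_mul]
    simp [contr_one]
  | succ n ih =>
    rw [ExteriorAlgebra.ιMulti_succ_apply, contr_ι_mul, ih, Fin.sum_univ_succ (n := n + 1),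
      Finset.mul_sum,
      sub_eq_add_neg, ← Finset.sum_neg_distrib]
    congr 1
    · simp
      rfl
    · refine Finset.sum_congr rfl fun i _ => ?_
      rw [ExteriorAlgebra.ιMulti_succ_apply (v := fun j => v (i.succ.succAbove j)), mul_smul_comm,
        ← neg_smul]
      simp [pow_succ, Matrix.vecTail, comp_def]

/-- Expansion of the determinant along the column of the first covector. It turns the determinant
pairing into an iterated contraction. -/
lemma extPairing_succ {n : ℕ} (α : Fin (n + 1) → V →ₗ[ℝ] ℝ) (x : ExteriorAlgebra ℝ V) :
    extPairing α x = extPairing (fun j => α j.succ) (contr (α 0) x) := by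
  suffices h : extPairing α = extPairing (fun j => α j.succ) ∘ₗ contr (α 0) by rw [h]; rfl
  refine ExteriorAlgebra.lhom_ext fun k => AlternatingMap.ext fun v => ?_
  simp only [LinearMap.compAlternatingMap_apply, LinearMap.comp_apply, extPairing]
  cases k with
  | zero =>
    rw [ExteriorAlgebra.liftAlternating_apply_ιMulti, ExteriorAlgebra.ιMulti_zero_apply, contr_one,
      map_zero]
    rfl
  | succ k =>
    rw [ExteriorAlgebra.liftAlternating_apply_ιMulti, contr_ιMulti, map_sum]
    simp only [map_smul, ExteriorAlgebra.liftAlternating_apply_ιMulti]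
    by_cases h : k = n
    · subst h
      simp only [Pi.single_eq_same, AlternatingMap.compLinearMap_apply]
      refine (Matrix.det_succ_column_zero _).trans (Finset.sum_congr rfl fun i _ => ?_)
      rfl
    · rw [Pi.single_eq_of_ne (by simpa using h), Pi.single_eq_of_ne h]
      simp

lemma extPairing_zero (α : Fin 0 → V →ₗ[ℝ] ℝ) (x : ExteriorAlgebra ℝ V) :
    extPairing α x = extEv x := by
  suffices h : extPairing α = extEv.toLinearMap by rw [h]; rfl
  refine ExteriorAlgebra.lhom_ext fun k => AlternatingMap.ext fun v => ?_
  simp only [LinearMap.compAlternatingMap_apply, extPairing,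
    ExteriorAlgebra.liftAlternating_apply_ιMulti, AlgHom.toLinearMap_apply]
  cases k with
  | zero =>
    simp only [Pi.single_eq_same, ExteriorAlgebra.ιMulti_zero_apply, map_one]
    exact Matrix.det_isEmpty (n := Fin 0) (R := ℝ)
  | succ k =>
    rw [Pi.single_eq_of_ne (by simp), ExteriorAlgebra.ιMulti_succ_apply, map_mul, extEv_ι, zero_mul]
    rfl

/-- The iterated contraction with a list of covectors, followed by the augmentation. -/
def contrList : List (Module.Dual ℝ V) → ExteriorAlgebra ℝ V → ℝ
  | [], x => extEv x
  | d :: l, x => contrList l (contr d x)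

lemma contrList_add (l : List (Module.Dual ℝ V)) : ∀ x y,
    contrList l (x + y) = contrList l x + contrList l y := by
  induction l with
  | nil => intros; simp [contrList]
  | cons d l ih => intros; simp [contrList, ih]

lemma contrList_smul (r : ℝ) (l : List (Module.Dual ℝ V)) : ∀ x,
    contrList l (r • x) = r * contrList l x := by
  induction l with
  | nil => intros; simp [contrList]
  | cons d l ih => intros; simp [contrList, ih]

lemma contrList_zero (l : List (Module.Dual ℝ V)) : contrList l 0 = 0 := by
  simpa using contrList_smul 0 l 0

lemma contrList_sum {κ : Type*} (t : Finset κ) (y : κ → ExteriorAlgebra ℝ V)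
    (l : List (Module.Dual ℝ V)) : contrList l (∑ k ∈ t, y k) = ∑ k ∈ t, contrList l (y k) :=
  map_sum (⟨⟨contrList l, contrList_zero l⟩, contrList_add l⟩ : ExteriorAlgebra ℝ V →+ ℝ) _ _

lemma contrList_ofFn {n : ℕ} (α : Fin n → Module.Dual ℝ V) (x : ExteriorAlgebra ℝ V) :
    contrList (List.ofFn α) x = extPairing α x := by
  induction n generalizing x with
  | zero => rw [extPairing_zero]; rfl
  | succ n ih => rw [extPairing_succ, List.ofFn_succ, contrList, ih]

lemma extPower_zero : ⋀[ℝ]^0 V = 1 := pow_zero _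

lemma extPower_succ (n : ℕ) :
    ⋀[ℝ]^(n + 1) V = LinearMap.range (ExteriorAlgebra.ι ℝ (M := V)) * ⋀[ℝ]^n V := pow_succ' _ _

lemma contr_mem {n : ℕ} (d : Module.Dual ℝ V) {x : ExteriorAlgebra ℝ V} (hx : x ∈ ⋀[ℝ]^(n + 1) V) :
    contr d x ∈ ⋀[ℝ]^n V := by
  induction n generalizing x with
  | zero =>
    rw [extPower_succ, extPower_zero, mul_one] at hx
    obtain ⟨v, rfl⟩ := hx
    rw [← mul_one (ExteriorAlgebra.ι ℝ v), contr_ι_mul, contr_one, mul_zero, sub_zero,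
      extPower_zero]
    exact Submodule.smul_mem _ _ (Submodule.one_le.1 le_rfl)
  | succ n ih =>
    rw [extPower_succ] at hx
    induction hx using Submodule.mul_induction_on' with
    | mem_mul_mem v hv y hy =>
      obtain ⟨v, rfl⟩ := hv
      rw [contr_ι_mul]
      refine sub_mem (Submodule.smul_mem _ _ hy) ?_
      rw [extPower_succ]
      exact Submodule.mul_mem_mul ⟨v, rfl⟩ (ih hy)
    | add x _ y _ hx hy => rw [map_add]; exact add_mem hx hy

lemma contr_of_mem_zero (d : Module.Dual ℝ V) {x : ExteriorAlgebra ℝ V} (hx : x ∈ ⋀[ℝ]^0 V) :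
    contr d x = 0 := by
  rw [extPower_zero] at hx
  obtain ⟨r, rfl⟩ := Submodule.mem_one.1 hx
  exact contr_algebraMap d r

lemma extEv_of_mem {n : ℕ} {x : ExteriorAlgebra ℝ V} (hx : x ∈ ⋀[ℝ]^(n + 1) V) : extEv x = 0 := by
  rw [extPower_succ] at hx
  induction hx using Submodule.mul_induction_on' with
  | mem_mul_mem v hv y hy =>
    obtain ⟨v, rfl⟩ := hv
    rw [map_mul, extEv_ι, zero_mul]
  | add x _ y _ hx hy => rw [map_add, hx, hy, add_zero]

lemma contrList_of_mem (l : List (Module.Dual ℝ V)) : ∀ {n : ℕ} {x : ExteriorAlgebra ℝ V},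
    x ∈ ⋀[ℝ]^n V → l.length ≠ n → contrList l x = 0 := by
  induction l with
  | nil =>
    intro n x hx hn
    obtain ⟨n, rfl⟩ : ∃ m, n = m + 1 := Nat.exists_eq_succ_of_ne_zero (Ne.symm hn)
    exact extEv_of_mem hx
  | cons d l ih =>
    intro n x hx hn
    rw [contrList]
    cases n with
    | zero => rw [contr_of_mem_zero d hx, contrList_zero]
    | succ n => exact ih (contr_mem d hx) (by simpa using hn)

/-! ### Reconstruction from the values of iterated contractions -/

/-- The element of degree `n` with given coefficients in a frame `e`. -/
def reconstruct {κ B : Type*} [Fintype κ] [Ring B] [Algebra ℝ B] (e : κ → B) :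
    ℕ → (List κ → B) → B
  | 0, c => c []
  | n + 1, c => ((n : ℝ) + 1)⁻¹ • ∑ i, e i * reconstruct e n fun l => c (i :: l)

lemma map_reconstruct {κ B C : Type*} [Fintype κ] [Ring B] [Algebra ℝ B] [Ring C] [Algebra ℝ C]
    (φ : B →ₐ[ℝ] C) (e : κ → B) (n : ℕ) (c : List κ → B) :
    φ (reconstruct e n c) = reconstruct (fun i => φ (e i)) n fun l => φ (c l) := by
  induction n generalizing c with
  | zero => rfl
  | succ n ih => simp [reconstruct, ih]

section Frame

variable {κ : Type*} [Fintype κ] {e : κ → V} {x : κ → Module.Dual ℝ V}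

/-- In the sum over `i`, the derivative of the leading factor leaves one copy of the right-hand
side. The derivatives of the remaining factors give `n` further copies, by induction and by the
skewness that exchanges `i` and `j`. The factor `(n + 1)⁻¹` in `reconstruct` compensates for this.
-/
lemma contr_reconstruct [DecidableEq κ] (hx : ∀ i j, x i (e j) = if i = j then 1 else 0)
    (n : ℕ) (c : List κ → ℝ)
    (hc : IsSkew c) (j : κ) :
    contr (x j) (reconstruct (fun i => ExteriorAlgebra.ι ℝ (e i)) (n + 1)
        fun l => algebraMap ℝ _ (c l)) =
      reconstruct (fun i => ExteriorAlgebra.ι ℝ (e i)) n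
        fun l => algebraMap ℝ (ExteriorAlgebra ℝ V) (c (j :: l)) := by
  have hn : ((n : ℝ) + 1) ≠ 0 := by positivity
  rw [reconstruct, map_smul, inv_smul_eq_iff₀ hn, map_sum]
  simp only [contr_ι_mul, hx, ite_smul, one_smul, zero_smul, Finset.sum_sub_distrib]
  rw [Finset.sum_ite_eq, if_pos (Finset.mem_univ j)]
  induction n generalizing c j with
  | zero => simp [reconstruct, contr_algebraMap]
  | succ n ih =>
    have hn' : ((n : ℝ) + 1) ≠ 0 := by positivity
    have key (i : κ) : contr (x j) (reconstruct (fun i => ExteriorAlgebra.ι ℝ (e i)) (n + 1)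
          fun l => algebraMap ℝ _ (c (i :: l))) =
        -reconstruct (fun i => ExteriorAlgebra.ι ℝ (e i)) n
          fun l => algebraMap ℝ (ExteriorAlgebra ℝ V) (c (j :: i :: l)) := by
      have h := ih (fun l => c (i :: l)) (hc.ins i) j (by positivity)
      have hneg : ∀ (n : ℕ) (b : List κ → ExteriorAlgebra ℝ V),
          reconstruct (fun i => ExteriorAlgebra.ι ℝ (e i)) n (fun l => -b l) =
            -reconstruct (fun i => ExteriorAlgebra.ι ℝ (e i)) n b := by
        intro n
        induction n with
        | zero => intro b; rfl
        | succ n ih => intro b; simp [reconstruct, ih]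
      rw [← hneg, reconstruct, map_smul, inv_smul_eq_iff₀ hn', map_sum]
      simp only [contr_ι_mul, hx, ite_smul, one_smul, zero_smul, Finset.sum_sub_distrib]
      rw [Finset.sum_ite_eq, if_pos (Finset.mem_univ j), h]
      have h' (l : List κ) : c (i :: j :: l) = -c (j :: i :: l) := hc [] i j l
      simp only [h', map_neg]
    simp only [key, mul_neg, Finset.sum_neg_distrib, sub_neg_eq_add]
    rw [reconstruct, Nat.cast_succ, add_smul _ (1 : ℝ), one_smul, smul_inv_smul₀ hn', add_comm]

lemma contrList_reconstruct [DecidableEq κ] (hx : ∀ i j, x i (e j) = if i = j then 1 else 0)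
    (l : List κ) :
    ∀ (n : ℕ) (c : List κ → ℝ) (_ : IsSkew c),
      contrList (l.map x) (reconstruct (fun i => ExteriorAlgebra.ι ℝ (e i)) n
        fun l => algebraMap ℝ _ (c l)) = if l.length = n then c l else 0 := by
  induction l with
  | nil =>
    intro n c hc
    cases n with
    | zero => simp [contrList, reconstruct]
    | succ n => simp [contrList, reconstruct, extEv_ι]
  | cons j l ih =>
    intro n c hc
    rw [List.map_cons, contrList]
    cases n with
    | zero => simp [reconstruct, contr_algebraMap, contrList_zero]
    | succ n =>
      rw [contr_reconstruct hx n c hc, ih n (fun l => c (j :: l)) (hc.ins j)]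
      simp

/-- Euler's identity. -/
lemma sum_ι_mul_contr (he : ∀ v, ∑ i, x i v • e i = v) {n : ℕ} {w : ExteriorAlgebra ℝ V}
    (hw : w ∈ ⋀[ℝ]^n V) :
    ∑ i, ExteriorAlgebra.ι ℝ (e i) * contr (x i) w = (n : ℝ) • w := by
  induction hw using Submodule.pow_induction_on_left' with
  | algebraMap r => simp [contr_algebraMap]
  | add w w' n hw hw' h h' => simp only [map_add, mul_add, Finset.sum_add_distrib, h, h', smul_add]
  | mem_mul v hv n w hw h =>
    obtain ⟨v, rfl⟩ := hv
    have h1 (i : κ) : ExteriorAlgebra.ι ℝ (e i) * contr (x i) (ExteriorAlgebra.ι ℝ v * w) =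
        ExteriorAlgebra.ι ℝ (x i v • e i) * w +
          ExteriorAlgebra.ι ℝ v * (ExteriorAlgebra.ι ℝ (e i) * contr (x i) w) := by
      have h2 := ExteriorAlgebra.ι_add_mul_swap (R := ℝ) (e i) v
      rw [contr_ι_mul, mul_sub, ← mul_assoc, ← mul_assoc, eq_neg_of_add_eq_zero_left h2, map_smul]
      simp
    simp only [h1, Finset.sum_add_distrib, ← Finset.mul_sum, ← Finset.sum_mul, ← map_sum, he, h]
    rw [mul_smul_comm, Nat.cast_succ, add_smul, one_smul, add_comm]

/-- By induction all contractions of `w` with the dual frame vanish, and Euler's identity recovers a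
nonzero multiple of `w` from them. -/
lemma eq_zero_of_mem (he : ∀ v, ∑ i, x i v • e i = v) : ∀ {n : ℕ} {w : ExteriorAlgebra ℝ V},
    w ∈ ⋀[ℝ]^n V → (∀ l : List κ, l.length = n → contrList (l.map x) w = 0) → w = 0 := by
  intro n
  induction n with
  | zero =>
    intro w hw h
    rw [extPower_zero] at hw
    obtain ⟨r, rfl⟩ := Submodule.mem_one.1 hw
    have := h [] rfl
    rw [List.map_nil, contrList, extEv_algebraMap] at this
    rw [this, map_zero]
  | succ n ih =>
    intro w hw h
    have h1 := sum_ι_mul_contr he hw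
    have h2 (i : κ) : contr (x i) w = 0 :=
      ih (contr_mem _ hw) fun l hl => h (i :: l) (by simpa using hl)
    simp only [h2, mul_zero, Finset.sum_const_zero] at h1
    exact ((smul_eq_zero.1 h1.symm).resolve_left (by positivity))

/-- An iterated contraction of length `k` sees only the component of degree `k`, so every component
of degree other than `n` vanishes. -/
lemma mem_of_contrList (he : ∀ v, ∑ i, x i v • e i = v) {w : ExteriorAlgebra ℝ V} (n : ℕ)
    (h : ∀ l : List κ, l.length ≠ n → contrList (l.map x) w = 0) : w ∈ ⋀[ℝ]^n V := by
  classical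
  set y := DirectSum.decompose (fun i : ℕ => ⋀[ℝ]^i V) w with hy
  have hw : w = ∑ i ∈ y.support, (y i : ExteriorAlgebra ℝ V) :=
    (DirectSum.sum_support_decompose (fun i : ℕ => ⋀[ℝ]^i V) w).symm
  have key (k : ℕ) (hk : k ≠ n) : (y k : ExteriorAlgebra ℝ V) = 0 := by
    refine eq_zero_of_mem he (y k).2 fun l hl => ?_
    have h1 := h l (by omega)
    rw [hw, contrList_sum] at h1
    by_cases hk' : k ∈ y.support
    · rw [Finset.sum_eq_single_of_mem k hk' fun j _ hj =>
        contrList_of_mem _ (y j).2 (by simp; omega)] at h1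
      exact h1
    · rw [DFinsupp.notMem_support_iff.1 hk', Submodule.coe_zero, contrList_zero]
  rw [hw]
  refine sum_mem fun i _ => ?_
  by_cases hi : i = n
  · subst hi; exact (y i).2
  · rw [key i hi]; exact zero_mem _

lemma eq_of_contrList (he : ∀ v, ∑ i, x i v • e i = v) {w w' : ExteriorAlgebra ℝ V}
    (h : ∀ l : List κ, contrList (l.map x) w = contrList (l.map x) w') : w = w' := by
  have h' (l : List κ) : contrList (l.map x) (w - w') = 0 := by
    have := contrList_add (l.map x) (w - w') w'
    rw [sub_add_cancel, h] at this
    linarith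
  rw [← sub_eq_zero]
  -- All values of the difference vanish, so it is homogeneous of any chosen degree; degree `0`
  -- serves.
  exact eq_zero_of_mem he (mem_of_contrList he 0 fun l _ => h' l) fun l _ => h' l

end Frame

end Exterior

/-! ### Smooth functions and multivector fields near a point -/

section Local

open Filter Topology

variable {E : Type*} [NormedAddCommGroup E] [NormedSpace ℝ E]
  {M : Type*} [TopologicalSpace M] [ChartedSpace E M] [IsManifold 𝓘(ℝ, E) ∞ M]

/-- Smoothness at a point of a section of `⋀ TM`. -/
def MultivectorSmoothAt (X : ∀ p : M, ExtTan E p) (p₀ : M) : Prop :=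
  ∀ l : ExteriorAlgebra ℝ E →ₗ[ℝ] ℝ,
    ContMDiffAt 𝓘(ℝ, E) 𝓘(ℝ, ℝ) ∞ (fun p => l (extTriv E p₀ p (X p))) p₀

lemma MultivectorSmoothAt.congr {X Y : ∀ p : M, ExtTan E p} {p₀ : M}
    (h : MultivectorSmoothAt X p₀) (hXY : ∀ᶠ p in 𝓝 p₀, Y p = X p) : MultivectorSmoothAt Y p₀ :=
  fun l => (h l).congr_of_eventuallyEq (by filter_upwards [hXY] with p hp; rw [hp])

lemma contMDiffAt_dAt (f : Smooth E M) {V : ∀ p : M, Tan E p} {p₀ : M}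
    (hV : ContMDiffAt 𝓘(ℝ, E) (𝓘(ℝ, E).prod 𝓘(ℝ, E)) ∞
        (fun p => (TotalSpace.mk' E p (V p) : TangentBundle 𝓘(ℝ, E) M)) p₀) :
    ContMDiffAt 𝓘(ℝ, E) 𝓘(ℝ, ℝ) ∞ (fun p => dAt f p (V p)) p₀ := by
  have h1 : ContMDiff 𝓘(ℝ, E).tangent 𝓘(ℝ, ℝ).tangent ∞ (tangentMap 𝓘(ℝ, E) 𝓘(ℝ, ℝ) f) :=
    f.contMDiff.contMDiff_tangentMap (by simp)
  have h2 := (contMDiff_snd_tangentBundle_modelSpace ℝ 𝓘(ℝ, ℝ) (n := ∞)).contMDiffAt.comp p₀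
    (h1.contMDiffAt.comp p₀ hV)
  exact h2

variable [FiniteDimensional ℝ E]

lemma exists_cutoff [T2Space M] (p : M) {U : Set M} (hU : U ∈ 𝓝 p) :
    ∃ χ : Smooth E M, χ =ᶠ[𝓝 p] 1 ∧ tsupport χ ⊆ U := by
  obtain ⟨f, hf⟩ := (SmoothBumpFunction.nhds_basis_tsupport (I := 𝓘(ℝ, E)) p).mem_iff.1 hU
  exact ⟨⟨f, f.contMDiff⟩, f.eventuallyEq_one, hf.2⟩

lemma exists_smooth_eq [T2Space M] (p : M) {f : M → ℝ}
    (hf : ∀ᶠ q in 𝓝 p, ContMDiffAt 𝓘(ℝ, E) 𝓘(ℝ, ℝ) ∞ f q) :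
    ∃ g : Smooth E M, g =ᶠ[𝓝 p] f := by
  obtain ⟨χ, h1, h2⟩ := exists_cutoff (E := E) p hf
  refine ⟨⟨fun q => χ q * f q, contMDiff_of_tsupport fun q hq => ?_⟩, ?_⟩
  · exact (χ.contMDiff q).mul (h2 (tsupport_mul_subset_left hq))
  · filter_upwards [h1] with q hq
    simp [hq]

/-- That `Y` is a multiple of `X` everywhere, and not only near `p`, keeps it in the degree of `X`.
-/
lemma exists_multivector_eq [T2Space M] (p : M) {X : ∀ p : M, ExtTan E p}
    (hX : ∀ᶠ q in 𝓝 p, MultivectorSmoothAt X q) :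
    ∃ Y : Multivector E M, (∃ χ : Smooth E M, ∀ q, Y.1 q = χ q • X q) ∧
      ∀ᶠ q in 𝓝 p, Y.1 q = X q := by
  obtain ⟨χ, h1, h2⟩ := exists_cutoff (E := E) p hX
  refine ⟨⟨fun q => χ q • X q, fun q => ?_⟩, ⟨χ, fun _ => rfl⟩, ?_⟩
  · by_cases hq : q ∈ tsupport χ
    · intro l
      simp only [map_smul, smul_eq_mul]
      exact (χ.contMDiff q).mul (h2 hq l)
    · have h0 : MultivectorSmoothAt (0 : ∀ p : M, ExtTan E p) q := fun l => by
        simpa using contMDiffAt_const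
      refine h0.congr ?_
      filter_upwards [(isClosed_tsupport χ).isOpen_compl.mem_nhds hq] with r hr
      rw [image_eq_zero_of_notMem_tsupport hr, zero_smul]
      rfl
  · filter_upwards [h1] with q hq
    simp [hq]

lemma multivectorSmoothAt_ι {V : ∀ p : M, Tan E p} {p₀ : M} :
    MultivectorSmoothAt (fun p => ExteriorAlgebra.ι ℝ (V p)) p₀ ↔
      ContMDiffAt 𝓘(ℝ, E) (𝓘(ℝ, E).prod 𝓘(ℝ, E)) ∞
        (fun p => (TotalSpace.mk' E p (V p) : TangentBundle 𝓘(ℝ, E) M)) p₀ := by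
  have e : (fun p => (trivializationAt E (TangentSpace 𝓘(ℝ, E)) p₀ ⟨p, V p⟩).2) =ᶠ[𝓝 p₀]
      fun p => (trivializationAt E (TangentSpace 𝓘(ℝ, E)) p₀).linearMapAt ℝ p (V p) := by
    filter_upwards [(trivializationAt E (TangentSpace 𝓘(ℝ, E)) p₀).open_baseSet.mem_nhds
      (FiberBundle.mem_baseSet_trivializationAt' p₀)] with p hp
    rw [Trivialization.coe_linearMapAt_of_mem _ hp]
  rw [Bundle.contMDiffAt_section]
  constructor
  · intro h
    refine ContMDiffAt.congr_of_eventuallyEq ?_ e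
    let b := Module.finBasis ℝ E
    have h2 : (fun p => (trivializationAt E (TangentSpace 𝓘(ℝ, E)) p₀).linearMapAt ℝ p (V p)) =
        fun p => ∑ i, b.coord i (ExteriorAlgebra.ιInv (extTriv E p₀ p (ExteriorAlgebra.ι ℝ (V p))))
          • b i := by
      funext p
      rw [extTriv, ExteriorAlgebra.map_apply_ι, ExteriorAlgebra.ι_leftInverse]
      exact (b.sum_repr _).symm
    rw [h2]
    refine contMDiffAt_finsetSum fun i _ => ?_
    exact (h (b.coord i ∘ₗ ExteriorAlgebra.ιInv)).smul contMDiffAt_const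
  · intro h l
    have h' := h.congr_of_eventuallyEq e.symm
    have h2 : (fun p => l (extTriv E p₀ p (ExteriorAlgebra.ι ℝ (V p)))) = fun p =>
        LinearMap.toContinuousLinearMap (l ∘ₗ ExteriorAlgebra.ι ℝ)
          ((trivializationAt E (TangentSpace 𝓘(ℝ, E)) p₀).linearMapAt ℝ p (V p)) := by
      funext p
      rw [extTriv, ExteriorAlgebra.map_apply_ι]
      rfl
    rw [h2]
    exact (ContinuousLinearMap.contMDiff _).contMDiffAt.comp p₀ h'

end Local

/-! ### Coordinate frames -/

section Frame

open Filter Topology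

variable {E : Type*} [NormedAddCommGroup E] [NormedSpace ℝ E] [FiniteDimensional ℝ E]
  {M : Type*} [TopologicalSpace M] [ChartedSpace E M] [IsManifold 𝓘(ℝ, E) ∞ M]

/-- Functions and vector fields that form, near `p₀`, coordinates and the coordinate frame. -/
structure IsFrame (p₀ : M) (x : Fin (Module.finrank ℝ E) → Smooth E M)
    (v : Fin (Module.finrank ℝ E) → ∀ p : M, Tan E p) : Prop where
  smooth : ∀ i, ∀ᶠ q in 𝓝 p₀, ContMDiffAt 𝓘(ℝ, E) (𝓘(ℝ, E).prod 𝓘(ℝ, E)) ∞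
        (fun p => (TotalSpace.mk' E p (v i p) : TangentBundle 𝓘(ℝ, E) M)) q
  dAt_eq : ∀ i, ∀ᶠ p in 𝓝 p₀, dAt (x i) p = (Module.finBasis ℝ E).coord i ∘ₗ
    (trivializationAt E (TangentSpace 𝓘(ℝ, E)) p₀).linearMapAt ℝ p
  dual : ∀ᶠ p in 𝓝 p₀, ∀ i j, dAt (x i) p (v j p) = if i = j then 1 else 0
  sum_smul : ∀ᶠ p in 𝓝 p₀, ∀ w : Tan E p, ∑ i, dAt (x i) p w • v i p = w

/-- The functions are cut-off chart coordinates, and the vector fields the frame of the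
trivialization of `TM` around `p₀`. On the chart domain this trivialization is the derivative of the
chart, so the two are dual to each other. -/
lemma exists_frame [T2Space M] (p₀ : M) : ∃ x v, IsFrame (E := E) p₀ x v := by
  set b := Module.finBasis ℝ E
  set t := trivializationAt E (TangentSpace 𝓘(ℝ, E)) p₀ with ht
  have hsm : ∀ i, ∀ᶠ q in 𝓝 p₀, ContMDiffAt 𝓘(ℝ, E) 𝓘(ℝ, ℝ) ∞
      (fun q => LinearMap.toContinuousLinearMap (b.coord i) (extChartAt 𝓘(ℝ, E) p₀ q)) q := by
    intro i
    filter_upwards [chart_source_mem_nhds E p₀] with q hq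
    exact (ContinuousLinearMap.contMDiff _).contMDiffAt.comp q (contMDiffAt_extChartAt' hq)
  choose x hx using fun i => exists_smooth_eq p₀ (hsm i)
  have hbase : t.baseSet ∈ 𝓝 p₀ := t.open_baseSet.mem_nhds
      (FiberBundle.mem_baseSet_trivializationAt' p₀)
  have hd : ∀ i, ∀ᶠ p in 𝓝 p₀, dAt (x i) p = b.coord i ∘ₗ t.linearMapAt ℝ p := by
    intro i
    filter_upwards [chart_source_mem_nhds E p₀, (hx i).eventually_nhds, hbase] with p hp hxp hb
    have h1 : HasMFDerivAt 𝓘(ℝ, E) 𝓘(ℝ, ℝ) (fun q => LinearMap.toContinuousLinearMap (b.coord i)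
        (extChartAt 𝓘(ℝ, E) p₀ q)) p ((LinearMap.toContinuousLinearMap (b.coord i)).comp
          (mfderiv 𝓘(ℝ, E) 𝓘(ℝ, E) (extChartAt 𝓘(ℝ, E) p₀) p)) :=
      ((LinearMap.toContinuousLinearMap (b.coord i)).hasMFDerivAt).comp p
        (mdifferentiableAt_extChartAt hp).hasMFDerivAt
    have h2 := h1.congr_of_eventuallyEq hxp
    unfold dAt
    rw [h2.mfderiv, ← TangentBundle.continuousLinearMapAt_trivializationAt hp]
    rfl
  refine ⟨x, fun i => t.localFrame b i, ⟨fun i => ?_, hd, ?_, ?_⟩⟩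
  · filter_upwards [hbase] with p hp
    exact contMDiffAt_localFrame_of_mem (I := 𝓘(ℝ, E)) (n := ∞) (e := t) b i hp
  · filter_upwards [hbase, Filter.eventually_all.2 hd] with p hp h i j
    rw [h, t.localFrame_apply_of_mem_baseSet b hp]
    simp [Trivialization.basisAt, hp, Finsupp.single_apply, eq_comm]
  · filter_upwards [hbase, Filter.eventually_all.2 hd] with p hp h w
    conv_rhs => rw [← (t.basisAt b hp).sum_repr w]
    refine Finset.sum_congr rfl fun i _ => ?_
    rw [h, t.localFrame_apply_of_mem_baseSet b hp]
    congr 1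
    simp [Trivialization.basisAt, hp]

end Frame

/-! ### Hadamard's lemma and the locality of derivations -/

section Hadamard

open Filter Topology

variable {E : Type*} [NormedAddCommGroup E] [NormedSpace ℝ E] [FiniteDimensional ℝ E]

-- Differentiation under the integral sign, iterated. The derivative takes values in `E →L[ℝ] F`, so
-- `F` is quantified inside the induction and shares the universe of `E`.
universe u in
lemma contDiff_integral {E : Type u} [NormedAddCommGroup E] [NormedSpace ℝ E]
    [FiniteDimensional ℝ E] (n : ℕ) :
    ∀ {F : Type u} [NormedAddCommGroup F] [NormedSpace ℝ F] [CompleteSpace F] {h : ℝ × E → F},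
      ContDiff ℝ ∞ h → ContDiff ℝ n fun x => ∫ t in (0 : ℝ)..1, h (t, x) := by
  have key : ∀ {F : Type u} [NormedAddCommGroup F] [NormedSpace ℝ F] [CompleteSpace F]
      {h : ℝ × E → F}, ContDiff ℝ ∞ h → ∀ x₀, HasFDerivAt (fun x => ∫ t in (0 : ℝ)..1, h (t, x))
        (∫ t in (0 : ℝ)..1, (fderiv ℝ h (t, x₀)).comp (ContinuousLinearMap.inr ℝ ℝ E)) x₀ := by
    intro F _ _ _ h hh x₀
    have hc : Continuous fun q : ℝ × E => (fderiv ℝ h q).comp (ContinuousLinearMap.inr ℝ ℝ E) :=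
      (hh.continuous_fderiv (by simp)).clm_comp continuous_const
    obtain ⟨C, hC⟩ := ((isCompact_Icc (a := (0 : ℝ)) (b := 1)).prod
      (isCompact_closedBall x₀ 1)).exists_bound_of_continuousOn hc.continuousOn
    refine intervalIntegral.hasFDerivAt_integral_of_dominated_of_fderiv_le
      (F := fun x t => h (t, x))
      (F' := fun x t => (fderiv ℝ h (t, x)).comp (ContinuousLinearMap.inr ℝ ℝ E))
      (bound := fun _ => C) (Metric.closedBall_mem_nhds x₀ one_pos) ?_ ?_ ?_ ?_ ?_ ?_
    · exact .of_forall fun x => (hh.continuous.comp (by fun_prop)).aestronglyMeasurable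
    · exact (hh.continuous.comp (by fun_prop)).intervalIntegrable _ _
    · exact (hc.comp (by fun_prop : Continuous fun t : ℝ => (t, x₀))).aestronglyMeasurable
    · refine .of_forall fun t ht x hx => hC (t, x) ⟨?_, hx⟩
      rw [Set.uIoc_of_le zero_le_one] at ht
      exact ⟨ht.1.le, ht.2⟩
    · exact intervalIntegrable_const
    · refine .of_forall fun t ht x hx => ?_
      have h1 : HasFDerivAt h (fderiv ℝ h (t, x)) (t, x) :=
        (hh.differentiable (by simp) _).hasFDerivAt
      exact h1.comp x (hasFDerivAt_prodMk_right t x)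
  induction n with
  | zero =>
    intro F _ _ _ h hh
    exact contDiff_zero.2 (continuous_iff_continuousAt.2 fun x => (key hh x).continuousAt)
  | succ n ih =>
    intro F _ _ _ h hh
    have : ((n + 1 : ℕ) : WithTop ℕ∞) = (n : WithTop ℕ∞) + 1 := by norm_cast
    rw [this, contDiff_succ_iff_hasFDerivAt]
    refine ⟨_, ih ((hh.fderiv_right (m := ∞) (by simp)).clm_comp
      (contDiff_const (c := ContinuousLinearMap.inr ℝ ℝ E))), fun x => key hh x⟩

/-- Integrate the derivative of `F` along the segment from `y` to `x`. -/
lemma exists_hadamard {F : E → ℝ} (hF : ContDiff ℝ ∞ F) (y : E) :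
    ∃ L : E → E →L[ℝ] ℝ, ContDiff ℝ ∞ L ∧ L y = fderiv ℝ F y ∧ ∀ x, F x = F y + L x (x - y) := by
  let h : ℝ × E → E →L[ℝ] ℝ := fun q => fderiv ℝ F (y + q.1 • (q.2 - y))
  have hh : ContDiff ℝ ∞ h := (hF.fderiv_right (m := ∞) (by simp)).comp (by fun_prop)
  refine ⟨fun x => ∫ t in (0 : ℝ)..1, h (t, x), contDiff_infty.2 fun n => contDiff_integral n hh,
    by simp [h], fun x => ?_⟩
  have hd : ∀ t ∈ Set.uIcc (0 : ℝ) 1, HasDerivAt (fun t : ℝ => F (y + t • (x - y)))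
      (h (t, x) (x - y)) t := by
    intro t _
    have h1 : HasFDerivAt F (fderiv ℝ F (y + t • (x - y))) (y + t • (x - y)) :=
      (hF.differentiable (by simp) _).hasFDerivAt
    have h2 : HasDerivAt (fun t : ℝ => y + t • (x - y)) ((1 : ℝ) • (x - y)) t :=
      ((hasDerivAt_id t).smul_const (x - y)).const_add y
    rw [one_smul] at h2
    exact h1.comp_hasDerivAt t h2
  have hc : Continuous fun t : ℝ => h (t, x) := hh.continuous.comp (by fun_prop)
  have := intervalIntegral.integral_eq_sub_of_hasDerivAt hd
    ((hc.clm_apply continuous_const).intervalIntegrable _ _)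
  have h3 : (∫ t in (0 : ℝ)..1, h (t, x)) (x - y) = ∫ t in (0 : ℝ)..1, h (t, x) (x - y) :=
    ContinuousLinearMap.intervalIntegral_apply (hc.intervalIntegrable _ _) _
  simp only [h3, this, one_smul, zero_smul, add_zero]
  simp

variable {M : Type*} [TopologicalSpace M] [ChartedSpace E M] [IsManifold 𝓘(ℝ, E) ∞ M] [T2Space M]

/-- A cutoff `χ` that is `1` near `p` and supported where `f` vanishes gives `χ * f = 0`; apply the
Leibniz rule at `p`. -/
lemma IsDer.eq_zero_of_eventuallyEq {φ : Smooth E M → Smooth E M} (hφ : IsDer φ) {p : M}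
    {f : Smooth E M} (h : f =ᶠ[𝓝 p] 0) : φ f p = 0 := by
  obtain ⟨χ, h1, h2⟩ := exists_cutoff (E := E) p h
  have h0 : χ * f = 0 := by
    ext q
    by_cases hq : q ∈ tsupport χ
    · have : f q = 0 := h2 hq
      simp [this]
    · simp [image_eq_zero_of_notMem_tsupport hq]
  obtain ⟨δ, hδ⟩ := hφ
  have h3 : δ (χ * f) p = 0 := by rw [h0]; simp
  have hp : χ p = 1 := h1.self_of_nhds
  have hp' : f p = 0 := h.self_of_nhds
  simp only [Derivation.leibniz, smul_eq_mul, ContMDiffMap.coe_add, ContMDiffMap.coe_mul,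
    Pi.add_apply, Pi.mul_apply, hp, hp', one_mul, zero_mul, add_zero] at h3
  rw [hδ]
  exact h3

lemma IsDer.eq_of_eventuallyEq {φ : Smooth E M → Smooth E M} (hφ : IsDer φ) {p : M}
    {f g : Smooth E M} (h : f =ᶠ[𝓝 p] g) : φ f p = φ g p := by
  have h0 : φ (f - g) p = 0 := hφ.eq_zero_of_eventuallyEq (by
    filter_upwards [h] with q hq
    simp [hq])
  obtain ⟨δ, hδ⟩ := hφ
  simp only [hδ, map_sub] at h0 ⊢
  exact sub_eq_zero.1 h0

/-- Near `p`, Hadamard's lemma writes `f` as `f p` plus a sum of products of two functions that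
vanish at `p`: a coordinate minus its value at `p`, and a coefficient whose value at `p` is a
partial derivative of `f`. A derivation kills such a sum at `p`. -/
lemma IsDer.eq_zero_of_dAt_eq_zero {φ : Smooth E M → Smooth E M} (hφ : IsDer φ) {p : M}
    {f : Smooth E M} (hf : dAt f p = 0) : φ f p = 0 := by
  set c := extChartAt 𝓘(ℝ, E) p with hc
  set b := Module.finBasis ℝ E
  have hsrc : ∀ᶠ q in 𝓝 p, q ∈ (chartAt E p).source := chart_source_mem_nhds E p
  have hcs : ∀ᶠ q in 𝓝 p, ContMDiffAt 𝓘(ℝ, E) 𝓘(ℝ, E) ∞ c q := by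
    filter_upwards [hsrc] with q hq using contMDiffAt_extChartAt' hq
  have htgt : c.target ∈ 𝓝 (c p) := extChartAt_target_mem_nhds p
  -- The cutoff is taken on the model space, so that `F` is smooth on all of `E` and the segments of
  -- Hadamard's lemma stay in its domain.
  obtain ⟨F, hF⟩ := exists_smooth_eq (E := E) (c p) (f := f ∘ c.symm) (by
    filter_upwards [eventually_mem_nhds_iff.2 htgt] with y hy
    exact (f.contMDiff _).comp y ((contMDiffOn_extChartAt_symm p).contMDiffAt hy))
  obtain ⟨L, hL, hL0, hFL⟩ := exists_hadamard (contMDiff_iff_contDiff.1 F.contMDiff) (c p)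
  have hfd : L (c p) = 0 := by
    have h1 : HasMFDerivAt 𝓘(ℝ, E) 𝓘(ℝ, ℝ) (f ∘ c.symm) (c p)
        ((mfderiv 𝓘(ℝ, E) 𝓘(ℝ, ℝ) f (c.symm (c p))).comp
          (mfderiv 𝓘(ℝ, E) 𝓘(ℝ, E) c.symm (c p))) :=
      ((f.contMDiff.mdifferentiable (by simp)) _).hasMFDerivAt.comp _
        (((contMDiffOn_extChartAt_symm (n := ∞) p).contMDiffAt htgt).mdifferentiableAt
          (by simp)).hasMFDerivAt
    have h0 : mfderiv 𝓘(ℝ, E) 𝓘(ℝ, ℝ) f (c.symm (c p)) = 0 := by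
      rw [extChartAt_to_inv p]
      exact ContinuousLinearMap.ext fun w => LinearMap.congr_fun hf w
    have h2 := h1.congr_of_eventuallyEq hF
    rw [h0, ContinuousLinearMap.zero_comp] at h2
    rw [hL0]
    have h3 : HasFDerivAt (⇑F) (0 : E →L[ℝ] ℝ) (c p) := hasMFDerivAt_iff_hasFDerivAt.1 h2
    exact h3.fderiv
  choose x hx using fun i => exists_smooth_eq (E := E) p
    (f := fun q => LinearMap.toContinuousLinearMap (b.coord i) (c q)) (by
      filter_upwards [hcs] with q hq
      exact (ContinuousLinearMap.contMDiff _).contMDiffAt.comp q hq)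
  choose g hg using fun i => exists_smooth_eq (E := E) p (f := fun q => L (c q) (b i)) (by
      filter_upwards [hcs] with q hq
      exact (contMDiff_iff_contDiff.2 (hL.clm_apply (contDiff_const (c := b i)))).contMDiffAt.comp
        q hq)
  have hg0 : ∀ i, g i p = 0 := fun i => by
    rw [(hg i).self_of_nhds]
    exact DFunLike.congr_fun hfd (b i)
  have hfe : f =ᶠ[𝓝 p] ((f p • 1 + ∑ i, g i * (x i - x i p • 1) : Smooth E M)) := by
    filter_upwards [hsrc, Filter.eventually_all.2 hx, Filter.eventually_all.2 hg,
      (continuousAt_extChartAt p).eventually hF] with q hq hxq hgq hFq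
    have e1 : f q = F (c q) := by
      rw [hFq, comp_apply, c.left_inv (by rwa [hc, extChartAt_source])]
    have e2 : f p = F (c p) := by
      rw [hF.self_of_nhds, comp_apply, extChartAt_to_inv p]
    have e3 : c q - c p = ∑ i, (x i q - x i p) • b i := by
      rw [← b.sum_repr (c q - c p)]
      refine Finset.sum_congr rfl fun i _ => ?_
      rw [hxq, (hx i).self_of_nhds]
      simp
    have e4 : (∑ i, g i * (x i - x i p • 1) : Smooth E M) q =
        ∑ i, g i q * (x i q - x i p) := by
      rw [← ContMDiffMap.coeFnAddMonoidHom_apply, map_sum]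
      simp
    simp only [ContMDiffMap.coe_add, Pi.add_apply, e4, ContMDiffMap.coe_smul, Pi.smul_apply,
      ContMDiffMap.coe_one, Pi.one_apply, smul_eq_mul, mul_one]
    rw [e1, hFL, e2, e3, map_sum]
    congr 1
    refine Finset.sum_congr rfl fun i _ => ?_
    rw [(L (c q)).map_smul, hgq, smul_eq_mul, mul_comm]
  rw [hφ.eq_of_eventuallyEq hfe]
  obtain ⟨δ, hδ⟩ := hφ
  rw [hδ]
  have e5 : δ (f p • 1 + ∑ i, g i * (x i - x i p • 1)) =
      ∑ i, (g i * δ (x i) + (x i - x i p • 1) * δ (g i)) := by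
    simp
  rw [e5, ← ContMDiffMap.coeFnAddMonoidHom_apply, map_sum]
  simp [hg0]

end Hadamard

/-! ### The Lie bracket of vector fields as a commutator of derivations -/

section LieBracket

open Filter Topology VectorField

variable {E : Type*} [NormedAddCommGroup E] [NormedSpace ℝ E]
  {M : Type*} [TopologicalSpace M] [ChartedSpace E M] [IsManifold 𝓘(ℝ, E) ∞ M]

lemma fderiv_comp_extChartAt_symm (p : M) {y : E} (hy : y ∈ (extChartAt 𝓘(ℝ, E) p).target)
    {g : M → ℝ} (hg : MDifferentiableAt 𝓘(ℝ, E) 𝓘(ℝ, ℝ) g ((extChartAt 𝓘(ℝ, E) p).symm y))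
    (V : ∀ q : M, Tan E q) :
    (fderiv ℝ (g ∘ (extChartAt 𝓘(ℝ, E) p).symm) y : E →L[ℝ] ℝ)
      (mpullbackWithin 𝓘(ℝ, E) 𝓘(ℝ, E) (extChartAt 𝓘(ℝ, E) p).symm V (Set.range 𝓘(ℝ, E)) y) =
    mfderiv 𝓘(ℝ, E) 𝓘(ℝ, ℝ) g ((extChartAt 𝓘(ℝ, E) p).symm y)
      (V ((extChartAt 𝓘(ℝ, E) p).symm y)) := by
  have hinv := isInvertible_mfderivWithin_extChartAt_symm (I := 𝓘(ℝ, E)) hy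
  have h1 : HasMFDerivWithinAt 𝓘(ℝ, E) 𝓘(ℝ, ℝ) (g ∘ (extChartAt 𝓘(ℝ, E) p).symm)
      (Set.range 𝓘(ℝ, E)) y
        ((mfderiv 𝓘(ℝ, E) 𝓘(ℝ, ℝ) g ((extChartAt 𝓘(ℝ, E) p).symm y)).comp
          (mfderivWithin 𝓘(ℝ, E) 𝓘(ℝ, E) (extChartAt 𝓘(ℝ, E) p).symm (Set.range 𝓘(ℝ, E)) y)) :=
    hg.hasMFDerivAt.comp_hasMFDerivWithinAt _
      ((mdifferentiableWithinAt_extChartAt_symm hy).hasMFDerivWithinAt)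
  have h2 : HasFDerivAt (g ∘ (extChartAt 𝓘(ℝ, E) p).symm) (_ : E →L[ℝ] ℝ) y :=
    hasMFDerivAt_iff_hasFDerivAt.1 (h1.hasMFDerivAt (by simp))
  refine (DFunLike.congr_fun h2.fderiv _).trans ?_
  exact congrArg (mfderiv 𝓘(ℝ, E) 𝓘(ℝ, ℝ) g ((extChartAt 𝓘(ℝ, E) p).symm y))
    (hinv.self_apply_inverse _)

lemma mfderiv_inverse_extChartAt {g : M → ℝ} {p : M}
    (hg : MDifferentiableAt 𝓘(ℝ, E) 𝓘(ℝ, ℝ) g p) (w : E) :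
    mfderiv 𝓘(ℝ, E) 𝓘(ℝ, ℝ) g p
      ((mfderiv 𝓘(ℝ, E) 𝓘(ℝ, E) (extChartAt 𝓘(ℝ, E) p) p).inverse w) =
    (fderiv ℝ (g ∘ (extChartAt 𝓘(ℝ, E) p).symm) (extChartAt 𝓘(ℝ, E) p p) : E →L[ℝ] ℝ) w := by
  have hinv := isInvertible_mfderiv_extChartAt (I := 𝓘(ℝ, E))
    (mem_extChartAt_source (I := 𝓘(ℝ, E)) p)
  have htgt : (extChartAt 𝓘(ℝ, E) p).target ∈ 𝓝 (extChartAt 𝓘(ℝ, E) p p) :=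
    extChartAt_target_mem_nhds p
  have hd : MDifferentiableAt 𝓘(ℝ, E) 𝓘(ℝ, ℝ) (g ∘ (extChartAt 𝓘(ℝ, E) p).symm)
      (extChartAt 𝓘(ℝ, E) p p) := by
    refine MDifferentiableAt.comp (I' := 𝓘(ℝ, E)) _ ?_
      (((contMDiffOn_extChartAt_symm (n := ∞) p).contMDiffAt htgt).mdifferentiableAt (by simp))
    rwa [extChartAt_to_inv p]
  have h0 : HasFDerivAt (g ∘ (extChartAt 𝓘(ℝ, E) p).symm)
      (fderiv ℝ (g ∘ (extChartAt 𝓘(ℝ, E) p).symm) (extChartAt 𝓘(ℝ, E) p p) : E →L[ℝ] ℝ)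
      (extChartAt 𝓘(ℝ, E) p p) := hd.differentiableAt.hasFDerivAt
  have h1 := (hasMFDerivAt_iff_hasFDerivAt.2 h0).comp p
    (mdifferentiableAt_extChartAt (mem_chart_source E p)).hasMFDerivAt
  have h2 : g =ᶠ[𝓝 p] (g ∘ (extChartAt 𝓘(ℝ, E) p).symm) ∘ (extChartAt 𝓘(ℝ, E) p) := by
    filter_upwards [extChartAt_source_mem_nhds (I := 𝓘(ℝ, E)) p] with q hq
    rw [comp_apply, comp_apply, (extChartAt 𝓘(ℝ, E) p).left_inv hq]
  refine (DFunLike.congr_fun (h1.congr_of_eventuallyEq h2).mfderiv _).trans ?_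
  exact congrArg (fderiv ℝ (g ∘ (extChartAt 𝓘(ℝ, E) p).symm) (extChartAt 𝓘(ℝ, E) p p) : E →L[ℝ] ℝ)
    (hinv.self_apply_inverse _)

variable [FiniteDimensional ℝ E]

/-- Pulled back to the chart at `p`, this is the commutator of two directional derivatives, where
the second derivatives cancel by symmetry. The derivatives of `f` along `W` and `V` are given as
functions `g` and `h`, which need to represent them only near `p`. -/
lemma dAt_mlieBracket (f g h : Smooth E M) {V W : ∀ q : M, Tan E q} {p : M}
    (hV : ContMDiffAt 𝓘(ℝ, E) (𝓘(ℝ, E).prod 𝓘(ℝ, E)) ∞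
        (fun p => (TotalSpace.mk' E p (V p) : TangentBundle 𝓘(ℝ, E) M)) p)
    (hW : ContMDiffAt 𝓘(ℝ, E) (𝓘(ℝ, E).prod 𝓘(ℝ, E)) ∞
        (fun p => (TotalSpace.mk' E p (W p) : TangentBundle 𝓘(ℝ, E) M)) p)
    (hg : g =ᶠ[𝓝 p] fun q => dAt f q (W q)) (hh : h =ᶠ[𝓝 p] fun q => dAt f q (V q)) :
    dAt f p (mlieBracket 𝓘(ℝ, E) V W p) = dAt g p (V p) - dAt h p (W p) := by
  have : CompleteSpace E := FiniteDimensional.complete ℝ E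
  have : IsManifold 𝓘(ℝ, E) 2 M := .of_le (n := ∞) (by norm_cast)
  have hfd : ∀ q, MDifferentiableAt 𝓘(ℝ, E) 𝓘(ℝ, ℝ) f q := f.contMDiff.mdifferentiable (by simp)
  have htgt : (extChartAt 𝓘(ℝ, E) p).target ∈ 𝓝 (extChartAt 𝓘(ℝ, E) p p) :=
    extChartAt_target_mem_nhds p
  set V' := mpullbackWithin 𝓘(ℝ, E) 𝓘(ℝ, E) (extChartAt 𝓘(ℝ, E) p).symm V
    (Set.range 𝓘(ℝ, E)) with hV'
  set W' := mpullbackWithin 𝓘(ℝ, E) 𝓘(ℝ, E) (extChartAt 𝓘(ℝ, E) p).symm W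
    (Set.range 𝓘(ℝ, E)) with hW'
  set F : E → ℝ := f ∘ (extChartAt 𝓘(ℝ, E) p).symm with hF
  set y := extChartAt 𝓘(ℝ, E) p p with hy
  have hyt : y ∈ (extChartAt 𝓘(ℝ, E) p).target := mem_extChartAt_target p
  have hFs : ContDiffAt ℝ ∞ F y := by
    rw [← contMDiffAt_iff_contDiffAt]
    exact (f.contMDiff _).comp y ((contMDiffOn_extChartAt_symm p).contMDiffAt htgt)
  have diff : ∀ U : ∀ q : M, Tan E q, ContMDiffAt 𝓘(ℝ, E) (𝓘(ℝ, E).prod 𝓘(ℝ, E)) ∞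
        (fun p => (TotalSpace.mk' E p (U p) : TangentBundle 𝓘(ℝ, E) M)) p →
      DifferentiableAt ℝ (mpullbackWithin 𝓘(ℝ, E) 𝓘(ℝ, E) (extChartAt 𝓘(ℝ, E) p).symm U
        (Set.range 𝓘(ℝ, E)) : E → E) y := by
    intro U hU
    have := MDifferentiableWithinAt.differentiableWithinAt_mpullbackWithin_vectorField
      (s := Set.univ)
      (hU.mdifferentiableAt (by simp)).mdifferentiableWithinAt
    have h : ((extChartAt 𝓘(ℝ, E) p).symm ⁻¹' Set.univ ∩ Set.range 𝓘(ℝ, E)) = Set.univ := by simp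
    exact differentiableWithinAt_univ.1 (h ▸ this)
  have fin : ∀ (U U' : ∀ q : M, Tan E q) (g : Smooth E M), g =ᶠ[𝓝 p] (fun q => dAt f q (U q)) →
      (fderiv ℝ (fun x => (fderiv ℝ F x : E →L[ℝ] ℝ) (mpullbackWithin 𝓘(ℝ, E) 𝓘(ℝ, E)
        (extChartAt 𝓘(ℝ, E) p).symm U (Set.range 𝓘(ℝ, E)) x)) y : E →L[ℝ] ℝ)
        (mpullbackWithin 𝓘(ℝ, E) 𝓘(ℝ, E)
          (extChartAt 𝓘(ℝ, E) p).symm U' (Set.range 𝓘(ℝ, E)) y) = dAt g p (U' p) := by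
    intro U U' g hg
    have der : (fun x => (fderiv ℝ F x : E →L[ℝ] ℝ) (mpullbackWithin 𝓘(ℝ, E) 𝓘(ℝ, E)
        (extChartAt 𝓘(ℝ, E) p).symm U (Set.range 𝓘(ℝ, E)) x)) =ᶠ[𝓝 y]
        g ∘ (extChartAt 𝓘(ℝ, E) p).symm := by
      have hc : Tendsto (extChartAt 𝓘(ℝ, E) p).symm (𝓝 y) (𝓝 p) := by
        have := continuousAt_extChartAt_symm (I := 𝓘(ℝ, E)) p
        rwa [ContinuousAt, extChartAt_to_inv p] at this
      filter_upwards [htgt, hc.eventually hg] with x hx hgx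
      rw [comp_apply, hgx]
      exact fderiv_comp_extChartAt_symm p hx (hfd _) U
    rw [der.fderiv_eq]
    have h : (extChartAt 𝓘(ℝ, E) p).symm y = p := extChartAt_to_inv p
    refine (fderiv_comp_extChartAt_symm p hyt (g.contMDiff.mdifferentiable (by simp) _) U').trans ?_
    rw [h]
    rfl
  rw [← fin W V g hg, ← fin V W h hh]
  have hb := fderiv_apply_lieBracket (V := V') (W := W') hFs (by simp; norm_cast)
    (diff W hW) (diff V hV)
  refine Eq.trans ?_ hb
  refine (mfderiv_inverse_extChartAt (hfd p) _).trans ?_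
  congr 1
  have hs : ((extChartAt 𝓘(ℝ, E) p).symm ⁻¹' Set.univ ∩ Set.range 𝓘(ℝ, E)) = Set.univ := by simp
  have h4 : ∀ (s : Set E) (A B : E → E), s = Set.univ →
      lieBracketWithin ℝ A B s y = lieBracket ℝ A B y := by
    rintro s A B rfl
    rw [lieBracketWithin_univ]
  exact h4 _ V' W' hs

end LieBracket

/-! ### Gerstenhaber algebras of pairs -/

section Pairs

variable {T : Type*} [AddCommGroup T]

lemma negOnePow_smul_eq (n : ℤ) (x : T) : n.negOnePow • x = if Even n then x else -x := by
  split_ifs with h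
  · rw [Int.negOnePow_even _ h, one_smul]
  · rw [Int.negOnePow_odd _ (Int.not_even_iff_odd.1 h), Units.neg_smul, one_smul]

variable [Module ℝ T] {𝒜 : ℤ → Submodule ℝ T} {mul br : T →ₗ[ℝ] T →ₗ[ℝ] T}

namespace IsGerstenhaber

/-- This and the next three lemmas are the second components of the axioms for pairs. Each is a
signed combination of instances of the same axiom in which one entry is primed and has its degree
lowered by one; what remains is a check of parities. -/
lemma pair_mul_comm (h : IsGerstenhaber 𝒜 mul br) {i j : ℤ} {X X' Y Y' : T}
    (hX : X ∈ 𝒜 i) (hX' : X' ∈ 𝒜 (i - 1)) (hY : Y ∈ 𝒜 j) (hY' : Y' ∈ 𝒜 (j - 1)) :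
    mul X' Y + i.negOnePow • mul X Y' =
      (i * j).negOnePow • (mul Y' X + j.negOnePow • mul Y X') := by
  rw [h.mul_comm _ _ X' hX' Y hY, h.mul_comm _ _ X hX Y' hY']
  simp only [negOnePow_smul_eq, Int.even_mul, Int.even_sub, Int.not_even_one]
  by_cases hi : Even i <;> by_cases hj : Even j <;> simp [hi, hj] <;> abel

lemma pair_br_skew (h : IsGerstenhaber 𝒜 mul br) {i j : ℤ} {X X' Y Y' : T}
    (hX : X ∈ 𝒜 i) (hX' : X' ∈ 𝒜 (i - 1)) (hY : Y ∈ 𝒜 j) (hY' : Y' ∈ 𝒜 (j - 1)) :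
    br X' Y + (i - 1).negOnePow • br X Y' =
      -(((i - 1) * (j - 1)).negOnePow • (br Y' X + (j - 1).negOnePow • br Y X')) := by
  rw [h.br_skew _ _ X' hX' Y hY, h.br_skew _ _ X hX Y' hY']
  simp only [negOnePow_smul_eq, Int.even_mul, Int.even_sub, Int.not_even_one]
  by_cases hi : Even i <;> by_cases hj : Even j <;> simp [hi, hj] <;> abel

lemma pair_jacobi (h : IsGerstenhaber 𝒜 mul br) {i j k : ℤ} {X X' Y Y' Z Z' : T}
    (hX : X ∈ 𝒜 i) (hX' : X' ∈ 𝒜 (i - 1)) (hY : Y ∈ 𝒜 j) (hY' : Y' ∈ 𝒜 (j - 1))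
    (hZ : Z ∈ 𝒜 k) (hZ' : Z' ∈ 𝒜 (k - 1)) :
    br X' (br Y Z) + (i - 1).negOnePow • br X (br Y' Z + (j - 1).negOnePow • br Y Z') =
      br (br X' Y + (i - 1).negOnePow • br X Y') Z +
        (i + j - 1 - 1).negOnePow • br (br X Y) Z' +
      ((i - 1) * (j - 1)).negOnePow • (br Y' (br X Z) +
        (j - 1).negOnePow • br Y (br X' Z + (i - 1).negOnePow • br X Z')) := by
  have h1 := h.jacobi _ _ _ X' hX' Y hY Z hZ
  have h2 := h.jacobi _ _ _ X hX Y' hY' Z hZ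
  have h3 := h.jacobi _ _ _ X hX Y hY Z' hZ'
  simp only [negOnePow_smul_eq, Int.even_mul, Int.even_sub, Int.even_add, Int.not_even_one] at *
  by_cases hi : Even i <;> by_cases hj : Even j <;> simp [hi, hj] at * <;> rw [h1, h2, h3] <;> abel

lemma pair_leibniz (h : IsGerstenhaber 𝒜 mul br) {i j k : ℤ} {X X' Y Y' Z Z' : T}
    (hX : X ∈ 𝒜 i) (hX' : X' ∈ 𝒜 (i - 1)) (hY : Y ∈ 𝒜 j) (hY' : Y' ∈ 𝒜 (j - 1))
    (hZ : Z ∈ 𝒜 k) (hZ' : Z' ∈ 𝒜 (k - 1)) :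
    br X' (mul Y Z) + (i - 1).negOnePow • br X (mul Y' Z + j.negOnePow • mul Y Z') =
      mul (br X' Y + (i - 1).negOnePow • br X Y') Z + (i + j - 1).negOnePow • mul (br X Y) Z' +
      ((i - 1) * j).negOnePow • (mul Y' (br X Z) +
        j.negOnePow • mul Y (br X' Z + (i - 1).negOnePow • br X Z')) := by
  have h1 := h.leibniz _ _ _ X' hX' Y hY Z hZ
  have h2 := h.leibniz _ _ _ X hX Y' hY' Z hZ
  have h3 := h.leibniz _ _ _ X hX Y hY Z' hZ'
  simp only [negOnePow_smul_eq, Int.even_mul, Int.even_sub, Int.even_add, Int.not_even_one] at *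
  by_cases hi : Even i <;> by_cases hj : Even j <;> simp [hi, hj] at * <;> rw [h1, h2, h3] <;> abel

end IsGerstenhaber

end Pairs

/-! ### Uniqueness of Gerstenhaber brackets -/

section Uniqueness

variable {T ι : Type*} [AddCommGroup T] [Module ℝ T] {𝒜 : ℤ → Submodule ℝ T}
  {mul br br' : T →ₗ[ℝ] T →ₗ[ℝ] T}

/-- A graded algebra that is locally generated by its elements of degree `0` and `1`; the elements
of `C p` play the role of functions that do not vanish at `p`. -/
structure IsLocallyGenerated (𝒜 : ℤ → Submodule ℝ T) (mul : T →ₗ[ℝ] T →ₗ[ℝ] T)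
    (C : ι → Set T) : Prop where
  mem : ∀ p, C p ⊆ 𝒜 0
  eq_zero : ∀ b, (∀ p, ∃ χ ∈ C p, mul χ b = 0) → b = 0
  gen : ∀ N : Submodule ℝ T, 𝒜 0 ≤ N → (∀ a ∈ 𝒜 0, ∀ b ∈ N, mul a b ∈ N) →
    (∀ a ∈ 𝒜 1, ∀ b ∈ N, mul a b ∈ N) → ∀ b p, ∃ χ ∈ C p, mul χ b ∈ N

namespace IsGerstenhaber

lemma le_of_forall (h : IsGerstenhaber 𝒜 mul br) {N : Submodule ℝ T} (hN : ∀ i, 𝒜 i ≤ N) (c : T) :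
    c ∈ N := by
  have : (⊤ : Submodule ℝ T) ≤ N := by
    rw [← h.isInternal.submodule_iSup_eq_top]
    exact iSup_le hN
  exact this Submodule.mem_top

lemma leibniz' (h : IsGerstenhaber 𝒜 mul br) {i j : ℤ} {a b : T} (ha : a ∈ 𝒜 i) (hb : b ∈ 𝒜 j)
    (c : T) : br a (mul b c) = mul (br a b) c + ((i - 1) * j).negOnePow • mul b (br a c) := by
  let N : Submodule ℝ T :=
    { carrier := {c | br a (mul b c) = mul (br a b) c + ((i - 1) * j).negOnePow • mul b (br a c)}
      add_mem' := fun {c d} hc hd => by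
        simp only [Set.mem_ofPred_eq, map_add, smul_add] at hc hd ⊢
        rw [hc, hd]
        abel
      zero_mem' := by simp
      smul_mem' := fun r c hc => by
        simp only [Set.mem_ofPred_eq, map_smul] at hc ⊢
        rw [hc, smul_add, smul_comm r] }
  exact h.le_of_forall (N := N) (fun k c hc => h.leibniz i j k a ha b hb c hc) c

/-- By the Leibniz rule the kernel of `br a - br' a` is stable under multiplication by elements on
which the brackets agree. It therefore contains, for each `b` and `p`, a multiple of `b` by some `χ
∈ C p`; since the difference commutes with `χ` up to sign, `χ` annihilates its value on `b`. -/
lemma br_congr_of_le {C : ι → Set T} (h : IsGerstenhaber 𝒜 mul br) (h' : IsGerstenhaber 𝒜 mul br')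
    (hC : IsLocallyGenerated 𝒜 mul C) {i : ℤ} {a : T} (ha : a ∈ 𝒜 i)
    (h0 : ∀ b ∈ 𝒜 0, br a b = br' a b) (h1 : ∀ b ∈ 𝒜 1, br a b = br' a b) : br a = br' a := by
  have key {j : ℤ} {b : T} (hb : b ∈ 𝒜 j) (hab : br a b = br' a b) (c : T) :
      (br a - br' a) (mul b c) = ((i - 1) * j).negOnePow • mul b ((br a - br' a) c) := by
    simp only [LinearMap.sub_apply, h.leibniz' ha hb, h'.leibniz' ha hb, hab, map_sub, smul_sub]
    abel
  rw [← sub_eq_zero]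
  refine LinearMap.ext fun b => hC.eq_zero _ fun p => ?_
  obtain ⟨χ, hχ, hb⟩ := hC.gen (LinearMap.ker (br a - br' a))
    (fun b hb => by simp [h0 b hb])
    (fun b hb c hc => by
      rw [LinearMap.mem_ker] at hc ⊢
      rw [key hb (h0 b hb), hc, map_zero, smul_zero])
    (fun b hb c hc => by
      rw [LinearMap.mem_ker] at hc ⊢
      rw [key hb (h1 b hb), hc, map_zero, smul_zero]) b p
  refine ⟨χ, hχ, ?_⟩
  have hχ0 := hC.mem p hχ
  rw [LinearMap.mem_ker, key hχ0 (h0 χ hχ0)] at hb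
  simpa using hb

/-- The agreement spreads in three rounds, each by `br_congr_of_le` and skew symmetry: to brackets
with an element of degree `1`, then of degree `0`, then of any degree. -/
lemma br_unique {C : ι → Set T} (h : IsGerstenhaber 𝒜 mul br) (h' : IsGerstenhaber 𝒜 mul br')
    (hC : IsLocallyGenerated 𝒜 mul C) (hneg : 𝒜 (-1) = ⊥)
    (h1 : ∀ a ∈ 𝒜 1, ∀ b ∈ 𝒜 1, br a b = br' a b)
    (h0 : ∀ a ∈ 𝒜 1, ∀ b ∈ 𝒜 0, br a b = br' a b) : br = br' := by
  have e1 : ∀ a ∈ 𝒜 1, br a = br' a := fun a ha => h.br_congr_of_le h' hC ha (h0 a ha) (h1 a ha)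
  have swap : ∀ {i j : ℤ} {a b : T}, a ∈ 𝒜 i → b ∈ 𝒜 j → br b = br' b → br a b = br' a b := by
    intro i j a b ha hb hab
    rw [h.br_skew i j a ha b hb, h'.br_skew i j a ha b hb, hab]
  have e0 : ∀ a ∈ 𝒜 0, br a = br' a := fun a ha => by
    refine h.br_congr_of_le h' hC ha (fun b hb => ?_) fun b hb => swap ha hb (e1 b hb)
    -- The bracket of two elements of degree `0` lies in degree `-1`, where everything vanishes.
    have m := h.br_mem 0 0 a ha b hb
    have m' := h'.br_mem 0 0 a ha b hb
    simp only [add_zero, zero_sub, hneg, Submodule.mem_bot] at m m'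
    rw [m, m']
  have e : ∀ i, ∀ a ∈ 𝒜 i, br a = br' a := fun i a ha =>
    h.br_congr_of_le h' hC ha (fun b hb => swap ha hb (e0 b hb)) fun b hb => swap ha hb (e1 b hb)
  refine LinearMap.ext fun a => ?_
  have := h.le_of_forall (N := LinearMap.ker (br - br')) (fun i a ha => by simp [e i a ha]) a
  simpa [sub_eq_zero] using this

end IsGerstenhaber

end Uniqueness

/-! ### The Gerstenhaber algebra of pairs -/

section PairAlgebra

variable {T U ι : Type*} [AddCommGroup T] [Module ℝ T] [AddCommGroup U] [Module ℝ U]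
  {𝒜 : ℤ → Submodule ℝ T} {mul br : T →ₗ[ℝ] T →ₗ[ℝ] T} {ℬ : ℤ → Submodule ℝ U}
  {mul' br' : U →ₗ[ℝ] U →ₗ[ℝ] U} {Φ : (T × T) ≃ₗ[ℝ] U}

lemma negOnePow_smul_mem {n i : ℤ} {x : T} (h : x ∈ 𝒜 i) : n.negOnePow • x ∈ 𝒜 i := by
  rw [negOnePow_smul_eq]
  split_ifs
  · exact h
  · exact neg_mem h

lemma negOnePow_smul_map (n : ℤ) (q : T × T) : n.negOnePow • Φ q =
    Φ (n.negOnePow • q.1, n.negOnePow • q.2) := by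
  simp only [negOnePow_smul_eq]
  split_ifs
  · rfl
  · rw [← map_neg]
    rfl

lemma IsGerstenhaber.pair (h : IsGerstenhaber 𝒜 mul br)
    (hmem : ∀ (n : ℤ) (X X' : T), Φ (X, X') ∈ ℬ n ↔ X ∈ 𝒜 n ∧ X' ∈ 𝒜 (n - 1))
    (hmul : ∀ n : ℤ, ∀ X ∈ 𝒜 n, ∀ X' Y Y' : T, mul' (Φ (X, X')) (Φ (Y, Y')) =
      Φ (mul X Y, mul X' Y + n.negOnePow • mul X Y'))
    (hint : DirectSum.IsInternal ℬ)
    (hassoc : ∀ a b c, mul' (mul' a b) c = mul' a (mul' b c))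
    (hunit : ∃ e ∈ ℬ 0, ∀ a, mul' e a = a ∧ mul' a e = a)
    (hbr : ∀ n : ℤ, ∀ X ∈ 𝒜 n, ∀ X' Y Y' : T, br' (Φ (X, X')) (Φ (Y, Y')) =
      Φ (br X Y, br X' Y + (n - 1).negOnePow • br X Y')) :
    IsGerstenhaber ℬ mul' br' := by
  have ex : ∀ {n : ℤ} {x : U}, x ∈ ℬ n → ∃ X ∈ 𝒜 n, ∃ X' ∈ 𝒜 (n - 1), Φ (X, X') = x := by
    intro n x hx
    obtain ⟨⟨X, X'⟩, rfl⟩ := Φ.surjective x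
    obtain ⟨h1, h2⟩ := (hmem n X X').1 hx
    exact ⟨X, h1, X', h2, rfl⟩
  have mm : ∀ {i j k : ℤ} {X Y : T}, X ∈ 𝒜 i → Y ∈ 𝒜 j → i + j = k → mul X Y ∈ 𝒜 k := by
    rintro i j _ X Y hX hY rfl
    exact h.mul_mem i j X hX Y hY
  have bm : ∀ {i j k : ℤ} {X Y : T}, X ∈ 𝒜 i → Y ∈ 𝒜 j → i + j - 1 = k → br X Y ∈ 𝒜 k := by
    rintro i j _ X Y hX hY rfl
    exact h.br_mem i j X hX Y hY
  have eqΦ : ∀ {a b c d : T}, a = c → b = d → Φ (a, b) = Φ (c, d) := by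
    rintro a b _ _ rfl rfl
    rfl
  refine ⟨hint, ?_, hassoc, hunit, ?_, ?_, ?_, ?_, ?_⟩
  · intro i j a ha b hb
    obtain ⟨X, hX, X', hX', rfl⟩ := ex ha
    obtain ⟨Y, hY, Y', hY', rfl⟩ := ex hb
    rw [hmul i X hX, hmem]
    exact ⟨mm hX hY rfl, add_mem (mm hX' hY (by ring))
      (negOnePow_smul_mem (mm hX hY' (by ring)))⟩
  · intro i j a ha b hb
    obtain ⟨X, hX, X', hX', rfl⟩ := ex ha
    obtain ⟨Y, hY, Y', hY', rfl⟩ := ex hb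
    rw [hmul i X hX, hmul j Y hY, negOnePow_smul_map]
    exact eqΦ (h.mul_comm i j X hX Y hY) (h.pair_mul_comm hX hX' hY hY')
  · intro i j a ha b hb
    obtain ⟨X, hX, X', hX', rfl⟩ := ex ha
    obtain ⟨Y, hY, Y', hY', rfl⟩ := ex hb
    rw [hbr i X hX, hmem]
    exact ⟨bm hX hY rfl, add_mem (bm hX' hY (by ring))
      (negOnePow_smul_mem (bm hX hY' (by ring)))⟩
  · intro i j a ha b hb
    obtain ⟨X, hX, X', hX', rfl⟩ := ex ha
    obtain ⟨Y, hY, Y', hY', rfl⟩ := ex hb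
    rw [hbr i X hX, hbr j Y hY, negOnePow_smul_map, ← map_neg]
    exact eqΦ (h.br_skew i j X hX Y hY) (h.pair_br_skew hX hX' hY hY')
  · intro i j k a ha b hb c hc
    obtain ⟨X, hX, X', hX', rfl⟩ := ex ha
    obtain ⟨Y, hY, Y', hY', rfl⟩ := ex hb
    obtain ⟨V, hV, V', hV', rfl⟩ := ex hc
    rw [hbr i X hX, hbr j Y hY, hbr i X hX, hbr i X hX, hbr j Y hY, hbr _ _ (bm hX hY rfl),
      negOnePow_smul_map, ← map_add]
    exact eqΦ (h.jacobi i j k X hX Y hY V hV) (h.pair_jacobi hX hX' hY hY' hV hV')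
  · intro i j k a ha b hb c hc
    obtain ⟨X, hX, X', hX', rfl⟩ := ex ha
    obtain ⟨Y, hY, Y', hY', rfl⟩ := ex hb
    obtain ⟨V, hV, V', hV', rfl⟩ := ex hc
    rw [hbr i X hX, hbr i X hX, hmul j Y hY, hbr i X hX, hmul j Y hY, hmul _ _ (bm hX hY rfl),
      negOnePow_smul_map, ← map_add]
    exact eqΦ (h.leibniz i j k X hX Y hY V hV) (h.pair_leibniz hX hX' hY hY' hV hV')

/-- Besides the elements of `T`, embedded as first components, one more generator of degree one is
needed: `Φ (0, e)` with `e` the unit. Multiplication by it moves a first component to the second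
place. -/
lemma IsLocallyGenerated.pair {C : ι → Set T} (h : IsGerstenhaber 𝒜 mul br)
    (hmem : ∀ (n : ℤ) (X X' : T), Φ (X, X') ∈ ℬ n ↔ X ∈ 𝒜 n ∧ X' ∈ 𝒜 (n - 1))
    (hmul : ∀ n : ℤ, ∀ X ∈ 𝒜 n, ∀ X' Y Y' : T, mul' (Φ (X, X')) (Φ (Y, Y')) =
      Φ (mul X Y, mul X' Y + n.negOnePow • mul X Y'))
    (hC : IsLocallyGenerated 𝒜 mul C)
    (hCmul : ∀ p, ∀ a ∈ C p, ∀ b ∈ C p, mul a b ∈ C p) :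
    IsLocallyGenerated ℬ mul' (fun p => (fun X => Φ (X, 0)) '' C p) := by
  have hz : ∀ {i : ℤ} {a : T}, a ∈ 𝒜 i → ∀ b b' : T,
      mul' (Φ (a, 0)) (Φ (b, b')) = Φ (mul a b, i.negOnePow • mul a b') := by
    intro i a ha b b'
    rw [hmul i a ha, map_zero, LinearMap.zero_apply, zero_add]
  refine ⟨?_, ?_, ?_⟩
  · rintro p _ ⟨χ, hχ, rfl⟩
    exact (hmem 0 χ 0).2 ⟨hC.mem p hχ, zero_mem _⟩
  · intro b hb
    obtain ⟨⟨X, X'⟩, rfl⟩ := Φ.surjective b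
    have key : ∀ p, ∃ χ ∈ C p, mul χ X = 0 ∧ mul χ X' = 0 := fun p => by
      obtain ⟨_, ⟨χ, hχ, rfl⟩, h0⟩ := hb p
      rw [hz (hC.mem p hχ), Int.negOnePow_zero, one_smul, Φ.map_eq_zero_iff, Prod.mk_eq_zero] at h0
      exact ⟨χ, hχ, h0⟩
    rw [hC.eq_zero X fun p => (key p).imp fun _ h => ⟨h.1, h.2.1⟩,
      hC.eq_zero X' fun p => (key p).imp fun _ h => ⟨h.1, h.2.2⟩]
    exact map_zero Φ
  · intro N h0 h0' h1' b p
    obtain ⟨⟨X, X'⟩, rfl⟩ := Φ.surjective b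
    have z1 : ∀ {i : ℤ} {a : T}, a ∈ 𝒜 i → ∀ b : T,
        Φ (mul a b, 0) = mul' (Φ (a, 0)) (Φ (b, 0)) := by
      intro i a ha b
      rw [hz ha, map_zero, smul_zero]
    have gen := hC.gen (N.comap (Φ.toLinearMap ∘ₗ LinearMap.inl ℝ T T))
      (fun a ha => h0 ((hmem 0 a 0).2 ⟨ha, zero_mem _⟩))
      (fun a ha b hb => by
        change Φ (mul a b, 0) ∈ N
        rw [z1 ha]
        exact h0' _ ((hmem 0 a 0).2 ⟨ha, zero_mem _⟩) _ hb)
      (fun a ha b hb => by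
        change Φ (mul a b, 0) ∈ N
        rw [z1 ha]
        exact h1' _ ((hmem 1 a 0).2 ⟨ha, zero_mem _⟩) _ hb)
    obtain ⟨χ, hχ, hX⟩ := gen X p
    obtain ⟨χ', hχ', hX'⟩ := gen X' p
    change Φ (mul χ X, 0) ∈ N at hX
    change Φ (mul χ' X', 0) ∈ N at hX'
    have mχ := hC.mem p hχ
    have mχ' := hC.mem p hχ'
    refine ⟨_, ⟨mul χ χ', hCmul p _ hχ _ hχ', rfl⟩, ?_⟩
    obtain ⟨e, he, hu⟩ := h.unit
    -- Multiply `Φ (mul χ' X', 0)` by the generator `Φ (0, e)`, which has degree one.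
    have hX'' : Φ (0, mul χ' X') ∈ N := by
      have := h1' _ ((hmem 1 0 e).2 ⟨zero_mem _, by simpa using he⟩) _ hX'
      rwa [hmul 1 0 (zero_mem _), map_zero, LinearMap.zero_apply, LinearMap.zero_apply, smul_zero,
        add_zero, (hu _).1] at this
    have comm : mul χ χ' = mul χ' χ := by
      simpa using h.mul_comm 0 0 χ mχ χ' mχ'
    have := add_mem (h0' _ ((hmem 0 χ' 0).2 ⟨mχ', zero_mem _⟩) _ hX)
      (h0' _ ((hmem 0 χ 0).2 ⟨mχ, zero_mem _⟩) _ hX'')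
    rw [hz mχ', hz mχ, ← map_add] at this
    convert this using 1
    rw [hz (hC.mem p (hCmul p _ hχ _ hχ')), Prod.mk_add_mk, map_zero, map_zero, smul_zero, zero_add,
      add_zero, Int.negOnePow_zero, one_smul, one_smul, h.mul_assoc χ χ' X', comm,
      h.mul_assoc χ' χ X]

end PairAlgebra

/-! ### The contraction algebra of multivector fields -/

section MultivectorAlgebra

open Filter Topology

variable {E : Type*} [NormedAddCommGroup E] [NormedSpace ℝ E]
  {M : Type*} [TopologicalSpace M] [ChartedSpace E M]

lemma hasMFDerivAt_smooth (f : Smooth E M) (p : M) :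
    HasMFDerivAt 𝓘(ℝ, E) 𝓘(ℝ, ℝ) f p (mfderiv 𝓘(ℝ, E) 𝓘(ℝ, ℝ) f p) :=
  (f.contMDiff.mdifferentiable (by simp) p).hasMFDerivAt

lemma dAt_add (f g : Smooth E M) (p : M) : dAt (f + g) p = dAt f p + dAt g p := by
  have h := ((hasMFDerivAt_smooth f p).add (hasMFDerivAt_smooth g p)).mfderiv
  exact LinearMap.ext fun w => DFunLike.congr_fun h w

lemma dAt_smul (r : ℝ) (f : Smooth E M) (p : M) : dAt (r • f) p = r • dAt f p := by
  have h := ((hasMFDerivAt_smooth f p).const_smul r).mfderiv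
  exact LinearMap.ext fun w => DFunLike.congr_fun h w

lemma dAt_mul (f g : Smooth E M) (p : M) : dAt (f * g) p = f p • dAt g p + g p • dAt f p := by
  have h := ((hasMFDerivAt_smooth f p).mul (hasMFDerivAt_smooth g p)).mfderiv
  exact LinearMap.ext fun w => DFunLike.congr_fun h w

lemma Smooth.sum_apply {ι : Type*} (t : Finset ι) (f : ι → Smooth E M) (p : M) :
    (∑ i ∈ t, f i) p = ∑ i ∈ t, f i p := by
  rw [← ContMDiffMap.coeFnAddMonoidHom_apply, map_sum]
  simp

variable [IsManifold 𝓘(ℝ, E) ∞ M] [FiniteDimensional ℝ E]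

/-- A smooth function as a multivector field of degree `0`. -/
def ofSmooth : Smooth E M →+* Multivector E M where
  toFun f := ⟨fun p => algebraMap ℝ _ (f p), fun p₀ l => by
    have h : (fun p => l (extTriv E p₀ p (algebraMap ℝ _ (f p)))) = fun p => f p * l 1 := by
      funext p
      rw [AlgHom.commutes, Algebra.algebraMap_eq_smul_one, map_smul, smul_eq_mul]
    rw [h]
    exact (f.contMDiff p₀).mul contMDiffAt_const⟩
  map_one' := Subtype.ext <| funext fun p => map_one (algebraMap ℝ _)
  map_mul' f g := Subtype.ext <| funext fun p => map_mul (algebraMap ℝ _) _ _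
  map_zero' := Subtype.ext <| funext fun p => map_zero (algebraMap ℝ _)
  map_add' f g := Subtype.ext <| funext fun p => map_add (algebraMap ℝ _) _ _

instance : Algebra (Smooth E M) (Multivector E M) :=
  ofSmooth.toAlgebra' fun f X => Subtype.ext <| funext fun p => Algebra.commutes (f p) (X.1 p)

lemma Multivector.smul_apply (f : Smooth E M) (X : Multivector E M) (p : M) :
    (f • X).1 p = f p • X.1 p :=
  (Algebra.smul_def (f p) (X.1 p)).symm

lemma Multivector.algebraMap_apply (f : Smooth E M) (p : M) :
    (algebraMap (Smooth E M) (Multivector E M) f).1 p = algebraMap ℝ _ (f p) := rfl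

instance : IsScalarTower ℝ (Smooth E M) (Multivector E M) where
  smul_assoc r f X := Subtype.ext <| funext fun p => by
    rw [Multivector.smul_apply]
    exact (smul_assoc r (f p) (X.1 p)).trans
      (congrArg (r • ·) (Multivector.smul_apply f X p).symm)

/-- The value of a multivector field at a point. -/
def evalAt (p : M) : Multivector E M →ₐ[ℝ] ExtTan E p :=
  (Pi.evalAlgHom ℝ (fun p : M => ExtTan E p) p).comp (Multivector E M).val

lemma evalAt_apply (p : M) (X : Multivector E M) : evalAt p X = X.1 p := rfl

lemma map_extInv {V W : Type*} [AddCommGroup V] [Module ℝ V] [AddCommGroup W] [Module ℝ W]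
    (φ : V →ₗ[ℝ] W) (x : ExteriorAlgebra ℝ V) :
    ExteriorAlgebra.map φ (extInv x) = extInv (ExteriorAlgebra.map φ x) := by
  have : (ExteriorAlgebra.map φ).comp extInv = extInv.comp (ExteriorAlgebra.map φ) := by
    refine ExteriorAlgebra.hom_ext (LinearMap.ext fun v => ?_)
    simp [extInv_ι]
  exact DFunLike.congr_fun this x

lemma extEv_map {V W : Type*} [AddCommGroup V] [Module ℝ V] [AddCommGroup W] [Module ℝ W]
    (φ : V →ₗ[ℝ] W) (x : ExteriorAlgebra ℝ V) : extEv (ExteriorAlgebra.map φ x) = extEv x := by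
  have : extEv.comp (ExteriorAlgebra.map φ) = extEv := by
    refine ExteriorAlgebra.hom_ext (LinearMap.ext fun v => ?_)
    simp [extEv_ι]
  exact DFunLike.congr_fun this x

/-- The grade involution of multivector fields. -/
def multivectorInv : Multivector E M →ₐ[Smooth E M] Multivector E M where
  toFun := fun X => ⟨fun p => extInv (X.1 p), fun p₀ l => by
    have h := X.2 p₀ (l ∘ₗ extInv.toLinearMap)
    simp only [LinearMap.comp_apply, AlgHom.toLinearMap_apply, extTriv, ← map_extInv] at h
    exact h⟩
  map_one' := Subtype.ext <| funext fun p => map_one (extInv (V := Tan E p))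
  map_mul' := fun X Y => Subtype.ext <| funext fun p => map_mul (extInv (V := Tan E p)) _ _
  map_zero' := Subtype.ext <| funext fun p => map_zero (extInv (V := Tan E p))
  map_add' := fun X Y => Subtype.ext <| funext fun p => map_add (extInv (V := Tan E p)) _ _
  commutes' := fun f => Subtype.ext <| funext fun p => (extInv (V := Tan E p)).commutes (f p)

/-- The degree `0` part of a multivector field. -/
def multivectorEv : Multivector E M →ₐ[Smooth E M] Smooth E M where
  toFun := fun X => ⟨fun p => extEv (X.1 p), fun p₀ => by
    have h := X.2 p₀ extEv.toLinearMap
    simp only [AlgHom.toLinearMap_apply, extTriv, extEv_map] at h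
    exact h⟩
  map_one' := by ext p; exact map_one (extEv (V := Tan E p))
  map_mul' := fun X Y => by ext p; exact map_mul (extEv (V := Tan E p)) _ _
  map_zero' := by ext p; exact map_zero (extEv (V := Tan E p))
  map_add' := fun X Y => by ext p; exact map_add (extEv (V := Tan E p)) _ _
  commutes' := fun f => by ext p; exact extEv_algebraMap (f p)

lemma multivectorInv_apply (X : Multivector E M) (p : M) :
    (multivectorInv X).1 p = extInv (X.1 p) := rfl

lemma multivectorEv_apply (X : Multivector E M) (p : M) : multivectorEv X p = extEv (X.1 p) := rfl

lemma Multivector.ext {X Y : Multivector E M} (h : ∀ p, X.1 p = Y.1 p) : X = Y :=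
  Subtype.ext (funext h)

lemma Multivector.add_apply (X Y : Multivector E M) (p : M) : (X + Y).1 p = X.1 p + Y.1 p := rfl

lemma Multivector.mul_apply (X Y : Multivector E M) (p : M) : (X * Y).1 p = X.1 p * Y.1 p := rfl

lemma Multivector.neg_apply (X : Multivector E M) (p : M) : (-X).1 p = -X.1 p := rfl

lemma Multivector.real_smul_apply (r : ℝ) (X : Multivector E M) (p : M) :
    (r • X).1 p = r • X.1 p := rfl

variable [T2Space M]

/-- Expand `df` in the coordinate differentials of a frame. In the trivialization these are constant
covectors, so contraction with them is composition with a fixed linear map; the coefficients are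
smooth. -/
lemma isSmoothMultivector_contr (f : Smooth E M) (X : Multivector E M) :
    IsSmoothMultivector fun p => contr (dAt f p) (X.1 p) := by
  intro p₀ l
  obtain ⟨x, v, h⟩ := exists_frame (E := E) p₀
  set b := Module.finBasis ℝ E
  have e : (fun p => l (extTriv E p₀ p (contr (dAt f p) (X.1 p)))) =ᶠ[𝓝 p₀]
      fun p => ∑ i, dAt f p (v i p) * (l ∘ₗ contr (b.coord i)) (extTriv E p₀ p (X.1 p)) := by
    filter_upwards [h.sum_smul, Filter.eventually_all.2 h.dAt_eq] with p h1 h2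
    have h3 : dAt f p = ∑ i, dAt f p (v i p) • dAt (x i) p := by
      refine LinearMap.ext fun w => ?_
      conv_lhs => rw [← h1 w]
      simp [mul_comm]
    rw [h3, map_sum, LinearMap.sum_apply, map_sum, map_sum]
    refine Finset.sum_congr rfl fun i _ => ?_
    rw [map_smul, LinearMap.smul_apply, map_smul, map_smul, h2, extTriv, map_contr, ← h3]
    rfl
  refine ContMDiffAt.congr_of_eventuallyEq ?_ e
  exact contMDiffAt_finsetSum fun i _ =>
    (contMDiffAt_dAt f (h.smooth i).self_of_nhds).mul (X.2 p₀ _)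

/-- The contraction of multivector fields with the differential of a function. -/
def multivectorCon (f : Smooth E M) : Multivector E M →ₗ[Smooth E M] Multivector E M where
  toFun := fun X => ⟨fun p => contr (dAt f p) (X.1 p), isSmoothMultivector_contr f X⟩
  map_add' := fun X Y => Subtype.ext <| funext fun p => map_add (contr (dAt f p)) _ _
  map_smul' := fun g X => Subtype.ext <| funext fun p => by
    simp only [Multivector.smul_apply, map_smul, RingHom.id_apply]

lemma multivectorCon_apply (f : Smooth E M) (X : Multivector E M) (p : M) :
    (multivectorCon f X).1 p = contr (dAt f p) (X.1 p) := rfl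

/-- Multivector fields as a contraction algebra over the smooth functions. -/
def multivectorContraction : Contraction (Smooth E M) (Multivector E M) where
  inv := multivectorInv
  con := multivectorCon
  ev := multivectorEv
  con_add f g X := Multivector.ext fun p => by
    rw [Multivector.add_apply, multivectorCon_apply, dAt_add, map_add, LinearMap.add_apply]
    rfl
  con_smul r f X := Multivector.ext fun p => by
    rw [Multivector.real_smul_apply, multivectorCon_apply, dAt_smul, map_smul, LinearMap.smul_apply]
    rfl
  con_mul_left f g X := Multivector.ext fun p => by
    rw [Multivector.add_apply, Multivector.smul_apply, Multivector.smul_apply,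
      multivectorCon_apply, dAt_mul, map_add, LinearMap.add_apply, map_smul, map_smul,
      LinearMap.smul_apply, LinearMap.smul_apply]
    rfl
  con_con f g X := Multivector.ext fun p => by
    rw [Multivector.neg_apply]
    exact contr_comm _ _ _
  con_mul f X Y := Multivector.ext fun p => by
    rw [Multivector.add_apply, Multivector.mul_apply, Multivector.mul_apply]
    exact contr_mul _ _ _
  con_inv f X := Multivector.ext fun p => by
    rw [Multivector.neg_apply]
    exact contr_extInv _ _
  inv_inv X := Multivector.ext fun p => by
    rw [multivectorInv_apply, multivectorInv_apply, extInv_extInv]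
  ev_inv X := by
    ext p
    rw [multivectorEv_apply, multivectorInv_apply, extEv_extInv]
    rfl

lemma multivectorContraction_val (l : List (Smooth E M)) (p : M) : ∀ X : Multivector E M,
    multivectorContraction.val X l p = contrList (l.map (dAt · p)) (X.1 p) := by
  induction l with
  | nil => intro X; rfl
  | cons f l ih => intro X; exact ih _

end MultivectorAlgebra

lemma IsSkew.eq_zero_of_not_nodup {A : Type*} [CommRing A] [Algebra ℝ A] {L : List A → A}
    (h : IsSkew L) (l : List A) (hl : ¬ l.Nodup) : L l = 0 := by
  induction l generalizing L with
  | nil => exact absurd List.nodup_nil hl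
  | cons a l ih =>
    by_cases ha : a ∈ l
    · obtain ⟨l₁, l₂, rfl⟩ := List.append_of_mem ha
      exact h.eq_zero_of_duplicate a l₁ l₂
    · exact ih (h.ins a) fun h' => hl (List.nodup_cons.2 ⟨ha, h'⟩)

lemma IsMultiDer.sub {A : Type*} [CommRing A] [Algebra ℝ A] {D D' : List A → A}
    (h : IsMultiDer D) (h' : IsMultiDer D') : IsMultiDer (D - D') where
  skew l a b l' := by
    simp only [Pi.sub_apply, h.skew l a b l', h'.skew l a b l']
    ring
  der l l' := (h.der l l').sub (h'.der l l')

/-! ### Multivector fields are the multiderivations of the smooth functions -/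

section Full

open Filter Topology

variable {E : Type*} [NormedAddCommGroup E] [NormedSpace ℝ E]
  {M : Type*} [TopologicalSpace M] [ChartedSpace E M]
  [IsManifold 𝓘(ℝ, E) ∞ M] [FiniteDimensional ℝ E] [T2Space M]

/-- Up to a function with vanishing differential at `p`, every function is a real linear combination
of the `x i`. The arguments are replaced by coordinates one at a time, from the last to the first.
-/
lemma IsMultiDer.eq_zero_at {D : List (Smooth E M) → Smooth E M} (hD : IsMultiDer D) {p : M}
    {κ : Type*} [Fintype κ] {x : κ → Smooth E M} {v : κ → Tan E p}
    (he : ∀ w : Tan E p, ∑ i, dAt (x i) p w • v i = w)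
    (h : ∀ l : List κ, D (l.map x) p = 0) (l : List (Smooth E M)) : D l p = 0 := by
  suffices ∀ (l : List (Smooth E M)) (l' : List κ), D (l ++ l'.map x) p = 0 by
    simpa using this l []
  intro l
  induction l using List.reverseRecOn with
  | nil => exact h
  | append_singleton l f ih =>
    intro l'
    have hd := hD.der l (l'.map x)
    have h0 : dAt (f - ∑ i, dAt f p (v i) • x i) p = 0 := by
      have hs : ∀ t : Finset κ, dAt (∑ i ∈ t, dAt f p (v i) • x i) p =
          ∑ i ∈ t, dAt f p (v i) • dAt (x i) p := by
        intro t
        classical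
        induction t using Finset.induction_on with
        | empty =>
          have := dAt_smul (0 : ℝ) (0 : Smooth E M) p
          simpa using this
        | insert i t hi ih => rw [Finset.sum_insert hi, Finset.sum_insert hi, dAt_add, dAt_smul, ih]
      rw [sub_eq_add_neg, ← neg_one_smul ℝ, dAt_add, dAt_smul, hs]
      refine LinearMap.ext fun w => ?_
      have h2 : dAt f p w = ∑ i, dAt f p (v i) * dAt (x i) p w := by
        conv_lhs => rw [← he w]
        simp [mul_comm]
      simp [h2]
    have h1 := hd.eq_zero_of_dAt_eq_zero h0
    obtain ⟨δ, hδ⟩ := hd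
    have h3 : δ (f - ∑ i, dAt f p (v i) • x i) p =
        δ f p - ∑ i, dAt f p (v i) * δ (x i) p := by
      rw [map_sub, map_sum]
      simp [Smooth.sum_apply]
    simp only [hδ] at h1
    rw [h3, ← hδ] at h1
    have h4 : ∀ i, δ (x i) p = 0 := fun i => by
      rw [← hδ]
      exact ih (i :: l')
    simp only [h4, mul_zero, Finset.sum_const_zero, sub_zero] at h1
    simpa using h1

variable (E M) in
lemma multivectorContraction_bounded (X : Multivector E M) (l : List (Smooth E M))
    (hl : Module.finrank ℝ E < l.length) : multivectorContraction.val X l = 0 := by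
  -- Truncation to the length of `l` leaves only coordinate lists of that length to consider; they
  -- are longer than the dimension, so an entry repeats.
  have hD := ((multivectorContraction (E := E) (M := M)).isMultiDer_val X).truncate l.length
  ext p
  obtain ⟨x, v, h⟩ := exists_frame (E := E) p
  have := hD.eq_zero_at h.sum_smul.self_of_nhds (fun l' => ?_) l
  · rwa [if_pos rfl] at this
  · split_ifs with h'
    · rw [(multivectorContraction.isMultiDer_val X).skew.eq_zero_of_not_nodup]
      · rfl
      · intro hn
        have := (List.Nodup.of_map _ hn).length_le_card
        rw [List.length_map] at h'
        simp at this
        omega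
    · rfl

/-- `Y` is reconstructed from the values of `D` on coordinate functions in a cut-off coordinate
frame. The first clause records that `Y` is built from functions and vector fields; it is what local
generation uses. -/
lemma exists_local_multivector {D : List (Smooth E M) → Smooth E M} (hD : IsMultiDer D) (p₀ : M) :
    ∃ Y : Multivector E M, (∀ N : Submodule ℝ (Multivector E M), multivectorGrading E M 0 ≤ N →
        (∀ a ∈ multivectorGrading E M 1, ∀ b ∈ N, a * b ∈ N) → Y ∈ N) ∧
      ∀ᶠ p in 𝓝 p₀, ∀ l, multivectorContraction.val Y l p = D l p := by
  obtain ⟨x, v, h⟩ := exists_frame (E := E) p₀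
  choose e hχ he using fun i => exists_multivector_eq p₀
    (X := fun p => ExteriorAlgebra.ι ℝ (v i p)) (by
      filter_upwards [h.smooth i] with p hp using multivectorSmoothAt_ι.2 hp)
  let c : List (Fin (Module.finrank ℝ E)) → Multivector E M :=
    fun l => algebraMap (Smooth E M) (Multivector E M) (D (l.map x))
  have hc : ∀ l, c l ∈ multivectorGrading E M 0 := fun l p => by
    rw [extPower_zero]
    exact Submodule.mem_one.2 ⟨_, rfl⟩
  have hg : ∀ i, e i ∈ multivectorGrading E M 1 := fun i p => by
    obtain ⟨χ, h⟩ := hχ i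
    rw [h]
    refine Submodule.smul_mem _ _ ?_
    exact (pow_one (LinearMap.range (ExteriorAlgebra.ι ℝ (M := Tan E p)))).ge ⟨_, rfl⟩
  refine ⟨∑ n ∈ Finset.range (Module.finrank ℝ E + 1), reconstruct e n c,
    fun N h0 h1 => sum_mem fun n hn => ?_, ?_⟩
  · clear hn
    generalize c = c' at hc
    induction n generalizing c' with
    | zero => exact h0 (hc _)
    | succ n ih => exact N.smul_mem _ (sum_mem fun i _ => h1 _ (hg i) _ (ih _ fun l => hc (i :: l)))
  filter_upwards [h.sum_smul, h.dual, Filter.eventually_all.2 he] with p hs hd hep l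
  set Y := ∑ n ∈ Finset.range (Module.finrank ℝ E + 1), reconstruct e n c
  have hdiff := (multivectorContraction.isMultiDer_val Y).sub hD
  have := hdiff.eq_zero_at hs (fun l => ?_) l
  · exact sub_eq_zero.1 this
  · change multivectorContraction.val Y (l.map x) p - D (l.map x) p = 0
    by_cases hl : l.length < Module.finrank ℝ E + 1
    · have h1 : Y.1 p = ∑ n ∈ Finset.range (Module.finrank ℝ E + 1),
          reconstruct (fun i => ExteriorAlgebra.ι ℝ (v i p)) n
            fun l => algebraMap ℝ _ (D (l.map x) p) := by
        rw [← evalAt_apply, map_sum]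
        refine Finset.sum_congr rfl fun n _ => ?_
        rw [map_reconstruct]
        simp only [evalAt_apply, hep]
        rfl
      rw [multivectorContraction_val, h1, contrList_sum, List.map_map]
      have h2 : ∀ n, contrList (l.map ((fun f => dAt f p) ∘ x))
          (reconstruct (fun i => ExteriorAlgebra.ι ℝ (v i p)) n
            fun l => algebraMap ℝ _ (D (l.map x) p)) = if l.length = n then D (l.map x) p else 0 :=
        fun n => contrList_reconstruct (x := fun i => dAt (x i) p) hd l n (fun l => D (l.map x) p)
          fun l i j l' => by
            simpa using congrArg (fun g : Smooth E M => g p)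
              (hD.skew (l.map x) (x i) (x j) (l'.map x))
      rw [Finset.sum_congr rfl fun n _ => h2 n, Finset.sum_ite_eq, if_pos (Finset.mem_range.2 hl),
        sub_self]
    · rw [multivectorContraction_bounded E M Y _ (by rw [List.length_map]; omega),
        hD.skew.eq_zero_of_not_nodup]
      · simp
      · intro hn
        have := (List.Nodup.of_map _ hn).length_le_card
        simp at this
        omega

lemma eq_at_of_val {X Y : Multivector E M} {p : M} (h : ∀ l,
    multivectorContraction.val X l p = multivectorContraction.val Y l p) : X.1 p = Y.1 p := by
  obtain ⟨x, v, hf⟩ := exists_frame (E := E) p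
  refine eq_of_contrList (x := fun i => dAt (x i) p) hf.sum_smul.self_of_nhds fun l => ?_
  have := h (l.map x)
  rw [multivectorContraction_val, multivectorContraction_val, List.map_map] at this
  exact this

variable (E M) in
lemma multivectorContraction_isFull :
    (multivectorContraction : Contraction (Smooth E M) (Multivector E M)).IsFull where
  injective X Y h := Multivector.ext fun p => eq_at_of_val fun l => by rw [h]
  surjective D hD := by
    choose Y _ hY using exists_local_multivector hD
    -- A multivector at a point is determined by its values, so the local solutions agree at nearby
    -- points. Hence the section that takes at `p` the value of the solution chosen for `p` is
    -- smooth.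
    have hloc : ∀ p₀, ∀ᶠ p in 𝓝 p₀, (Y p).1 p = (Y p₀).1 p := by
      intro p₀
      filter_upwards [hY p₀] with p hp
      exact eq_at_of_val fun l => by rw [hp, (hY p).self_of_nhds]
    refine ⟨⟨fun p => (Y p).1 p, fun p₀ =>
      MultivectorSmoothAt.congr (fun l => (Y p₀).2 p₀ l) (hloc p₀)⟩, funext fun l => ?_⟩
    ext p
    rw [multivectorContraction_val]
    exact (multivectorContraction_val l p (Y p)).symm.trans ((hY p).self_of_nhds l)
  bounded := ⟨_, multivectorContraction_bounded E M⟩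

lemma multivectorContraction_grading :
    (multivectorContraction : Contraction (Smooth E M) (Multivector E M)).grading =
      multivectorGrading E M := by
  funext n
  ext X
  cases n with
  | ofNat n =>
    change (∀ l, _ → _) ↔ ∀ p, X.1 p ∈ ⋀[ℝ]^n (Tan E p)
    constructor
    · intro h p
      obtain ⟨x, v, hf⟩ := exists_frame (E := E) p
      refine mem_of_contrList (x := fun i => dAt (x i) p) hf.sum_smul.self_of_nhds n fun l hl => ?_
      have h1 := congrArg (fun g : Smooth E M => g p) (h (l.map x) (by simpa using hl))
      simp only [multivectorContraction_val, List.map_map] at h1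
      exact h1
    · intro h l hl
      ext p
      rw [multivectorContraction_val]
      exact contrList_of_mem _ (h p) (by simpa using hl)
  | negSucc n =>
    change (∀ l, _ → _) ↔ X = 0
    constructor
    · intro h
      exact (multivectorContraction_isFull E M).injective (funext fun l => by
        rw [h l (by have := Int.negSucc_lt_zero n; omega), Contraction.val_zero])
    · rintro rfl l _
      exact Contraction.val_zero _ l

end Full

/-! ### The Schouten–Nijenhuis bracket -/

section Schouten

open Filter Topology VectorField

variable {E : Type*} [NormedAddCommGroup E] [NormedSpace ℝ E]
  {M : Type*} [TopologicalSpace M] [ChartedSpace E M]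
  [IsManifold 𝓘(ℝ, E) ∞ M] [FiniteDimensional ℝ E]

lemma mem_grading_zero {X : Multivector E M} {f : Smooth E M}
    (h : ∀ p, X.1 p = algebraMap ℝ _ (f p)) : X ∈ multivectorGrading E M 0 := fun p => by
  rw [h, extPower_zero]
  exact Submodule.mem_one.2 ⟨_, rfl⟩

lemma mem_grading_one {X : Multivector E M} {V : ∀ p : M, Tan E p}
    (h : ∀ p, X.1 p = ExteriorAlgebra.ι ℝ (V p)) : X ∈ multivectorGrading E M 1 := fun p => by
  rw [h]
  exact (pow_one (LinearMap.range (ExteriorAlgebra.ι ℝ (M := Tan E p)))).ge ⟨_, rfl⟩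

lemma exists_of_mem_grading_one {X : Multivector E M} (h : X ∈ multivectorGrading E M 1) :
    ∃ V : ∀ p : M, Tan E p, ∀ p, X.1 p = ExteriorAlgebra.ι ℝ (V p) := by
  have : ∀ p, ∃ v : Tan E p, X.1 p = ExteriorAlgebra.ι ℝ v := fun p => by
    obtain ⟨v, hv⟩ := (pow_one (LinearMap.range (ExteriorAlgebra.ι ℝ (M := Tan E p)))).le (h p)
    exact ⟨v, hv.symm⟩
  exact ⟨fun p => (this p).choose, fun p => (this p).choose_spec⟩

lemma contMDiff_of_eq_ι {X : Multivector E M} {V : ∀ p : M, Tan E p}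
    (h : ∀ p, X.1 p = ExteriorAlgebra.ι ℝ (V p)) (p : M) :
    ContMDiffAt 𝓘(ℝ, E) (𝓘(ℝ, E).prod 𝓘(ℝ, E)) ∞
        (fun p => (TotalSpace.mk' E p (V p) : TangentBundle 𝓘(ℝ, E) M)) p := by
  refine multivectorSmoothAt_ι.1 fun l => ?_
  simp only [← h]
  exact X.2 p l

lemma algebraMap_ev {X : Multivector E M} (h : X ∈ multivectorGrading E M 0) :
    algebraMap (Smooth E M) _ (multivectorEv X) = X := Multivector.ext fun p => by
  have h1 := h p
  rw [extPower_zero] at h1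
  obtain ⟨r, hr⟩ := Submodule.mem_one.1 h1
  rw [Multivector.algebraMap_apply, multivectorEv_apply, ← hr, extEv_algebraMap]

lemma multivectorEv_algebraMap (f : Smooth E M) :
    multivectorEv (algebraMap (Smooth E M) (Multivector E M) f) = f :=
  multivectorEv.commutes f

lemma multivectorEv_eq_zero {X : Multivector E M} (h : X ∈ multivectorGrading E M 1) :
    multivectorEv X = 0 := by
  ext p
  exact extEv_of_mem (n := 0) (h p)

variable [T2Space M]

/-- The derivative of a function along a vector field. -/
lemma multivectorCon_of_eq_ι {X : Multivector E M} {V : ∀ p : M, Tan E p}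
    (h : ∀ p, X.1 p = ExteriorAlgebra.ι ℝ (V p)) (f : Smooth E M) :
    ∃ g : Smooth E M, (∀ p, g p = dAt f p (V p)) ∧ multivectorCon f X = algebraMap _ _ g := by
  have h1 : ∀ p, (multivectorCon f X).1 p = algebraMap ℝ _ (dAt f p (V p)) := fun p => by
    have := contr_ι_mul (dAt f p) (V p) 1
    rw [mul_one, contr_one, mul_zero, sub_zero] at this
    rw [multivectorCon_apply, h, this, Algebra.algebraMap_eq_smul_one]
  refine ⟨multivectorEv (multivectorCon f X), fun p => ?_, (algebraMap_ev fun p => ?_).symm⟩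
  · rw [multivectorEv_apply, h1, extEv_algebraMap]
  · rw [h1, extPower_zero]
    exact Submodule.mem_one.2 ⟨_, rfl⟩

lemma multivectorInv_of_mem {X : Multivector E M} (h : X ∈ multivectorGrading E M 1) :
    multivectorInv X = -X := by
  rw [← multivectorContraction_grading] at h
  refine (Contraction.inv_eq (multivectorContraction_isFull E M) h).trans ?_
  rw [sg_smul, Int.negOnePow_one, Units.neg_smul, one_smul]

variable (E M) in
/-- The Schouten–Nijenhuis bracket. -/
def schouten : Multivector E M →ₗ[ℝ] Multivector E M →ₗ[ℝ] Multivector E M :=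
  Contraction.bracket (multivectorContraction_isFull E M)

variable (E M) in
lemma isGerstenhaber_schouten :
    IsGerstenhaber (multivectorGrading E M) multivectorWedge (schouten E M) := by
  rw [← multivectorContraction_grading]
  exact Contraction.isGerstenhaber_bracket _

lemma multivectorEv_schouten (X Y : Multivector E M) : multivectorEv (schouten E M X Y) =
    multivectorEv (multivectorCon (multivectorEv Y) X) -
      multivectorEv (multivectorCon (multivectorEv X) Y) :=
  Contraction.ev_bracket (multivectorContraction_isFull E M) X Y

lemma multivectorCon_schouten (f : Smooth E M) (X Y : Multivector E M) :
    multivectorCon f (schouten E M X Y) =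
      schouten E M (multivectorCon f X) Y - schouten E M (multivectorInv X) (multivectorCon f Y) :=
  Contraction.con_bracket (multivectorContraction_isFull E M) f X Y

lemma multivectorCon_zero (X : Multivector E M) : multivectorCon 0 X = 0 :=
  Contraction.con_zero_left multivectorContraction X

variable (E M) in
lemma isSchoutenNijenhuis_schouten : IsSchoutenNijenhuis (schouten E M) where
  gerstenhaber := isGerstenhaber_schouten E M
  br_function X F V f hX hF p := by
    have hF0 := mem_grading_zero hF
    have hm : schouten E M X F ∈ multivectorGrading E M 0 :=
      (isGerstenhaber_schouten E M).br_mem 1 0 X (mem_grading_one hX) F hF0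
    have hf : multivectorEv F = f := by
      ext q
      rw [multivectorEv_apply, hF, extEv_algebraMap]
    obtain ⟨g, hg, hgX⟩ := multivectorCon_of_eq_ι hX f
    rw [← algebraMap_ev hm, multivectorEv_schouten, hf, hgX, multivectorEv_algebraMap,
      multivectorEv_eq_zero (mem_grading_one hX), multivectorCon_zero, map_zero, sub_zero,
      Multivector.algebraMap_apply, hg]
  br_vectorField X Y V W hX hY p := by
    have hX1 := mem_grading_one hX
    have hY1 := mem_grading_one hY
    have hm : schouten E M X Y ∈ multivectorGrading E M 1 :=
      (isGerstenhaber_schouten E M).br_mem 1 1 X hX1 Y hY1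
    obtain ⟨U, hU⟩ := exists_of_mem_grading_one hm
    rw [hU]
    congr 1
    -- A tangent vector is determined by its action on coordinate functions, so it suffices to
    -- compare the actions on functions. Both sides act as the commutator of the derivatives along
    -- `V` and `W`.
    have key : ∀ f : Smooth E M, dAt f p (U p) = dAt f p (mlieBracket 𝓘(ℝ, E) V W p) := by
      intro f
      obtain ⟨g, hg, hgX⟩ := multivectorCon_of_eq_ι hX f
      obtain ⟨h, hh, hhY⟩ := multivectorCon_of_eq_ι hY f
      obtain ⟨u, hu, huU⟩ := multivectorCon_of_eq_ι hU f
      obtain ⟨a, ha, haX⟩ := multivectorCon_of_eq_ι hX h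
      obtain ⟨b, hb, hbY⟩ := multivectorCon_of_eq_ι hY g
      rw [dAt_mlieBracket f h g (contMDiff_of_eq_ι hX p) (contMDiff_of_eq_ι hY p)
        (.of_forall hh) (.of_forall hg), ← hu, ← ha, ← hb]
      have e := congrArg multivectorEv huU
      rw [multivectorEv_algebraMap, multivectorCon_schouten, multivectorInv_of_mem hX1, hgX, hhY,
        map_neg, LinearMap.neg_apply, sub_neg_eq_add, map_add, multivectorEv_schouten,
        multivectorEv_schouten, multivectorEv_eq_zero hY1, multivectorEv_eq_zero hX1,
        multivectorCon_zero, multivectorCon_zero, multivectorEv_algebraMap,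
        multivectorEv_algebraMap, haX, hbY, multivectorEv_algebraMap, multivectorEv_algebraMap,
        map_zero] at e
      rw [← e]
      change (0 - b p) + (a p - 0) = a p - b p
      ring
    obtain ⟨x, v, hf⟩ := exists_frame (E := E) p
    rw [← hf.sum_smul.self_of_nhds (U p), ← hf.sum_smul.self_of_nhds (mlieBracket _ V W p)]
    simp only [key]

/-- Functions that take the value `1` at `p`. -/
def oneAt (p : M) : Set (Multivector E M) :=
  {X | ∃ χ : Smooth E M, χ p = 1 ∧ X = algebraMap _ _ χ}

variable (E M) in
lemma isLocallyGenerated_multivector :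
    IsLocallyGenerated (multivectorGrading E M) multivectorWedge (oneAt (E := E) (M := M)) where
  mem p := by
    rintro _ ⟨χ, -, rfl⟩
    exact mem_grading_zero fun p => rfl
  eq_zero X h := Multivector.ext fun p => by
    obtain ⟨_, ⟨χ, hχ, rfl⟩, h⟩ := h p
    have h1 := congrArg (fun Y : Multivector E M => Y.1 p) h
    simp only [multivectorWedge, LinearMap.mul_apply', ← Algebra.smul_def,
      Multivector.smul_apply, hχ, one_smul] at h1
    exact h1
  gen N h0 h0' h1 X p := by
    -- Near `p` the field `X` equals a `Y` built from generators. With `χ` supported there, `χ X = χ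
    -- Y` holds globally.
    obtain ⟨Y, hY, hYX⟩ := exists_local_multivector (multivectorContraction.isMultiDer_val X) p
    obtain ⟨χ, h1χ, hχ⟩ := exists_cutoff (E := E) p hYX
    have hN := hY N h0 h1
    have h2 : algebraMap (Smooth E M) (Multivector E M) χ ∈ multivectorGrading E M 0 :=
      mem_grading_zero fun p => rfl
    refine ⟨_, ⟨χ, h1χ.self_of_nhds, rfl⟩, ?_⟩
    convert h0' _ h2 _ hN using 1
    change algebraMap _ _ χ * X = algebraMap _ _ χ * Y
    rw [← Algebra.smul_def, ← Algebra.smul_def]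
    refine Multivector.ext fun q => ?_
    rw [Multivector.smul_apply, Multivector.smul_apply]
    by_cases hq : q ∈ tsupport χ
    · rw [eq_at_of_val (hχ hq)]
    · rw [image_eq_zero_of_notMem_tsupport hq, zero_smul, zero_smul]

lemma IsSchoutenNijenhuis.eq {S S' : Multivector E M →ₗ[ℝ] Multivector E M →ₗ[ℝ] Multivector E M}
    (h : IsSchoutenNijenhuis S) (h' : IsSchoutenNijenhuis S') : S = S' := by
  refine h.gerstenhaber.br_unique h'.gerstenhaber (isLocallyGenerated_multivector E M) rfl ?_ ?_
  · intro X hX Y hY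
    obtain ⟨V, hV⟩ := exists_of_mem_grading_one hX
    obtain ⟨W, hW⟩ := exists_of_mem_grading_one hY
    exact Multivector.ext fun p => by
      rw [h.br_vectorField X Y V W hV hW, h'.br_vectorField X Y V W hV hW]
  · intro X hX Y hY
    obtain ⟨V, hV⟩ := exists_of_mem_grading_one hX
    have hf : ∀ p, Y.1 p = algebraMap ℝ _ (multivectorEv Y p) := fun p => by
      conv_lhs => rw [← algebraMap_ev hY]
      rfl
    exact Multivector.ext fun p => by
      rw [h.br_function X Y V _ hV hf, h'.br_function X Y V _ hV hf]

end Schouten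

/-! ### Sections of an affine line bundle -/

section Sections

open Filter Topology

variable {E : Type*} [NormedAddCommGroup E] [NormedSpace ℝ E]
  {M : Type*} [TopologicalSpace M] [ChartedSpace E M]
  {Z : M → Type*} [∀ p, AddTorsor ℝ (Z p)] [TopologicalSpace (TotalSpace ℝ Z)]
  [∀ p, TopologicalSpace (Z p)] [FiberBundle ℝ Z] [AffineLineBundle E Z]

lemma exists_sec [FiniteDimensional ℝ E] [T2Space M] [SigmaCompactSpace M]
    [IsManifold 𝓘(ℝ, E) ∞ M] : Nonempty (Sec E Z) := by
  let e : ∀ p : M, Trivialization ℝ (π ℝ Z) := fun p => trivializationAt ℝ Z p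
  obtain ⟨ρ, hρ⟩ := SmoothPartitionOfUnity.exists_isSubordinate 𝓘(ℝ, E) (isClosed_univ (X := M))
    (fun p => (e p).baseSet) (fun p => (e p).open_baseSet)
    (fun p _ => Set.mem_iUnion.2 ⟨p, FiberBundle.mem_baseSet_trivializationAt' p⟩)
  -- An arbitrary choice of points, with no smoothness. `h i q +ᵥ s₀ q` is the zero of the `i`-th
  -- trivialization over `q`, and the section sought is the average of these zeros by the partition
  -- of unity.
  let s₀ : ∀ p, Z p := fun p => Classical.arbitrary (Z p)
  let h : M → M → ℝ := fun i q => -(e i (TotalSpace.mk' ℝ q (s₀ q))).2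
  refine ⟨⟨fun q => (∑ᶠ i, ρ i q • h i q) +ᵥ s₀ q, fun p₀ => ?_⟩⟩
  rw [Bundle.contMDiffAt_section]
  have key : (fun q => (e p₀ (TotalSpace.mk' ℝ q ((∑ᶠ i, ρ i q • h i q) +ᵥ s₀ q))).2) =ᶠ[𝓝 p₀]
      fun q => ∑ᶠ i, ρ i q • (e p₀ (TotalSpace.mk' ℝ q (h i q +ᵥ s₀ q))).2 := by
    filter_upwards [(e p₀).open_baseSet.mem_nhds
      (FiberBundle.mem_baseSet_trivializationAt' p₀)] with q hq
    have hf : (support fun i => ρ i q).Finite := ρ.locallyFinite.point_finite q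
    rw [AffineLineBundle.coord_vadd E (e p₀) q hq]
    simp only [AffineLineBundle.coord_vadd E (e p₀) q hq, mul_add, smul_eq_mul]
    rw [finsum_add_distrib (hf.subset fun i hi => left_ne_zero_of_mul hi)
      (hf.subset fun i hi => left_ne_zero_of_mul hi), ← finsum_mul,
      ρ.sum_eq_one (Set.mem_univ q), one_mul]
  refine ContMDiffAt.congr_of_eventuallyEq (ρ.contMDiffAt_finsum fun i hi => ?_) key
  have hi' := hρ i hi
  have h0 := FiberBundle.mem_baseSet_trivializationAt' (F := ℝ) (E := Z) p₀
  have hn : (e i).baseSet ∩ (e p₀).baseSet ∈ 𝓝 p₀ :=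
    ((e i).open_baseSet.inter (e p₀).open_baseSet).mem_nhds ⟨hi', h0⟩
  refine ((AffineLineBundle.smooth_coordChange (E := E) (e i) (e p₀)).contMDiffAt
    hn).congr_of_eventuallyEq ?_
  filter_upwards [hn] with q hq
  have h1 : e i (TotalSpace.mk' ℝ q (h i q +ᵥ s₀ q)) = (q, 0) := by
    refine Prod.ext ((e i).coe_fst' hq.1) ?_
    rw [AffineLineBundle.coord_vadd E (e i) q hq.1]
    simp [h]
  rw [← h1]
  congr 2
  exact ((e i).left_inv ((e i).mem_source.2 hq.1)).symm

lemma vadd_injective (σ : Sec E Z) : Injective fun f : Smooth E M => f +ᵥ σ := fun f g h => by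
  ext p
  have h1 : f p +ᵥ σ.1 p = g p +ᵥ σ.1 p := congrFun (congrArg Subtype.val h) p
  exact vadd_right_cancel _ h1

lemma vadd_surjective (σ : Sec E Z) : Surjective fun f : Smooth E M => f +ᵥ σ := fun s => by
  refine ⟨⟨fun p => s.1 p -ᵥ σ.1 p, fun p₀ => ?_⟩, Subtype.ext (funext fun p => ?_)⟩
  · have hs := (Bundle.contMDiffAt_section (IB := 𝓘(ℝ, E)) (F := ℝ) (s := s.1) p₀).1 (s.2 p₀)
    have hσ := (Bundle.contMDiffAt_section (IB := 𝓘(ℝ, E)) (F := ℝ) (s := σ.1) p₀).1 (σ.2 p₀)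
    refine (hs.sub hσ).congr_of_eventuallyEq ?_
    filter_upwards [(trivializationAt ℝ Z p₀).open_baseSet.mem_nhds
      (FiberBundle.mem_baseSet_trivializationAt' p₀)] with p hp
    have := AffineLineBundle.coord_vadd E (trivializationAt ℝ Z p₀) p hp (s.1 p -ᵥ σ.1 p) (σ.1 p)
    rw [vsub_vadd] at this
    simp [this]
  · exact vsub_vadd (s.1 p) (σ.1 p)

/-- The identification of functions with sections given by a section. -/
def vaddEquiv (σ : Sec E Z) : Smooth E M ≃ Sec E Z :=
  Equiv.ofBijective _ ⟨vadd_injective σ, vadd_surjective σ⟩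

lemma vaddEquiv_apply (σ : Sec E Z) (f : Smooth E M) : vaddEquiv σ f = f +ᵥ σ := rfl

lemma vaddEquiv_symm_vadd (σ a : Sec E Z) (f : Smooth E M) :
    (vaddEquiv σ).symm (f +ᵥ a) = f + (vaddEquiv σ).symm a := by
  rw [Equiv.symm_apply_eq, vaddEquiv_apply, add_vadd, ← vaddEquiv_apply σ ((vaddEquiv σ).symm a),
    Equiv.apply_symm_apply]

end Sections

/-! ### Affine multiderivations as functions on lists -/

lemma isSkew_of_perm {S A : Type*} [CommRing A] {L : List S → A}
    (h : ∀ (n : ℕ) (τ : Equiv.Perm (Fin n)) (s : Fin n → S),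
      L (List.ofFn (s ∘ τ)) = Equiv.Perm.sign τ • L (List.ofFn s)) : IsSkew L := by
  intro l a b l'
  set n := (l ++ b :: a :: l').length with hn
  have hn' : n = l.length + l'.length + 2 := by rw [hn]; simp; omega
  let i : Fin n := ⟨l.length, by omega⟩
  let j : Fin n := ⟨l.length + 1, by omega⟩
  have hij : i ≠ j := fun h => by simpa [i, j] using congrArg Fin.val h
  have h1 := h n (Equiv.swap i j) (l ++ b :: a :: l').get
  rw [Equiv.Perm.sign_swap hij, List.ofFn_get, Units.neg_smul, one_smul] at h1
  rw [← h1]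
  congr 1
  refine List.ext_getElem (by simp [hn']; omega) fun k hk hk' => ?_
  rw [List.length_ofFn] at hk'
  rw [List.getElem_ofFn, comp_apply]
  by_cases h1 : k = l.length
  · subst h1
    rw [show (⟨l.length, hk'⟩ : Fin n) = i from rfl, Equiv.swap_apply_left]
    simp [j]
  · by_cases h2 : k = l.length + 1
    · subst h2
      rw [show (⟨l.length + 1, hk'⟩ : Fin n) = j from rfl, Equiv.swap_apply_right]
      simp [i]
    · rw [Equiv.swap_apply_of_ne_of_ne (by simpa [i, Fin.ext_iff] using h1)
        (by simpa [j, Fin.ext_iff] using h2)]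
      rcases lt_or_gt_of_ne h1 with h | h
      · simp [List.getElem_append_left, h]
      · obtain ⟨m, rfl⟩ : ∃ m, k = l.length + 2 + m := ⟨k - (l.length + 2), by omega⟩
        simp [List.getElem_append_right, add_assoc, add_comm 2 m]

/-- Exchanges of neighbours generate the symmetric group, and the permutations that obey the sign
rule form a submonoid. -/
lemma IsSkew.perm {S A : Type*} [CommRing A] {L : List S → A} (h : IsSkew L) {n : ℕ}
    (τ : Equiv.Perm (Fin n)) (s : Fin n → S) :
    L (List.ofFn (s ∘ τ)) = Equiv.Perm.sign τ • L (List.ofFn s) := by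
  cases n with
  | zero => rw [Subsingleton.elim τ 1]; simp
  | succ n =>
  let H : Submonoid (Equiv.Perm (Fin (n + 1))) :=
    { carrier := {τ | ∀ s : Fin (n + 1) → S,
        L (List.ofFn (s ∘ τ)) = Equiv.Perm.sign τ • L (List.ofFn s)}
      one_mem' := fun s => by simp
      mul_mem' := fun {τ ρ} hτ hρ s => by
        rw [Equiv.Perm.coe_mul, ← comp_assoc, hρ, hτ, Equiv.Perm.sign_mul, smul_smul, mul_comm] }
  have hH : ⊤ ≤ H := by
    rw [← Equiv.Perm.mclosure_swap_castSucc_succ n, Submonoid.closure_le]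
    rintro _ ⟨i, rfl⟩ s
    have key : ∀ s : Fin (n + 1) → S, List.ofFn s = (List.ofFn s).take i ++ s i.castSucc ::
        s i.succ :: (List.ofFn s).drop (i + 2) := by
      intro s
      have h1 : (List.ofFn s).length = n + 1 := List.length_ofFn
      conv_lhs => rw [← List.take_append_drop i (List.ofFn s)]
      rw [List.drop_eq_getElem_cons (by omega), List.drop_eq_getElem_cons (by omega)]
      rw [List.getElem_ofFn, List.getElem_ofFn]
      rfl
    have ht : (List.ofFn (s ∘ Equiv.swap i.castSucc i.succ)).take i = (List.ofFn s).take i := by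
      refine List.ext_getElem (by simp) fun k hk hk' => ?_
      simp only [List.length_take, List.length_ofFn] at hk
      simp only [List.getElem_take, List.getElem_ofFn, comp_apply]
      rw [Equiv.swap_apply_of_ne_of_ne]
      · exact fun h => by have := congrArg Fin.val h; simp at this; omega
      · exact fun h => by have := congrArg Fin.val h; simp at this; omega
    have hd : (List.ofFn (s ∘ Equiv.swap i.castSucc i.succ)).drop (i + 2) =
        (List.ofFn s).drop (i + 2) := by
      refine List.ext_getElem (by simp) fun k hk hk' => ?_
      simp only [List.getElem_drop, List.getElem_ofFn, comp_apply]
      rw [Equiv.swap_apply_of_ne_of_ne]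
      · exact fun h => by have := congrArg Fin.val h; simp at this; omega
      · exact fun h => by have := congrArg Fin.val h; simp at this; omega
    rw [key (s ∘ _), key s, ht, hd, comp_apply, comp_apply, Equiv.swap_apply_left,
      Equiv.swap_apply_right, h, Equiv.Perm.sign_swap (by simp [Fin.ext_iff]), Units.neg_smul,
      one_smul]
  exact hH (Submonoid.mem_top τ) s

lemma ofFn_update {S : Type*} {n : ℕ} (s : Fin n → S) (i : Fin n) (a : S) :
    List.ofFn (update s i a) = (List.ofFn s).take i ++ a :: (List.ofFn s).drop (i + 1) := by
  have h := List.set_eq_take_append_cons_drop (l := List.ofFn s) (i := i) (a := a)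
  rw [if_pos (by simp)] at h
  rw [← h]
  refine List.ext_getElem (by simp) fun k hk hk' => ?_
  simp [List.getElem_set, update_apply, Fin.ext_iff, eq_comm]

lemma append_cons_eq_ofFn {S : Type*} (l l' : List S) (a b : S) :
    l ++ a :: l' = List.ofFn (update (l ++ b :: l').get ⟨l.length, by simp⟩ a) := by
  rw [ofFn_update, List.ofFn_get]
  simp

section AffVal

variable {E : Type*} [NormedAddCommGroup E] [NormedSpace ℝ E]
  {M : Type*} [TopologicalSpace M] [ChartedSpace E M]
  {Z : M → Type*} [∀ p, AddTorsor ℝ (Z p)] [TopologicalSpace (TotalSpace ℝ Z)]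
  [∀ p, TopologicalSpace (Z p)] [FiberBundle ℝ Z] [AffineLineBundle E Z]

/-- An element of `⋀ AffDer(Z, ℝ)` as a function on lists of functions, by means of a section. -/
def affVal (σ : Sec E Z) : AffDerAlg E Z →ₗ[ℝ] List (Smooth E M) → Smooth E M where
  toFun x l := (x l.length).1 fun i => vaddEquiv σ (l.get i)
  map_add' _ _ := rfl
  map_smul' _ _ := rfl

variable (σ : Sec E Z)

lemma affVal_eq (x : AffDerAlg E Z) {l : List (Smooth E M)} {n : ℕ} (h : l.length = n) :
    affVal σ x l = (x n).1 fun i => vaddEquiv σ (l.get (Fin.cast h.symm i)) := by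
  subst h
  rfl

lemma affVal_ofFn (x : AffDerAlg E Z) {n : ℕ} (f : Fin n → Smooth E M) :
    affVal σ x (List.ofFn f) = (x n).1 fun i => vaddEquiv σ (f i) := by
  rw [affVal_eq σ x List.length_ofFn]
  simp

lemma affVal_homog {n : ℕ} (D : MultiAffDer E Z n) (f : Fin n → Smooth E M) :
    affVal σ (homog n D) (List.ofFn f) = D.1 fun i => vaddEquiv σ (f i) := by
  rw [affVal_ofFn, homog, DirectSum.lof_eq_of, DirectSum.of_eq_same]

lemma affVal_homog_of_ne {n : ℕ} (D : MultiAffDer E Z n) {l : List (Smooth E M)}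
    (h : l.length ≠ n) : affVal σ (homog n D) l = 0 := by
  rw [affVal_eq σ _ rfl, homog, DirectSum.lof_eq_of, DirectSum.of_eq_of_ne _ _ _ h]
  rfl

lemma affVal_injective : Injective (affVal σ) := fun x y h => by
  refine DFinsupp.ext fun n => Subtype.ext (funext fun s => ?_)
  have h1 := congrFun h (List.ofFn fun i => (vaddEquiv σ).symm (s i))
  rw [affVal_ofFn, affVal_ofFn] at h1
  simpa using h1

lemma isMultiAff_affVal (x : AffDerAlg E Z) : IsMultiAff (affVal σ x) where
  skew := isSkew_of_perm fun n τ s => by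
    rw [affVal_ofFn, affVal_ofFn]
    exact (x n).2.1 τ fun i => vaddEquiv σ (s i)
  aff l l' := by
    set s := (l ++ 0 :: l').get with hs
    obtain ⟨δ, hδ⟩ := (x _).2.2 ⟨l.length, by simp⟩ (fun i => vaddEquiv σ (s i))
    refine ⟨δ, fun f => ?_⟩
    have h (g : Smooth E M) : affVal σ x (l ++ g :: l') =
        (x _).1 (update (fun i => vaddEquiv σ (s i)) ⟨l.length, by simp⟩ (vaddEquiv σ g)) := by
      rw [append_cons_eq_ofFn l l' g 0, affVal_ofFn]
      exact congrArg _ (comp_update (vaddEquiv σ) s _ g)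
    beta_reduce
    rw [h, h, vaddEquiv_apply, vaddEquiv_apply]
    beta_reduce at hδ
    rw [hδ, hδ, map_zero]
    abel

/-- The homogeneous element of `⋀ AffDer(Z, ℝ)` given by a function on lists. -/
def ofIsMultiAff {L : List (Smooth E M) → Smooth E M} (h : IsMultiAff L) (n : ℕ) :
    MultiAffDer E Z n :=
  ⟨fun s => L (List.ofFn fun i => (vaddEquiv σ).symm (s i)),
    fun τ s => h.skew.perm τ fun i => (vaddEquiv σ).symm (s i), fun i s => by
      obtain ⟨δ, hδ⟩ := h.aff ((List.ofFn fun i => (vaddEquiv σ).symm (s i)).take i)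
        ((List.ofFn fun i => (vaddEquiv σ).symm (s i)).drop (i + 1))
      refine ⟨δ, fun a f => ?_⟩
      have h1 (a : Sec E Z) : (fun j => (vaddEquiv σ).symm (update s i a j)) =
          update (fun j => (vaddEquiv σ).symm (s j)) i ((vaddEquiv σ).symm a) :=
        comp_update (vaddEquiv σ).symm s i a
      have h2 := hδ (f + (vaddEquiv σ).symm a)
      rw [map_add, ← hδ ((vaddEquiv σ).symm a)] at h2
      simp only [h1, ofFn_update, vaddEquiv_symm_vadd]
      linear_combination h2⟩

lemma exists_affVal_eq {L : List (Smooth E M) → Smooth E M} (h : IsMultiAff L)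
    (hb : ∃ N : ℕ, ∀ l, N < l.length → L l = 0) : ∃ x : AffDerAlg E Z, affVal σ x = L := by
  obtain ⟨N, hN⟩ := hb
  refine ⟨∑ n ∈ Finset.range (N + 1), homog n (ofIsMultiAff σ h n), funext fun l => ?_⟩
  have h1 (n : ℕ) : affVal σ (homog n (ofIsMultiAff σ h n)) l =
      if l.length = n then L l else 0 := by
    split_ifs with hl
    · subst hl
      have := affVal_homog σ (ofIsMultiAff σ h l.length) l.get
      rw [List.ofFn_get] at this
      rw [this]
      simp [ofIsMultiAff]
    · exact affVal_homog_of_ne σ _ hl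
  rw [map_sum, Finset.sum_apply, Finset.sum_congr rfl fun n _ => h1 n, Finset.sum_ite_eq]
  split_ifs with hl
  · rfl
  · exact (hN l (by simpa using hl)).symm

lemma mem_intGrading {n : ℤ} {x : AffDerAlg E Z} :
    x ∈ intGrading (fun n => MultiAffDer E Z n) n ↔ HasDeg n (affVal σ x) := by
  have key (hx : HasDeg n (affVal σ x)) (k : ℕ) (hk : (k : ℤ) ≠ n) : x k = 0 := by
    refine Subtype.ext (funext fun s => ?_)
    have := hx (List.ofFn fun i => (vaddEquiv σ).symm (s i)) (by simpa using hk)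
    rw [affVal_ofFn] at this
    simpa using this
  cases n with
  | ofNat n =>
    constructor
    · rintro ⟨D, rfl⟩ l hl
      exact affVal_homog_of_ne σ D (by simpa using hl)
    · intro hx
      refine ⟨x n, DFinsupp.ext fun k => ?_⟩
      rw [DirectSum.lof_eq_of]
      by_cases hk : k = n
      · subst hk
        exact DirectSum.of_eq_same _ _
      · rw [key hx k (by simpa using hk)]
        exact DirectSum.of_eq_of_ne _ _ _ hk
  | negSucc n =>
    constructor
    · intro hx l _
      rw [(Submodule.mem_bot ℝ).1 hx, map_zero, Pi.zero_apply]
    · intro hx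
      exact (Submodule.mem_bot ℝ).2 (DFinsupp.ext fun k => key hx k (by
        have := Int.negSucc_lt_zero n; omega))

/-- The factor `1/(n! k!)` in the wedge product cancels the multiplicity in `antisymm_eq_shuffle`.
-/
lemma wedgeHom_apply_vadd {n k : ℕ} (D : MultiAffDer E Z n) (D' : MultiAffDer E Z k)
    (f : Fin (n + k) → Smooth E M) :
    (wedgeHom D D').1 (fun i => vaddEquiv σ (f i)) =
      shuffle (affVal σ (homog n D)) (affVal σ (homog k D')) (List.ofFn f) := by
  have h := antisymm_eq_shuffle n k rfl (affVal σ (homog n D)) (affVal σ (homog k D'))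
    (isMultiAff_affVal σ _).skew (isMultiAff_affVal σ _).skew
    (fun l hl => affVal_homog_of_ne σ D (by simpa using hl))
    (fun l hl => affVal_homog_of_ne σ D' (by simpa using hl)) f
  have e (τ : Equiv.Perm (Fin (n + k))) : Equiv.Perm.sign τ •
      wedgeTerm D.1 D'.1 τ (fun i => vaddEquiv σ (f i)) =
      ((Equiv.Perm.sign τ : ℤ) : Smooth E M) *
        (affVal σ (homog n D) ((List.ofFn (f ∘ τ)).take n) *
          affVal σ (homog k D') ((List.ofFn (f ∘ τ)).drop n)) := by
    have h1 : (List.ofFn (f ∘ τ)).take n = List.ofFn fun i => f (τ (Fin.castAdd k i)) := by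
      refine List.ext_getElem (by simp) fun j hj hj' => by simp
    have h2 : (List.ofFn (f ∘ τ)).drop n = List.ofFn fun i => f (τ (Fin.natAdd n i)) := by
      refine List.ext_getElem (by simp) fun j hj hj' => by simp
    rw [h1, h2, affVal_homog, affVal_homog, wedgeTerm, Units.smul_def, zsmul_eq_mul]
  simp only [wedgeHom, e]
  rw [antisymm] at h
  rw [h, inv_smul_eq_iff₀ (by positivity), Algebra.smul_def]
  congr 1
  push_cast
  simp

lemma affVal_affWedge (x y : AffDerAlg E Z) :
    affVal σ (affWedge x y) = shuffle (affVal σ x) (affVal σ y) := by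
  have hl (D D₁ D₂ : List (Smooth E M) → Smooth E M) :
      shuffle D (D₁ + D₂) = shuffle D D₁ + shuffle D D₂ :=
    funext fun l => shuffle_add_right l D D₁ D₂
  have hr (D₁ D₂ D : List (Smooth E M) → Smooth E M) :
      shuffle (D₁ + D₂) D = shuffle D₁ D + shuffle D₂ D :=
    funext fun l => shuffle_add_left l D₁ D₂ D
  induction x using DirectSum.induction_on with
  | zero =>
    rw [map_zero, LinearMap.zero_apply, map_zero]
    exact funext fun l => (shuffle_zero_left l _).symm
  | add x x' hx hx' => rw [map_add, LinearMap.add_apply, map_add, map_add, hx, hx', hr]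
  | of n D =>
    induction y using DirectSum.induction_on with
    | zero =>
      rw [map_zero, map_zero]
      exact funext fun l => (shuffle_zero_right l _).symm
    | add y y' hy hy' => rw [map_add, map_add, map_add, hy, hy', hl]
    | of k D' =>
      change affVal σ (affWedge (homog n D) (homog k D')) =
        shuffle (affVal σ (homog n D)) (affVal σ (homog k D'))
      have h : affWedge (homog n D) (homog k D') = homog (n + k) (wedgeHom D D') := by
        simp only [affWedge, homog, DirectSum.toModule_lof, LinearMap.flip_apply]
        rfl
      rw [h]
      funext l
      by_cases hl : l.length = n + k
      · obtain ⟨f, rfl⟩ : ∃ f : Fin (n + k) → Smooth E M, l = List.ofFn f :=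
          ⟨fun i => l.get (Fin.cast hl.symm i), by
            refine List.ext_getElem (by simp [hl]) fun j hj hj' => by simp⟩
        rw [affVal_homog, wedgeHom_apply_vadd]
      · rw [affVal_homog_of_ne σ _ hl]
        exact (shuffle_hasDeg l n k _ _
          (fun l hl => affVal_homog_of_ne σ D (by simpa using hl))
          (fun l hl => affVal_homog_of_ne σ D' (by simpa using hl))
          (by exact_mod_cast hl)).symm

end AffVal

lemma HasDeg.add {S A : Type*} [CommRing A] {n : ℤ} {D D' : List S → A} (h : HasDeg n D)
    (h' : HasDeg n D') : HasDeg n (D + D') := fun l hl => by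
  rw [Pi.add_apply, h l hl, h' l hl, add_zero]

lemma HasDeg.sub {S A : Type*} [CommRing A] {n : ℤ} {D D' : List S → A} (h : HasDeg n D)
    (h' : HasDeg n D') : HasDeg n (D - D') := fun l hl => by
  rw [Pi.sub_apply, h l hl, h' l hl, sub_zero]

lemma wedgeOne_ofFn {A : Type*} [CommRing A] [Algebra ℝ A] {n : ℕ} (D : List A → A)
    (f : Fin (n + 1) → A) : wedgeOne D (List.ofFn f) =
      ∑ i : Fin (n + 1), (-1) ^ (i : ℕ) * D (List.ofFn fun j => f (i.succAbove j)) := by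
  induction n generalizing D with
  | zero => simp [wedgeOne]
  | succ n ih =>
    rw [List.ofFn_succ, wedgeOne, ih]
    conv_rhs => rw [Fin.sum_univ_succ]
    simp only [Fin.val_zero, pow_zero, one_mul, Fin.zero_succAbove, sub_eq_add_neg]
    rw [← Finset.sum_neg_distrib]
    congr 1
    refine Finset.sum_congr rfl fun i _ => ?_
    rw [List.ofFn_succ, ins, Fin.succ_succAbove_zero, Fin.val_succ, pow_succ]
    simp only [Fin.succ_succAbove_succ]
    ring

lemma IsMultiDer.map_zero_cons {A : Type*} [CommRing A] [Algebra ℝ A] {D : List A → A}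
    (h : IsMultiDer D) (l : List A) : D (0 :: l) = 0 := (h.der [] l).map_zero

/-! ### Pairs of elements of a contraction algebra -/

namespace Contraction

variable {A T : Type*} [CommRing A] [Algebra ℝ A] [Ring T] [Algebra A T]
    [Algebra ℝ T] [IsScalarTower ℝ A T] (K : Contraction A T)

/-- The affine multiderivation of `A` given by a pair of elements of `T`. -/
def pairVal : (T × T) →ₗ[ℝ] List A → A where
  toFun q := K.val q.1 - wedgeOne (K.val q.2)
  map_add' q r := funext fun l => by
    have h : K.val (q.2 + r.2) = K.val q.2 + K.val r.2 := funext fun l => K.val_add l _ _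
    simp only [Prod.fst_add, Prod.snd_add, h, Pi.sub_apply, Pi.add_apply, wedgeOne_add, val_add]
    abel
  map_smul' r q := funext fun l => by
    have h : K.val (r • q.2) = algebraMap ℝ A r • K.val q.2 := funext fun l => by
      rw [val_real_smul, Algebra.smul_def]
      rfl
    simp only [Prod.smul_fst, Prod.smul_snd, h, Pi.sub_apply, Pi.smul_apply, wedgeOne_smul,
      val_real_smul, RingHom.id_apply, smul_sub]
    rw [Algebra.smul_def r (wedgeOne _ l)]

lemma pairVal_apply (X X' : T) : K.pairVal (X, X') = K.val X - wedgeOne (K.val X') := rfl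

lemma pairVal_nil (X X' : T) : K.pairVal (X, X') [] = K.ev X := by
  rw [pairVal_apply, Pi.sub_apply, val_nil, AffGerst.wedgeOne, sub_zero]

lemma pairVal_singleton (X X' : T) (f : A) :
    K.pairVal (X, X') [f] = K.ev (K.con f X) - K.ev X' := by
  rw [pairVal_apply, Pi.sub_apply, AffGerst.wedgeOne, AffGerst.wedgeOne]
  simp

/-- Inserting `0` isolates the second component of the pair. Injectivity and the degree of the
components both rest on this. -/
lemma ins_zero_pairVal (X X' : T) : ins 0 (K.pairVal (X, X')) = -K.val X' := by
  funext l
  rw [ins, pairVal_apply, Pi.sub_apply, wedgeOne_zero_cons (K.isMultiDer_val _),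
    (K.isMultiDer_val X).map_zero_cons, zero_sub]
  rfl

variable {K}

lemma pairVal_injective (hK : K.IsFull) : Injective K.pairVal := by
  rw [injective_iff_map_eq_zero]
  rintro ⟨X, X'⟩ h
  have h1 := K.ins_zero_pairVal X X'
  rw [h] at h1
  have hz : K.val 0 = 0 := funext fun l => K.val_zero l
  have hX' : X' = 0 := hK.injective (by
    rw [hz, ← neg_eq_zero, ← h1]
    rfl)
  subst hX'
  have hw : AffGerst.wedgeOne (0 : List A → A) = 0 := funext fun l => wedgeOne_zero l
  rw [pairVal_apply, hz, hw, sub_zero] at h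
  rw [hK.injective (h.trans hz.symm)]
  rfl

lemma isMultiAff_pairVal (q : T × T) : IsMultiAff (K.pairVal q) := by
  have h : K.pairVal q = K.val q.1 + (-1 : A) • AffGerst.wedgeOne (K.val q.2) := by
    rw [neg_one_smul, ← sub_eq_add_neg]
    rfl
  have h' : (-1 : A) • AffGerst.wedgeOne (K.val q.2) = AffGerst.wedgeOne (-K.val q.2) :=
    funext fun l => by
      rw [Pi.smul_apply, smul_eq_mul, ← wedgeOne_smul, neg_one_smul]
  rw [h, h']
  exact (K.isMultiDer_val _).isMultiAff.add (.wedgeOne (K.isMultiDer_val _).neg)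

lemma exists_pairVal_eq (hK : K.IsFull) {L : List A → A} (h : IsMultiAff L) :
    ∃ q, K.pairVal q = L := by
  obtain ⟨D, D', hD, hD', rfl⟩ := IsMultiAff.exists_decomposition h
  obtain ⟨X, rfl⟩ := hK.surjective D hD
  obtain ⟨X', rfl⟩ := hK.surjective D' hD'
  exact ⟨(X, X'), rfl⟩

lemma pairVal_bounded (hK : K.IsFull) : ∃ N : ℕ, ∀ q l, N < l.length → K.pairVal q l = 0 := by
  obtain ⟨N, hN⟩ := hK.bounded
  refine ⟨N + 1, fun q l hl => ?_⟩
  obtain ⟨X, X'⟩ := q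
  have hw : ∀ l : List A, N + 1 < l.length → AffGerst.wedgeOne (K.val X') l = 0 := by
    intro l hl
    have h0 : ∀ (l : List A) (D : List A → A) (N : ℕ), (∀ l : List A, N < l.length → D l = 0) →
        N + 1 < l.length → AffGerst.wedgeOne D l = 0 := by
      intro l
      induction l with
      | nil => intro D N _ hl; simp at hl
      | cons f l ih =>
        intro D N hD hl
        rw [List.length_cons] at hl
        have h1 : AffGerst.wedgeOne (AffGerst.ins f D) l = 0 := by
          rcases N with _ | N
          · have : AffGerst.ins f D = 0 := funext fun l => hD _ (by simp)
            rw [this, wedgeOne_zero]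
          · exact ih _ N (fun l hl => hD _ (by simpa using hl)) (by omega)
        rw [AffGerst.wedgeOne, h1, hD l (by omega), sub_zero]
    exact h0 l _ N (hN X') hl
  rw [pairVal_apply, Pi.sub_apply, hw l hl, hN X l (by omega), sub_zero]

lemma hasDeg_pairVal {n : ℤ} {X X' : T} :
    HasDeg n (K.pairVal (X, X')) ↔ X ∈ K.grading n ∧ X' ∈ K.grading (n - 1) := by
  have hw : HasDeg (n - 1) (K.val X') → HasDeg n (AffGerst.wedgeOne (K.val X')) := fun h l hl =>
    wedgeOne_hasDeg l h (by omega)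
  constructor
  · intro h
    have h1 : HasDeg (n - 1) (K.val X') := fun l hl => by
      have h2 := h.ins 0 l hl
      rw [ins_zero_pairVal] at h2
      exact neg_eq_zero.1 h2
    refine ⟨?_, h1⟩
    have h3 := h.add (hw h1)
    rwa [pairVal_apply, sub_add_cancel] at h3
  · rintro ⟨h, h'⟩
    exact HasDeg.sub h (hw h')

lemma shuffle_pairVal (X X' Y Y' : T) : shuffle (K.pairVal (X, X')) (K.pairVal (Y, Y')) =
    K.pairVal (X * Y, X' * Y + K.inv X * Y') := by
  have hs (X Y : T) : shuffle (K.val X) (K.val Y) = K.val (X * Y) :=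
    funext fun l => K.shuffle_val l X Y
  have hi : gradeInv (K.val X) = K.val (K.inv X) := funext fun l => (K.val_inv l X).symm
  have ha (X Y : T) : K.val X + K.val Y = K.val (X + Y) := funext fun l => (K.val_add l X Y).symm
  rw [pairVal_apply, pairVal_apply, pairVal_apply, shuffle_sub_wedgeOne, hi, hs, hs, hs, ha]

/-- The hypotheses hold in degree one. There the first component of a pair is the linear part of the
affine derivation, so the right-hand side is the prescribed commutator of affine derivations. -/
lemma pairVal_bracket_singleton (hK : K.IsFull) {X Y : T} (hX : K.ev X = 0) (hY : K.ev Y = 0)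
    (X' Y' : T) (f : A) :
    K.pairVal (bracket hK X Y, bracket hK X' Y - bracket hK (K.inv X) Y') [f] =
      K.ev (K.con (K.pairVal (Y, Y') [f]) X) - K.ev (K.con (K.pairVal (X, X') [f]) Y) := by
  simp only [pairVal_singleton, con_bracket, map_sub, ev_bracket, con_sub, hX, hY, con_zero_left,
    con_inv, map_neg, ev_inv, map_zero]
  ring

end Contraction

/-! ### The identification of pairs of multivector fields with affine multiderivations -/

section Identification

variable {E : Type*} [NormedAddCommGroup E] [NormedSpace ℝ E] [FiniteDimensional ℝ E]
  {M : Type*} [TopologicalSpace M] [ChartedSpace E M] [T2Space M] [IsManifold 𝓘(ℝ, E) ∞ M]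

variable {Z : M → Type*} [∀ p, AddTorsor ℝ (Z p)] [TopologicalSpace (TotalSpace ℝ Z)]
  [∀ p, TopologicalSpace (Z p)] [FiberBundle ℝ Z] [AffineLineBundle E Z] (σ : Sec E Z)

variable (E M) in
/-- The affine multiderivation of `C^∞(M)` given by a pair of multivector fields. -/
def multivectorPairVal : (Multivector E M × Multivector E M) →ₗ[ℝ] List (Smooth E M) → Smooth E M :=
  Contraction.pairVal multivectorContraction

variable (E M) in
lemma multivectorPairVal_injective : Injective (multivectorPairVal E M) :=
  Contraction.pairVal_injective (multivectorContraction_isFull E M)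

/-- Both ranges consist of affine multiderivations. Elements of a direct sum have finite support,
which is why the bound on the degrees of multivector fields enters one of the inclusions. -/
lemma range_multivectorPairVal :
    LinearMap.range (multivectorPairVal E M) = LinearMap.range (affVal σ) := by
  refine le_antisymm ?_ ?_
  · rintro _ ⟨q, rfl⟩
    obtain ⟨N, hN⟩ := Contraction.pairVal_bounded (multivectorContraction_isFull E M)
    exact exists_affVal_eq σ (Contraction.isMultiAff_pairVal q) ⟨N, hN q⟩
  · rintro _ ⟨x, rfl⟩
    exact Contraction.exists_pairVal_eq (multivectorContraction_isFull E M) (isMultiAff_affVal σ x)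

/-- The identification of pairs of multivector fields with elements of `⋀ AffDer(Z, ℝ)`. -/
def identification : (Multivector E M × Multivector E M) ≃ₗ[ℝ] AffDerAlg E Z :=
  (LinearEquiv.ofInjective (multivectorPairVal E M) (multivectorPairVal_injective E M)).trans
    ((LinearEquiv.ofEq _ _ (range_multivectorPairVal σ)).trans
      (LinearEquiv.ofInjective (affVal σ) (affVal_injective σ)).symm)

lemma affVal_identification (q : Multivector E M × Multivector E M) :
    affVal σ (identification σ q) = multivectorPairVal E M q := by
  have h := LinearEquiv.apply_symm_apply (LinearEquiv.ofInjective (affVal σ) (affVal_injective σ))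
    (LinearEquiv.ofEq _ _ (range_multivectorPairVal σ)
      (LinearEquiv.ofInjective (multivectorPairVal E M) (multivectorPairVal_injective E M) q))
  exact congrArg Subtype.val h

lemma isIdentification_identification : IsIdentification σ (identification σ) := by
  intro X X' n f p
  have h := congrFun (affVal_identification σ (X, X')) (List.ofFn f)
  rw [affVal_ofFn] at h
  change ((identification σ (X, X')) n).1 (fun i => vaddEquiv σ (f i)) p = _
  rw [h, multivectorPairVal, Contraction.pairVal_apply, Pi.sub_apply]
  have hv {m : ℕ} (g : Fin m → Smooth E M) (Y : Multivector E M) :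
      multivectorContraction.val Y (List.ofFn g) p =
        extPairing (fun j => dAt (g j) p) (Y.1 p) := by
    rw [multivectorContraction_val, List.map_ofFn, contrList_ofFn]
    rfl
  cases n with
  | zero =>
    rw [pairValue, ← hv]
    simp [wedgeOne]
  | succ n =>
    rw [pairValue, wedgeOne_ofFn, ← hv]
    have hsub (a b : Smooth E M) : (a - b) p = a p - b p := rfl
    rw [hsub, sub_eq_add_neg, Smooth.sum_apply, ← Finset.sum_neg_distrib]
    congr 1
    refine Finset.sum_congr rfl fun i _ => ?_
    rw [← hv, pow_succ]
    change -((((-1 : Smooth E M) ^ (i : ℕ)) p) * _) = _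
    have h1 : ((-1 : Smooth E M) ^ (i : ℕ)) p = (-1) ^ (i : ℕ) := rfl
    rw [h1]
    ring

lemma identification_mem {n : ℤ} {X X' : Multivector E M} :
    identification σ (X, X') ∈ intGrading (fun n => MultiAffDer E Z n) n ↔
    X ∈ multivectorGrading E M n ∧ X' ∈ multivectorGrading E M (n - 1) := by
  rw [mem_intGrading σ, affVal_identification, ← multivectorContraction_grading]
  exact Contraction.hasDeg_pairVal

lemma exists_of_mem_intGrading {n : ℤ} {x : AffDerAlg E Z}
    (hx : x ∈ intGrading (fun n => MultiAffDer E Z n) n) :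
    ∃ X ∈ multivectorGrading E M n, ∃ X' ∈ multivectorGrading E M (n - 1),
      identification σ (X, X') = x := by
  obtain ⟨⟨X, X'⟩, rfl⟩ := (identification σ).surjective x
  obtain ⟨h, h'⟩ := (identification_mem σ).1 hx
  exact ⟨X, h, X', h', rfl⟩

lemma affWedge_identification (X X' Y Y' : Multivector E M) :
    affWedge (identification σ (X, X')) (identification σ (Y, Y')) =
      identification σ (X * Y, X' * Y + multivectorInv X * Y') := by
  apply affVal_injective σ
  rw [affVal_affWedge, affVal_identification, affVal_identification, affVal_identification]
  exact Contraction.shuffle_pairVal X X' Y Y'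

lemma multivectorInv_eq {n : ℤ} {X : Multivector E M} (h : X ∈ multivectorGrading E M n) :
    multivectorInv X = n.negOnePow • X := by
  rw [← multivectorContraction_grading] at h
  exact (Contraction.inv_eq (multivectorContraction_isFull E M) h).trans (sg_smul _ _)

lemma affWedge_identification_of_mem {n : ℤ} {X : Multivector E M}
    (h : X ∈ multivectorGrading E M n) (X' Y Y' : Multivector E M) :
    affWedge (identification σ (X, X')) (identification σ (Y, Y')) =
      identification σ (X * Y, X' * Y + n.negOnePow • (X * Y')) := by
  rw [affWedge_identification, multivectorInv_eq h]
  simp only [negOnePow_smul_eq]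
  split_ifs
  · rfl
  · exact congrArg (fun W => identification σ (X * Y, X' * Y + W)) (neg_mul X Y')

end Identification

/-! ### The bracket of affine multiderivations -/

section AffineMultiderivations

variable {E : Type*} [NormedAddCommGroup E] [NormedSpace ℝ E]
  {M : Type*} [TopologicalSpace M] [ChartedSpace E M]
  {Z : M → Type*} [∀ p, AddTorsor ℝ (Z p)] [TopologicalSpace (TotalSpace ℝ Z)]
  [∀ p, TopologicalSpace (Z p)] [FiberBundle ℝ Z] [AffineLineBundle E Z]

lemma affWedge_assoc (σ : Sec E Z) (x y z : AffDerAlg E Z) :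
    affWedge (affWedge x y) z = affWedge x (affWedge y z) :=
  affVal_injective σ <| funext fun l => by
    simp only [affVal_affWedge, shuffle_assoc]

lemma homog_mem {n : ℕ} (D : MultiAffDer E Z n) :
    homog n D ∈ intGrading (fun n => MultiAffDer E Z n) n :=
  ⟨D, rfl⟩

lemma exists_homog_of_mem {n : ℕ} {x : AffDerAlg E Z}
    (h : x ∈ intGrading (fun n => MultiAffDer E Z n) n) : ∃ D, homog n D = x := h

lemma eq_of_mem_intGrading {n : ℕ} {x y : AffDerAlg E Z}
    (hx : x ∈ intGrading (fun n => MultiAffDer E Z n) n)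
    (hy : y ∈ intGrading (fun n => MultiAffDer E Z n) n) (h : ∀ s, (x n).1 s = (y n).1 s) :
    x = y := by
  obtain ⟨D, rfl⟩ := exists_homog_of_mem hx
  obtain ⟨D', rfl⟩ := exists_homog_of_mem hy
  congr 1
  refine Subtype.ext (funext fun s => ?_)
  simpa only [homog, DirectSum.lof_eq_of, DirectSum.of_eq_same] using h s

end AffineMultiderivations

section AffineBracket

variable {E : Type*} [NormedAddCommGroup E] [NormedSpace ℝ E] [FiniteDimensional ℝ E]
  {M : Type*} [TopologicalSpace M] [ChartedSpace E M] [T2Space M] [IsManifold 𝓘(ℝ, E) ∞ M]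

variable {Z : M → Type*} [∀ p, AddTorsor ℝ (Z p)] [TopologicalSpace (TotalSpace ℝ Z)]
  [∀ p, TopologicalSpace (Z p)] [FiberBundle ℝ Z] [AffineLineBundle E Z] (σ : Sec E Z)

variable (E M) in
/-- The bracket `[(X, X'), (Y, Y')] = ([X, Y], [X', Y] - [ω X, Y'])` of pairs of multivector fields,
where `ω` is the grading involution. -/
def pairSchouten : (Multivector E M × Multivector E M) →ₗ[ℝ]
    (Multivector E M × Multivector E M) →ₗ[ℝ] Multivector E M × Multivector E M :=
  LinearMap.mk₂ ℝ (fun q r => (schouten E M q.1 r.1,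
      schouten E M q.2 r.1 - schouten E M (multivectorInv q.1) r.2))
    (fun q q' r => by
      simp only [Prod.fst_add, Prod.snd_add, map_add, LinearMap.add_apply, Prod.mk_add_mk]
      rw [add_sub_add_comm])
    (fun c q r => by
      have hc : multivectorInv (c • q.1) = c • multivectorInv q.1 := by
        rw [← algebraMap_smul (Smooth E M) c q.1, map_smul, algebraMap_smul]
      simp only [Prod.smul_fst, Prod.smul_snd, map_smul, hc, LinearMap.smul_apply, Prod.smul_mk,
        smul_sub])
    (fun q r r' => by
      simp only [Prod.fst_add, Prod.snd_add, map_add, Prod.mk_add_mk]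
      rw [add_sub_add_comm])
    (fun c q r => by
      simp only [Prod.smul_fst, Prod.smul_snd, map_smul, Prod.smul_mk, smul_sub])

/-- The bracket of `⋀ AffDer(Z, ℝ)`, by means of the identification given by a section. -/
def affBracket : AffDerAlg E Z →ₗ[ℝ] AffDerAlg E Z →ₗ[ℝ] AffDerAlg E Z :=
  ((pairSchouten E M).compl₁₂ (identification σ).symm.toLinearMap
    (identification σ).symm.toLinearMap).compr₂ (identification σ).toLinearMap

lemma affBracket_identification (X X' Y Y' : Multivector E M) :
    affBracket σ (identification σ (X, X')) (identification σ (Y, Y')) =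
      identification σ (schouten E M X Y,
        schouten E M X' Y - schouten E M (multivectorInv X) Y') := by
  simp [affBracket, pairSchouten]

lemma affBracket_identification_of_mem {n : ℤ} {X : Multivector E M}
    (h : X ∈ multivectorGrading E M n) (X' Y Y' : Multivector E M) :
    affBracket σ (identification σ (X, X')) (identification σ (Y, Y')) =
      identification σ (schouten E M X Y,
        schouten E M X' Y + (n - 1).negOnePow • schouten E M X Y') := by
  have e : ∀ {T : Type _} [AddCommGroup T] (S : T →+ T) (x y : T),
      y - S (n.negOnePow • x) = y + (n - 1).negOnePow • S x := by
    intro T _ S x y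
    simp only [negOnePow_smul_eq, Int.even_sub, Int.not_even_one]
    by_cases hn : Even n <;> simp [hn, sub_eq_add_neg]
  rw [affBracket_identification, multivectorInv_eq h]
  exact congrArg (fun W => identification σ (schouten E M X Y, W))
    (e ((schouten E M).flip Y').toAddMonoidHom X (schouten E M X' Y))

lemma isInternal_intGrading (σ : Sec E Z) :
    DirectSum.IsInternal (M := AffDerAlg E Z) (intGrading fun n => MultiAffDer E Z n) := by
  obtain ⟨N, hN⟩ := Contraction.pairVal_bounded (multivectorContraction_isFull E M)
  refine isInternal_of_hasDeg (T := AffDerAlg E Z) (affVal σ) (affVal_injective σ)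
    (fun n x => mem_intGrading σ)
    (fun x n => ⟨homog n (x n), funext fun l => ?_⟩) fun x => ⟨N, fun l hl => ?_⟩
  · split_ifs with hl
    · rw [affVal_eq σ _ hl, affVal_eq σ _ hl, homog, DirectSum.lof_eq_of, DirectSum.of_eq_same]
    · exact affVal_homog_of_ne σ _ hl
  · obtain ⟨q, rfl⟩ := (identification σ).surjective x
    rw [affVal_identification]
    exact hN q l hl

lemma exists_affWedge_unit (σ : Sec E Z) :
    ∃ e ∈ intGrading (fun n => MultiAffDer E Z n) 0, ∀ x : AffDerAlg E Z, affWedge e x = x ∧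
      affWedge x e = x := by
  have h1 : (1 : Multivector E M) ∈ multivectorGrading E M 0 := by
    rw [← map_one (algebraMap (Smooth E M) (Multivector E M))]
    exact mem_grading_zero fun p => rfl
  refine ⟨identification σ (1, 0), (identification_mem σ).2 ⟨h1, zero_mem _⟩, fun x => ?_⟩
  obtain ⟨⟨X, X'⟩, rfl⟩ := (identification σ).surjective x
  rw [affWedge_identification, affWedge_identification, map_one]
  simp only [zero_mul, mul_zero, one_mul, mul_one, zero_add, add_zero, and_self]

lemma isGerstenhaber_affBracket :
    IsGerstenhaber (intGrading fun n => MultiAffDer E Z n) affWedge (affBracket σ) :=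
  (isGerstenhaber_schouten E M).pair (Φ := identification σ)
    (fun _ _ _ => identification_mem σ)
    (fun _ _ hX _ _ _ => affWedge_identification_of_mem σ hX _ _ _)
    (isInternal_intGrading σ) (affWedge_assoc σ) (exists_affWedge_unit σ)
    (fun _ _ hX _ _ _ => affBracket_identification_of_mem σ hX _ _ _)

lemma isLocallyGenerated_affWedge :
    IsLocallyGenerated (intGrading fun n => MultiAffDer E Z n) affWedge
      (fun p => (fun X => identification σ (X, 0)) '' oneAt (E := E) (M := M) p) :=
  (isLocallyGenerated_multivector E M).pair (isGerstenhaber_schouten E M)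
    (fun _ _ _ => identification_mem σ)
    (fun _ _ hX _ _ _ => affWedge_identification_of_mem σ hX _ _ _) <| by
      rintro p _ ⟨χ, hχ, rfl⟩ _ ⟨ψ, hψ, rfl⟩
      refine ⟨χ * ψ, ?_, (map_mul (algebraMap _ _) χ ψ).symm⟩
      change χ p * ψ p = 1
      rw [hχ, hψ, mul_one]

/-- On an affine derivation the component `X'` contributes only a constant, which drops out of
differences. -/
lemma linearPart_eq {D : MultiAffDer E Z 1} {X X' : Multivector E M}
    (h : identification σ (X, X') = homog 1 D) (a : Sec E Z) (f : Smooth E M) :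
    linearPart (fun s => D.1 ![s]) a f = multivectorEv (multivectorCon f X) := by
  have e (s : Sec E Z) : D.1 ![s] = multivectorEv (multivectorCon ((vaddEquiv σ).symm s) X) -
      multivectorEv X' := by
    have h1 := affVal_homog σ D ![(vaddEquiv σ).symm s]
    rw [← h, affVal_identification] at h1
    have h2 : (fun i => vaddEquiv σ (![(vaddEquiv σ).symm s] i)) = ![s] := by
      funext i
      fin_cases i
      simp
    rw [h2] at h1
    rw [← h1]
    exact Contraction.pairVal_singleton (K := multivectorContraction) X X' _
  rw [linearPart, e, e, vaddEquiv_symm_vadd]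
  have hc : multivectorCon (f + (vaddEquiv σ).symm a) X =
      multivectorCon f X + multivectorCon ((vaddEquiv σ).symm a) X :=
    multivectorContraction.con_add _ _ X
  rw [hc, map_add]
  ring

lemma affBracket_one_one (D₁ D₂ : MultiAffDer E Z 1) (a : Sec E Z) :
    ((affBracket σ (homog 1 D₁) (homog 1 D₂)) 1).1 ![a] =
      linearPart (fun s => D₁.1 ![s]) a (D₂.1 ![a]) -
        linearPart (fun s => D₂.1 ![s]) a (D₁.1 ![a]) := by
  obtain ⟨X, hX, X', -, h₁⟩ := exists_of_mem_intGrading σ (homog_mem D₁)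
  obtain ⟨Y, hY, Y', -, h₂⟩ := exists_of_mem_intGrading σ (homog_mem D₂)
  have ha : (fun i => vaddEquiv σ (![(vaddEquiv σ).symm a] i)) = ![a] := by
    funext i
    fin_cases i
    simp
  have e₁ := affVal_homog σ D₁ ![(vaddEquiv σ).symm a]
  have e₂ := affVal_homog σ D₂ ![(vaddEquiv σ).symm a]
  have e := affVal_ofFn σ (affBracket σ (homog 1 D₁) (homog 1 D₂)) ![(vaddEquiv σ).symm a]
  rw [ha, ← h₁, affVal_identification] at e₁
  rw [ha, ← h₂, affVal_identification] at e₂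
  rw [linearPart_eq σ h₁, linearPart_eq σ h₂]
  rw [ha, ← h₁, ← h₂, affBracket_identification, affVal_identification] at e
  rw [← h₁, ← h₂, affBracket_identification, ← e, ← e₁, ← e₂]
  exact Contraction.pairVal_bracket_singleton (multivectorContraction_isFull E M)
    (multivectorEv_eq_zero hX) (multivectorEv_eq_zero hY) X' Y' _

lemma affBracket_one_zero (D : MultiAffDer E Z 1) (F : MultiAffDer E Z 0) (a : Sec E Z) :
    ((affBracket σ (homog 1 D) (homog 0 F)) 0).1 ![] =
      linearPart (fun s => D.1 ![s]) a (F.1 ![]) := by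
  obtain ⟨X, hX, X', -, h₁⟩ := exists_of_mem_intGrading σ (homog_mem D)
  obtain ⟨Y, hY, Y', -, h₂⟩ := exists_of_mem_intGrading σ (homog_mem F)
  have e₂ := affVal_homog σ F ![]
  have e := affVal_ofFn σ (affBracket σ (homog 1 D) (homog 0 F)) ![]
  rw [← h₂, affVal_identification] at e₂
  rw [← h₁, ← h₂, affBracket_identification, affVal_identification] at e
  have hF : F.1 ![] = multivectorEv Y := by
    rw [Subsingleton.elim ![] (fun i => vaddEquiv σ (![] i)), ← e₂]
    exact Contraction.pairVal_nil (K := multivectorContraction) Y Y'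
  rw [linearPart_eq σ h₁, hF, ← h₁, ← h₂, affBracket_identification,
    Subsingleton.elim ![] (fun i => vaddEquiv σ (![] i)), ← e]
  refine (Contraction.pairVal_nil (K := multivectorContraction) _ _).trans ?_
  refine (multivectorEv_schouten X Y).trans ?_
  rw [multivectorEv_eq_zero hX, multivectorCon_zero, map_zero, sub_zero]

lemma isAffSchoutenNijenhuis_affBracket : IsAffSchoutenNijenhuis (affBracket σ) where
  gerstenhaber := isGerstenhaber_affBracket σ
  br_one_one := affBracket_one_one σ
  br_one_zero := affBracket_one_zero σ

/-- In degrees `0` and `1` the values are prescribed by the definition. A section serves for local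
generation, and as the base point at which the linear part is evaluated. -/
lemma IsAffSchoutenNijenhuis.eq [SigmaCompactSpace M]
    {br br' : AffDerAlg E Z →ₗ[ℝ] AffDerAlg E Z →ₗ[ℝ] AffDerAlg E Z}
    (h : IsAffSchoutenNijenhuis br) (h' : IsAffSchoutenNijenhuis br') : br = br' := by
  obtain ⟨σ⟩ := exists_sec (E := E) (Z := Z)
  refine h.gerstenhaber.br_unique h'.gerstenhaber (isLocallyGenerated_affWedge σ) rfl ?_ ?_
  · intro x hx y hy
    refine eq_of_mem_intGrading (n := 1) (h.gerstenhaber.br_mem 1 1 x hx y hy)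
      (h'.gerstenhaber.br_mem 1 1 x hx y hy) fun s => ?_
    obtain ⟨D, rfl⟩ := exists_homog_of_mem (n := 1) hx
    obtain ⟨D', rfl⟩ := exists_homog_of_mem (n := 1) hy
    have hs : s = ![s 0] := by
      funext i
      fin_cases i
      rfl
    rw [hs, h.br_one_one, h'.br_one_one]
  · intro x hx y hy
    refine eq_of_mem_intGrading (n := 0) (h.gerstenhaber.br_mem 1 0 x hx y hy)
      (h'.gerstenhaber.br_mem 1 0 x hx y hy) fun s => ?_
    obtain ⟨D, rfl⟩ := exists_homog_of_mem (n := 1) hx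
    obtain ⟨D', rfl⟩ := exists_homog_of_mem (n := 0) hy
    rw [Subsingleton.elim s ![], h.br_one_zero D D' σ, h'.br_one_zero D D' σ]

end AffineBracket

end AffGerst

end

theorem theorem2
    {E : Type*} [NormedAddCommGroup E] [NormedSpace ℝ E] [FiniteDimensional ℝ E]
    {M : Type*} [TopologicalSpace M] [T2Space M] [SigmaCompactSpace M]
    [ChartedSpace E M] [IsManifold 𝓘(ℝ, E) ∞ M]
    (Z : M → Type*) [∀ p, AddTorsor ℝ (Z p)] [TopologicalSpace (TotalSpace ℝ Z)]
    [∀ p, TopologicalSpace (Z p)] [FiberBundle ℝ Z] [AffGerst.AffineLineBundle E Z] :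
    -- the classical Schouten–Nijenhuis bracket of multivector fields is well defined
    (∃! S : AffGerst.Multivector E M →ₗ[ℝ] AffGerst.Multivector E M →ₗ[ℝ] AffGerst.Multivector E M,
      AffGerst.IsSchoutenNijenhuis S) ∧
    -- the canonical Gerstenhaber algebra structure
    (∃! br : AffGerst.AffDerAlg E Z →ₗ[ℝ] AffGerst.AffDerAlg E Z →ₗ[ℝ] AffGerst.AffDerAlg E Z,
      AffGerst.IsAffSchoutenNijenhuis br) ∧
    -- the identification given by a section; the pointwise product of multivector fields is `*`
    ∀ σ : AffGerst.Sec E Z,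
      ∃ Φ : (AffGerst.Multivector E M × AffGerst.Multivector E M) ≃ₗ[ℝ] AffGerst.AffDerAlg E Z,
        AffGerst.IsIdentification σ Φ ∧
        (∀ n : ℤ, ((AffGerst.multivectorGrading E M n).prod
            (AffGerst.multivectorGrading E M (n - 1))).map Φ.toLinearMap =
          AffGerst.intGrading (fun n => AffGerst.MultiAffDer E Z n) n) ∧
        (∀ n k : ℤ,
          ∀ X ∈ AffGerst.multivectorGrading E M n, ∀ X' ∈ AffGerst.multivectorGrading E M (n - 1),
          ∀ Y ∈ AffGerst.multivectorGrading E M k, ∀ Y' ∈ AffGerst.multivectorGrading E M (k - 1),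
            AffGerst.affWedge (Φ (X, X')) (Φ (Y, Y')) =
              Φ (X * Y, X' * Y + n.negOnePow • (X * Y'))) ∧
        (∀ S br, AffGerst.IsSchoutenNijenhuis S → AffGerst.IsAffSchoutenNijenhuis br →
          ∀ n k : ℤ,
          ∀ X ∈ AffGerst.multivectorGrading E M n, ∀ X' ∈ AffGerst.multivectorGrading E M (n - 1),
          ∀ Y ∈ AffGerst.multivectorGrading E M k, ∀ Y' ∈ AffGerst.multivectorGrading E M (k - 1),
            br (Φ (X, X')) (Φ (Y, Y')) =
              Φ (S X Y, S X' Y + (n - 1).negOnePow • S X Y')) := by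
  refine ⟨⟨AffGerst.schouten E M, AffGerst.isSchoutenNijenhuis_schouten E M, fun S hS =>
      hS.eq (AffGerst.isSchoutenNijenhuis_schouten E M)⟩, ?_, fun σ =>
    ⟨AffGerst.identification σ, AffGerst.isIdentification_identification σ, fun n => ?_,
      fun n k X hX X' _ Y _ Y' _ => AffGerst.affWedge_identification_of_mem σ hX X' Y Y',
      fun S br hS hbr n k X hX X' _ Y _ Y' _ => ?_⟩⟩
  · obtain ⟨σ⟩ := AffGerst.exists_sec (E := E) (Z := Z)
    exact ⟨AffGerst.affBracket σ, AffGerst.isAffSchoutenNijenhuis_affBracket σ, fun br hbr =>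
      hbr.eq (AffGerst.isAffSchoutenNijenhuis_affBracket σ)⟩
  · ext x
    constructor
    · rintro ⟨⟨X, X'⟩, ⟨hX, hX'⟩, rfl⟩
      exact (AffGerst.identification_mem σ).2 ⟨hX, hX'⟩
    · intro hx
      obtain ⟨X, hX, X', hX', rfl⟩ := AffGerst.exists_of_mem_intGrading σ hx
      exact ⟨(X, X'), ⟨hX, hX'⟩, rfl⟩
  · rw [hS.eq (AffGerst.isSchoutenNijenhuis_schouten E M),
      hbr.eq (AffGerst.isAffSchoutenNijenhuis_affBracket σ)]
    exact AffGerst.affBracket_identification_of_mem σ hX X' Y Y'
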